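/- **Theorem 1.2.** The unknotting number $u(K)$ of a knot $K$ in $S^3$ is the minimum number of crossing changes, interspersed with isotopy, that transform a diagram of $K$ to a diagram of the unknot. Let $5_1$ (the $(2,5)$ torus knot) and $8_2$ be the knots of the standard knot table. Let $K_5 = 5_1\#8_2$ be their connected sum, where $5_1$ and $8_2$ are each taken up to mirror image, with the mirror images chosen so that the signature satisfies $\sigma(K_5)=0$; such choices exist. Then $$u(5_1)=2,\qquad u(8_2)=2,\qquad u(K_5)\le 3 .$$ In particular $u(5_1\#8_2)<u(5_1)+u(8_2)$, so the unknotting number is not additive under connected sum for this pair. -/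

import Mathlib

/-!
Knots in the 3-sphere are presented by their oriented diagrams on the 2-sphere, up to Reidemeister
moves.  A knot diagram is recorded by its signed Gauss code: travel once along the knot and write
down, for each passage through a crossing, the name of the crossing, whether one passes over or
under, and the sign of the crossing.  A diagram on the sphere is determined by this code, and the
codes that arise from diagrams on the sphere are those whose associated closed surface has Euler
characteristic 2.
-/

namespace KnotTheory

/-- One passage of the knot through a crossing. The sign of a crossing is `1` when (direction of
the over strand, direction of the under strand) is a positively oriented basis of the plane. -/
@[ext] structure Pass where
  label : ℕ
  isOver : Bool
  sign : ℤˣ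
  deriving DecidableEq

/-- The other passage through the same crossing. -/
def Pass.other (p : Pass) : Pass := ⟨p.label, !p.isOver, p.sign⟩

/-- The passage after the crossing has been changed: over and under are exchanged, and the sign of
the crossing is reversed. -/
def Pass.flip (p : Pass) : Pass := ⟨p.label, !p.isOver, -p.sign⟩

/-- A (based) signed Gauss code. -/
abbrev GaussCode := List Pass

namespace GaussCode

/-- The cyclic predecessor of a position. -/
def prev (c : GaussCode) (i : Fin c.length) : Fin c.length :=
  ⟨(i + c.length - 1) % c.length, Nat.mod_lt _ i.pos⟩

/-- The cyclic successor of a position. -/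
def next (c : GaussCode) (i : Fin c.length) : Fin c.length :=
  ⟨(i + 1) % c.length, Nat.mod_lt _ i.pos⟩

/-- Every crossing is passed exactly twice, once over and once under, with a well-defined sign. -/
def IsValid (c : GaussCode) : Prop :=
  c.Nodup ∧ ∀ p ∈ c, p.other ∈ c ∧ ∀ q ∈ c, q.label = p.label → q = p ∨ q = p.other

/-- The edges of the underlying 4-valent graph are indexed by positions: edge `i` leads from the
passage at position `i` to the passage at position `next i`. A dart is an edge with a direction,
`true` for the direction of the knot. `head` is the position at which a dart arrives. -/
def head (c : GaussCode) (d : Fin c.length × Bool) : Fin c.length :=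
  if d.2 then next c d.1 else d.1

/-- The number `1` if the strand crossed at the end of the dart `d` runs from right to left as
seen along `d`, and `-1` if it runs from left to right. -/
def turn (c : GaussCode) (d : Fin c.length × Bool) : ℤˣ :=
  (c.get (head c d)).sign * (if (c.get (head c d)).isOver then 1 else -1) * (if d.2 then 1 else -1)

/-- Following the boundary of the face to the left of a dart: at the crossing at the end of the
dart `d` one turns left, onto the dart `d'` of the other strand. -/
def FaceStep (c : GaussCode) (d d' : Fin c.length × Bool) : Prop :=
  ∃ j, j ≠ head c d ∧ (c.get j).label = (c.get (head c d)).label ∧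
    d' = if turn c d = 1 then (j, true) else (prev c j, false)

/-- The faces, as classes of darts with the same face to their left. -/
def Face (c : GaussCode) : Type := Quot (FaceStep c)

/-- The code of a knot diagram on the 2-sphere: either there is no crossing, or `V - E + F = 2`,
where the diagram has `c.length / 2` crossings and `c.length` edges. -/
def IsKnotDiagram (c : GaussCode) : Prop :=
  IsValid c ∧ (c = [] ∨ 2 * Nat.card (Face c) = c.length + 4)

/-- The part of a strand with the two passages `p`, `q`, in this order if `t = 1` and in the
opposite order if `t = -1`. -/
def arc (t : ℤˣ) (p q : Pass) : GaussCode := if t = 1 then [p, q] else [q, p]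

/-- The elementary changes of Gauss codes: another base point, other names for the crossings, and
the three Reidemeister moves. They are to be applied only between codes of diagrams on the sphere;
between such codes the conditions on the signs say that the two (three) edges of a second (third)
Reidemeister move bound a bigon (a triangle) that is a face. -/
inductive Move : GaussCode → GaussCode → Prop
  | rotate (A B : GaussCode) : Move (A ++ B) (B ++ A)
  | relabel (f : ℕ → ℕ) (hf : Function.Injective f) (c : GaussCode) :
      Move c (c.map fun p => ⟨f p.label, p.isOver, p.sign⟩)
  /-- First Reidemeister move: a kink. -/
  | reidemeister1 (x : ℕ) (o : Bool) (s : ℤˣ) (A : GaussCode) :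
      Move ([⟨x, o, s⟩, ⟨x, !o, s⟩] ++ A) A
  /-- Second Reidemeister move, for strands with the same or with opposite directions. -/
  | reidemeister2 (x y : ℕ) (o : Bool) (s t : ℤˣ) (A B : GaussCode) :
      Move ([⟨x, o, s⟩, ⟨y, o, -s⟩] ++ A ++ arc t ⟨x, !o, s⟩ ⟨y, !o, -s⟩ ++ B) (A ++ B)
  /-- Third Reidemeister move. The top strand meets the middle strand in `x` and the bottom strand
  in `y`, and the middle strand meets the bottom strand in `z`. The directions `t`, `m`, `b` of the
  three strands are compared with the cyclic order `x`, `y`, `z` of the corners of the triangle,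
  and `e` is `1` if this order is counterclockwise. Here the strands are visited in the order
  top, middle, bottom. -/
  | reidemeister3 (x y z : ℕ) (e t m b sx sy sz : ℤˣ) (A B C : GaussCode)
      (hx : sx = -(e * t * m)) (hy : sy = e * t * b) (hz : sz = -(e * m * b)) :
      Move
        (arc t ⟨x, true, sx⟩ ⟨y, true, sy⟩ ++ A ++ arc m ⟨z, true, sz⟩ ⟨x, false, sx⟩ ++ B ++
          arc b ⟨y, false, sy⟩ ⟨z, false, sz⟩ ++ C)
        (arc (-t) ⟨x, true, sx⟩ ⟨y, true, sy⟩ ++ A ++ arc (-m) ⟨z, true, sz⟩ ⟨x, false, sx⟩ ++ B ++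
          arc (-b) ⟨y, false, sy⟩ ⟨z, false, sz⟩ ++ C)
  /-- Third Reidemeister move, with the strands visited in the order top, bottom, middle. -/
  | reidemeister3' (x y z : ℕ) (e t m b sx sy sz : ℤˣ) (A B C : GaussCode)
      (hx : sx = -(e * t * m)) (hy : sy = e * t * b) (hz : sz = -(e * m * b)) :
      Move
        (arc t ⟨x, true, sx⟩ ⟨y, true, sy⟩ ++ A ++ arc b ⟨y, false, sy⟩ ⟨z, false, sz⟩ ++ B ++
          arc m ⟨z, true, sz⟩ ⟨x, false, sx⟩ ++ C)
        (arc (-t) ⟨x, true, sx⟩ ⟨y, true, sy⟩ ++ A ++ arc (-b) ⟨y, false, sy⟩ ⟨z, false, sz⟩ ++ B ++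
          arc (-m) ⟨z, true, sz⟩ ⟨x, false, sx⟩ ++ C)

/-- Two diagrams represent the same knot: they are related by finitely many moves and inverses of
moves, all taking place among knot diagrams on the sphere. -/
def Isotopic : GaussCode → GaussCode → Prop :=
  Relation.EqvGen fun c d => IsKnotDiagram c ∧ IsKnotDiagram d ∧ Move c d

/-- Changing the crossing `x`. -/
def changeCrossing (c : GaussCode) (x : ℕ) : GaussCode :=
  c.map fun p => if p.label = x then p.flip else p

/-- The diagram `c` can be transformed to the diagram of the unknot without crossings by `n`
crossing changes, interspersed with isotopies. -/
inductive UnknotsIn : ℕ → GaussCode → Prop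
  | isotopy {c : GaussCode} (h : Isotopic c []) : UnknotsIn 0 c
  | change {n : ℕ} {c d : GaussCode} (h : Isotopic c d) {x : ℕ} (hx : ∃ p ∈ d, p.label = x)
      (hd : UnknotsIn n (changeCrossing d x)) : UnknotsIn (n + 1) c

/-- The unknotting number of the knot with diagram `c`: the minimum number of crossing changes,
interspersed with isotopies, that transform `c` to a diagram of the unknot (`⊤` if there is no
such transformation, as for a code that is not the code of a diagram on the sphere). -/
noncomputable def unknottingNumber (c : GaussCode) : ℕ∞ :=
  ⨅ (n : ℕ) (_ : UnknotsIn n c), (n : ℕ∞)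

/-- The unknotting number is an invariant of knots. -/
theorem unknottingNumber_eq_of_isotopic {c d : GaussCode} (h : Isotopic c d) :
    unknottingNumber c = unknottingNumber d := by
  have key : ∀ {c d : GaussCode}, Isotopic c d → ∀ n, UnknotsIn n d → UnknotsIn n c := by
    intro c d h n hn
    cases hn with
    | isotopy h' => exact .isotopy (h.trans _ _ _ h')
    | change h' hx hd => exact .change (h.trans _ _ _ h') hx hd
  have : ∀ n, UnknotsIn n c ↔ UnknotsIn n d := fun n => ⟨key (h.symm _ _) n, key h n⟩
  simp only [unknottingNumber, this]

/-- The mirror image: all crossings are changed. -/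
def mirror (c : GaussCode) : GaussCode := c.map Pass.flip

/-- The diagram of a connected sum: the arc at the base point of each of the disjoint diagrams `c`
and `d` is deleted, and the end points are joined so that the orientations match. -/
def connSum (c d : GaussCode) : GaussCode :=
  (c.map fun p => ⟨2 * p.label, p.isOver, p.sign⟩) ++
    (d.map fun p => ⟨2 * p.label + 1, p.isOver, p.sign⟩)

/-- The real 1-cycles on the 4-valent graph of the diagram, as functions on the edges: at each
crossing, the flow in equals the flow out. -/
def cycles (c : GaussCode) : Submodule ℝ (Fin c.length → ℝ) where
  carrier := {a | ∀ i j, i ≠ j → (c.get i).label = (c.get j).label →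
    a (prev c i) + a (prev c j) = a i + a j}
  zero_mem' := by intro i j _ _; simp
  add_mem' := by
    intro a b ha hb i j hij h
    have h1 := ha i j hij h
    have h2 := hb i j hij h
    simp only [Pi.add_apply]
    linarith
  smul_mem' := by
    intro r a ha i j hij h
    have h1 := ha i j hij h
    simp only [Pi.smul_apply, smul_eq_mul]
    rw [← mul_add, h1, mul_add]

/-- The coefficient of a 1-chain at the edge `i`. -/
def edge (c : GaussCode) (i : Fin c.length) : (Fin c.length → ℝ) →ₗ[ℝ] ℝ := LinearMap.proj i

/-- The Seifert form `(a, b) ↦ lk(a, b⁺)` of the Seifert surface `S` that Seifert's algorithm builds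
from the diagram (with the discs of the Seifert circles hanging below the diagram), on 1-cycles of
the diagram.

The knot together with the vertical segments at the crossings lies on `S`, and projects to the
diagram; so each 1-cycle of the diagram lifts to `S`. Every class in `H₁(S)` arises in this way,
and the cycles that become trivial are spanned by the Seifert circles. Push `b` off `S` in the
positive normal direction. In the projection `b⁺` then runs to the left of the knot, except that it
changes sides twice along the under strand at each crossing. The linking number is the signed count
of the crossings of `a` with `b⁺` at which `a` is above. Near a crossing with over passage at `i`
and under passage at `j` these are two: `b⁺` comes along one edge `k` of the under strand, and along
it passes below the edge `k` of `a` and below one edge of `a` on the over strand. Here `k` is the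
incoming edge if the crossing is positive and the outgoing edge if it is negative. -/
noncomputable def seifertForm (c : GaussCode) : LinearMap.BilinForm ℝ (Fin c.length → ℝ) :=
  ∑ i : Fin c.length, ∑ j : Fin c.length,
    if (c.get i).label = (c.get j).label ∧ (c.get i).isOver = true ∧ (c.get j).isOver = false then
      if (c.get i).sign = 1 then
        LinearMap.BilinForm.linMulLin (edge c i - edge c (prev c j)) (edge c (prev c j))
      else
        LinearMap.BilinForm.linMulLin (edge c j - edge c (prev c i)) (edge c j)
    else 0

/-- The quadratic form `a ↦ lk(a, a⁺)` on the 1-cycles of the diagram. It is one half of the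
quadratic form of the symmetrized Seifert matrix `V + Vᵀ`, pulled back along a surjection. -/
noncomputable def seifertQuadraticForm (c : GaussCode) : QuadraticForm ℝ (cycles c) :=
  (LinearMap.BilinMap.toQuadraticMap (seifertForm c)).restrict (cycles c)

/-- The signature of the knot with diagram `c`: the signature of the symmetrized Seifert form
(negative for positive torus knots). -/
noncomputable def signature (c : GaussCode) : ℤ :=
  (_root_.sigPos (seifertQuadraticForm c) : ℤ) - (_root_.sigNeg (seifertQuadraticForm c) : ℤ)

/-- The standard diagram of the knot `5₁`, the torus knot of type `(2, 5)`: the closure of the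
2-strand braid `σ₁⁵`, with positive crossings. -/
def fiveOne : GaussCode :=
  [⟨1, true, 1⟩, ⟨2, false, 1⟩, ⟨3, true, 1⟩, ⟨4, false, 1⟩, ⟨5, true, 1⟩,
   ⟨1, false, 1⟩, ⟨2, true, 1⟩, ⟨3, false, 1⟩, ⟨4, true, 1⟩, ⟨5, false, 1⟩]

/-- The standard diagram of the knot `8₂`: the alternating diagram with Dowker-Thistlethwaite code
`4 10 12 14 16 2 6 8`, six positive and two negative crossings (crossing `k` is the one passed
at the odd time `2 k - 1`). -/
def eightTwo : GaussCode :=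
  [⟨1, true, 1⟩, ⟨6, false, -1⟩, ⟨2, true, -1⟩, ⟨1, false, 1⟩,
   ⟨3, true, 1⟩, ⟨7, false, 1⟩, ⟨4, true, 1⟩, ⟨8, false, 1⟩,
   ⟨5, true, 1⟩, ⟨2, false, -1⟩, ⟨6, true, -1⟩, ⟨3, false, 1⟩,
   ⟨7, true, 1⟩, ⟨4, false, 1⟩, ⟨8, true, 1⟩, ⟨5, false, 1⟩]

end GaussCode

end KnotTheory

/-! The upper bounds are certificates: explicit sequences of Reidemeister moves and crossing changes
that end at the empty code, with two changes for `5₁`, for `8₂` and for their mirror images, and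
three for each of the sums `5₁ # m(8₂)` and `m(5₁) # 8₂`. Codes are turned into lists of natural
numbers, and `unknotsN` replays a sequence on them, checking that every intermediate code is a
diagram on the sphere. By `unknotsIn_of_unknotsN` a successful replay is a genuine unknotting; the
replay itself is evaluated by the kernel.

The lower bounds `2 ≤ u` come from a signature. Seifert circles are rearranged by Reidemeister
moves, so the invariant is taken instead from `strandForm`, a quadratic function on 1-cycles without
reference to them: each crossing contributes its sign times the product of the coefficient sums
along its two strands. A first Reidemeister move adds or removes plus or minus a square, a second
one a hyperbolic plane, and a third one is absorbed by a linear change of parameters. Hence, with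
`p` and `q` the positive and negative indices, `2 * (p - q)` minus twice the writhe is a knot
invariant (`Isotopic.hasSignature_iff`). A crossing change preserves the function on a hyperplane,
so each index moves by at most 1 and the invariant by at most 8 (`HasSignature.of_changeCrossing`).
An unknotting with `n` changes therefore forces `|k| ≤ 8 * n`, whereas explicit diagonalizations
give `8 < |k|` for both knots.

The Seifert signature serves to select the mirror images. Written as sums of squares, the Seifert
forms of the sums show that it vanishes for `5₁ # m(8₂)` and does not vanish if neither or both of
the knots are mirrored. So signature zero leaves only the two sums for which there is a certificate.
-/

namespace KnotTheory
namespace GaussCode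

/-! ### Numerical encoding of Gauss codes -/

/-- The unit `1` or `-1`. -/
def unitOf (b : Bool) : ℤˣ := bif b then 1 else -1

/-- The number encoding a passage. -/
def code (x : ℕ) (o s : Bool) : ℕ := 4 * x + 2 * o.toNat + s.toNat

/-- Is the passage an over passage? -/
def overBit (n : ℕ) : Bool := Nat.beq (n / 2 % 2) 1

/-- Is the crossing positive? -/
def signBit (n : ℕ) : Bool := Nat.beq (n % 2) 1

/-- The passage with a given number. -/
def decode (n : ℕ) : Pass := ⟨n / 4, overBit n, unitOf (signBit n)⟩

/-- The Gauss code with given numbers. -/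
abbrev decodeList (l : List ℕ) : GaussCode := l.map decode

theorem unitOf_injective : Function.Injective unitOf := by decide

theorem unitOf_not (b : Bool) : unitOf (!b) = -unitOf b := by cases b <;> rfl

theorem decode_code (x : ℕ) (o s : Bool) : decode (code x o s) = ⟨x, o, unitOf s⟩ := by
  have h1 : code x o s / 4 = x := by cases o <;> cases s <;> simp [code] <;> omega
  have h2 : overBit (code x o s) = o := by
    cases o <;> cases s <;> simp only [code, overBit, Bool.toNat_true, Bool.toNat_false] <;> first
      | (rw [Nat.beq_eq]; omega)
      | (rw [← Bool.not_eq_true, Nat.beq_eq]; omega)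
  have h3 : signBit (code x o s) = s := by
    cases o <;> cases s <;> simp only [code, signBit, Bool.toNat_true, Bool.toNat_false] <;> first
      | (rw [Nat.beq_eq]; omega)
      | (rw [← Bool.not_eq_true, Nat.beq_eq]; omega)
  simp [decode, h1, h2, h3]

theorem exists_code (n : ℕ) : ∃ x o s, n = code x o s := by
  have h : n % 4 < 4 := Nat.mod_lt _ (by norm_num)
  have e := Nat.div_add_mod n 4
  generalize n % 4 = r at h e
  interval_cases r
  · exact ⟨n / 4, false, false, by simp [code]; omega⟩
  · exact ⟨n / 4, false, true, by simp [code]; omega⟩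
  · exact ⟨n / 4, true, false, by simp [code]; omega⟩
  · exact ⟨n / 4, true, true, by simp [code]; omega⟩

theorem decode_injective : Function.Injective decode := by
  intro a b h
  obtain ⟨x, o, s, rfl⟩ := exists_code a
  obtain ⟨x', o', s', rfl⟩ := exists_code b
  simp only [decode_code, Pass.mk.injEq] at h
  obtain ⟨rfl, rfl, hs⟩ := h
  rw [unitOf_injective hs]

/-- The number of the other passage through the same crossing. -/
def otherN (n : ℕ) : ℕ := bif overBit n then n - 2 else n + 2

theorem decode_otherN (n : ℕ) : decode (otherN n) = (decode n).other := by
  obtain ⟨x, o, s, rfl⟩ := exists_code n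
  have : otherN (code x o s) = code x (!o) s := by
    have h : overBit (code x o s) = o := congrArg Pass.isOver (decode_code x o s)
    unfold otherN
    rw [h]
    cases o <;> simp [code] <;> omega
  rw [this, decode_code, decode_code]; rfl

theorem otherN_ne (n : ℕ) : otherN n ≠ n := by
  intro h
  have := congrArg Pass.isOver ((decode_otherN n).symm.trans (congrArg decode h))
  simp [Pass.other] at this

theorem otherN_div (n : ℕ) : otherN n / 4 = n / 4 :=
  congrArg Pass.label (decode_otherN n)

/-! ### Primitive list operations, in a form suited to evaluation in the kernel -/

/-- Membership test. -/
def memN (x : ℕ) (l : List ℕ) : Bool :=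
  List.rec false (fun y _ r => bif Nat.beq x y then true else r) l

/-- Index of the first occurrence. -/
def idxN (x : ℕ) (l : List ℕ) : ℕ := List.rec (motive := fun _ => ℕ → ℕ) (fun n => n)
  (fun y _ r n => bif Nat.beq x y then n else r (Nat.succ n)) l 0

/-- Entry at an index. -/
def getN (l : List ℕ) : ℕ → ℕ := List.rec (motive := fun _ => ℕ → ℕ) (fun _ => 0)
  (fun y _ r n => Nat.casesOn n y r) l

/-- Equality test. -/
def eqN : List ℕ → List ℕ → Bool
  | [], [] => true
  | x :: l, y :: m => bif Nat.beq x y then eqN l m else false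
  | _, _ => false

/-- Evaluate a number before passing it on. -/
def forceNat (n : ℕ) (k : ℕ → Bool) : Bool := Nat.casesOn n (k 0) fun m => k (m + 1)

/-- Evaluate a list before passing it on. -/
def forceList : List ℕ → (List ℕ → Bool) → Bool
  | [], k => k []
  | x :: t, k => forceNat x fun y => forceList t fun s => k (y :: s)

theorem memN_iff {x : ℕ} {l : List ℕ} : memN x l = true ↔ x ∈ l := by
  induction l with
  | nil => simp [memN]
  | cons y l ih =>
    change (bif Nat.beq x y then true else memN x l) = true ↔ _
    by_cases h : x = y
    · simp [h]
    · have : Nat.beq x y = false := by rw [← Bool.not_eq_true, Nat.beq_eq]; exact h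
      simp [this, ih, h]

theorem getN_eq (l : List ℕ) (i : ℕ) (h : i < l.length) : getN l i = l[i] := by
  induction l generalizing i with
  | nil => simp at h
  | cons y l ih =>
    cases i with
    | zero => rfl
    | succ i => exact ih i (by simpa using h)

theorem idxN_eq (l : List ℕ) (hl : l.Nodup) (i : ℕ) (h : i < l.length) : idxN l[i] l = i := by
  have key : ∀ (l : List ℕ), l.Nodup → ∀ (i n : ℕ) (h : i < l.length),
      List.rec (motive := fun _ => ℕ → ℕ) (fun n => n)
        (fun y _ r n => bif Nat.beq l[i] y then n else r (Nat.succ n)) l n = n + i := by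
    intro l hl
    induction l with
    | nil => intro i n h; simp at h
    | cons y l ih =>
      intro i n h
      cases i with
      | zero =>
        simp
      | succ i =>
        have hi : i < l.length := by simpa using h
        have : Nat.beq l[i] y = false := by
          rw [← Bool.not_eq_true, Nat.beq_eq]
          rintro rfl
          exact (List.nodup_cons.1 hl).1 (List.getElem_mem hi)
        simp only [List.getElem_cons_succ, this, cond_false]
        rw [ih hl.of_cons i (Nat.succ n) hi]
        omega
  exact (key l hl i 0 h).trans (Nat.zero_add i)

theorem eqN_eq {l m : List ℕ} (h : eqN l m = true) : l = m := by
  induction l generalizing m with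
  | nil => cases m <;> simp_all [eqN]
  | cons x l ih =>
    cases m with
    | nil => simp [eqN] at h
    | cons y m =>
      rw [eqN] at h
      by_cases hxy : x = y
      · have : Nat.beq x y = true := by rw [Nat.beq_eq]; exact hxy
        rw [this] at h
        rw [hxy, ih h]
      · have : Nat.beq x y = false := by rw [← Bool.not_eq_true, Nat.beq_eq]; exact hxy
        simp [this] at h

/-- Logically the forcing functions are plain application. The case distinction on the argument only
makes the kernel reduce it to a numeral before continuing, so that unevaluated terms do not pile up.
-/
theorem forceNat_eq (n : ℕ) (k : ℕ → Bool) : forceNat n k = k n := by cases n <;> rfl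

theorem forceList_eq (l : List ℕ) (k : List ℕ → Bool) : forceList l k = k l := by
  induction l generalizing k with
  | nil => rfl
  | cons x t ih => rw [forceList, forceNat_eq, ih]

/-! ### Recognizing knot diagrams -/

/-- Every crossing is passed twice. -/
def validN (l : List ℕ) : Bool :=
  l.all fun p => memN (otherN p) l && Nat.beq (l.countP fun q => Nat.beq (q / 4) (p / 4)) 2

/-- The entries with the label of `p` number exactly two, and `p` and `otherN p` are two different
ones among them, so these are all. A repetition of `p` would show up in this filtered list, whence
the absence of duplicates. -/
theorem validN.spec {l : List ℕ} (h : validN l = true) :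
    l.Nodup ∧ ∀ p ∈ l, otherN p ∈ l ∧ ∀ q ∈ l, q / 4 = p / 4 → q = p ∨ q = otherN p := by
  have key : ∀ p ∈ l, otherN p ∈ l ∧
      List.Perm [p, otherN p] (l.filter fun q => Nat.beq (q / 4) (p / 4)) := by
    intro p hp
    have h1 := List.all_eq_true.1 h p hp
    rw [Bool.and_eq_true, memN_iff, Nat.beq_eq, List.countP_eq_length_filter] at h1
    refine ⟨h1.1, List.Subperm.perm_of_length_le (List.Nodup.subperm ?_ ?_) ?_⟩
    · simpa using (otherN_ne p).symm
    · intro q hq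
      simp only [List.mem_cons, List.not_mem_nil, or_false] at hq
      rcases hq with rfl | rfl
      · simpa [List.mem_filter] using hp
      · simpa [List.mem_filter, otherN_div] using h1.1
    · rw [h1.2]; rfl
  refine ⟨List.nodup_iff_count_le_one.2 fun p => ?_, fun p hp => ⟨(key p hp).1, fun q hq hqp => ?_⟩⟩
  · by_cases hp : p ∈ l
    · have h2 : (l.filter fun q => Nat.beq (q / 4) (p / 4)).Nodup :=
        (key p hp).2.nodup_iff.1 (by simpa using (otherN_ne p).symm)
      have h3 := List.nodup_iff_count_le_one.1 h2 p
      rwa [List.count_filter (by simp)] at h3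
    · rw [List.count_eq_zero_of_not_mem hp]; exact Nat.zero_le _
  · have : q ∈ [p, otherN p] := (key p hp).2.mem_iff.2 (by simpa [List.mem_filter] using ⟨hq, hqp⟩)
    simpa using this

/-- Rotations and third Reidemeister moves only permute the entries, so for them validity is
inherited and need not be evaluated again. -/
theorem validN.of_perm {l m : List ℕ} (h : l.Perm m) (hl : validN l = true) : validN m = true := by
  rw [validN, List.all_eq_true] at hl ⊢
  intro p hp
  have := hl p (h.mem_iff.2 hp)
  rwa [Bool.and_eq_true, memN_iff, h.mem_iff, ← memN_iff, h.countP_eq, ← Bool.and_eq_true] at this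

theorem isValid_decodeList {l : List ℕ} (h : validN l = true) : IsValid (decodeList l) := by
  obtain ⟨h1, h2⟩ := validN.spec h
  refine ⟨h1.map decode_injective, ?_⟩
  intro p hp
  obtain ⟨n, hn, rfl⟩ := List.mem_map.1 hp
  refine ⟨?_, ?_⟩
  · rw [← decode_otherN]; exact List.mem_map_of_mem (h2 n hn).1
  · intro q hq hqp
    obtain ⟨m, hm, rfl⟩ := List.mem_map.1 hq
    rw [← decode_otherN]
    rcases (h2 n hn).2 m hm hqp with h | h
    · exact Or.inl (by rw [h])
    · exact Or.inr (by rw [h])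

/-! ### Moving the base point -/

theorem next_prev (c : GaussCode) (i : Fin c.length) : next c (prev c i) = i := by
  have h := i.2
  apply Fin.ext
  change ((i + c.length - 1) % c.length + 1) % c.length = i
  rw [Nat.mod_add_mod, Nat.sub_add_cancel (by omega), Nat.add_mod_right, Nat.mod_eq_of_lt h]

theorem prev_next (c : GaussCode) (i : Fin c.length) : prev c (next c i) = i := by
  have h := i.2
  apply Fin.ext
  change ((i + 1) % c.length + c.length - 1) % c.length = i
  rw [Nat.add_sub_assoc (by omega), Nat.mod_add_mod,
    show (i : ℕ) + 1 + (c.length - 1) = i + c.length by omega,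
    Nat.add_mod_right, Nat.mod_eq_of_lt h]

theorem map_prev_of_map_next {c d : GaussCode} (e : Fin c.length ≃ Fin d.length)
    (hnext : ∀ i, e (next c i) = next d (e i)) (i : Fin c.length) : e (prev c i) = prev d (e i) := by
  rw [← prev_next d (e (prev c i)), ← hnext, next_prev]

/-- Faces depend only on the cyclic succession of the passages, so a bijection of positions that
respects passages and successors carries face steps to face steps. -/
theorem FaceStep.map {c d : GaussCode} (e : Fin c.length ≃ Fin d.length)
    (hget : ∀ i, d.get (e i) = c.get i) (hnext : ∀ i, e (next c i) = next d (e i))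
    {x y : Fin c.length × Bool} (h : FaceStep c x y) :
    FaceStep d (e x.1, x.2) (e y.1, y.2) := by
  have hhead : head d (e x.1, x.2) = e (head c x) := by
    obtain ⟨i, b⟩ := x
    cases b <;> simp [head, hnext]
  have hturn : turn d (e x.1, x.2) = turn c x := by simp only [turn, hhead, hget]
  obtain ⟨j, hj, hl, rfl⟩ := h
  refine ⟨e j, ?_, ?_, ?_⟩
  · rw [hhead]; exact fun h => hj (e.injective h)
  · rw [hhead, hget, hget]; exact hl
  · rw [hturn]
    by_cases h : turn c x = 1
    · simp [h]
    · simp [h, map_prev_of_map_next e hnext]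

theorem card_face_congr {c d : GaussCode} (e : Fin c.length ≃ Fin d.length)
    (hget : ∀ i, d.get (e i) = c.get i) (hnext : ∀ i, e (next c i) = next d (e i)) :
    Nat.card (Face c) = Nat.card (Face d) := by
  refine Nat.card_congr (Quot.congr (e.prodCongr (Equiv.refl Bool)) fun x y =>
    ⟨FaceStep.map e hget hnext, fun h => ?_⟩)
  have := FaceStep.map e.symm (fun i => by rw [← hget, e.apply_symm_apply])
    (fun i => by rw [e.symm_apply_eq, hnext, e.apply_symm_apply]) h
  simpa using this

theorem IsValid.of_perm {c d : GaussCode} (h : c.Perm d) (hc : IsValid c) : IsValid d :=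
  ⟨h.nodup_iff.1 hc.1, fun p hp => by
    simpa only [h.mem_iff] using hc.2 p (h.mem_iff.2 hp)⟩

theorem card_face_rotate_one (p : Pass) (t : GaussCode) :
    Nat.card (Face (t ++ [p])) = Nat.card (Face (p :: t)) := by
  have hlen : (t ++ [p]).length = (p :: t).length := by simp
  -- Every position moves up by one; cyclically, the last position, occupied by `p`, goes to
  -- position 0.
  let f : Fin (t ++ [p]).length → Fin (p :: t).length := fun i => next _ (Fin.cast hlen i)
  have hf : Function.Bijective f := by
    refine (Fintype.bijective_iff_injective_and_card f).2 ⟨fun i j hij => ?_, by simp⟩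
    have := congrArg (prev _) hij
    rw [prev_next, prev_next] at this
    exact Fin.cast_injective _ this
  refine card_face_congr (Equiv.ofBijective f hf) (fun i => ?_) (fun i => ?_)
  · obtain ⟨i, hi⟩ := i
    simp only [Equiv.ofBijective_apply, f, next, List.get_eq_getElem, Fin.val_cast]
    rw [List.length_append, List.length_singleton] at hi
    rcases Nat.lt_succ_iff_lt_or_eq.1 hi with h | rfl
    · have : (i + 1) % (p :: t).length = i + 1 := Nat.mod_eq_of_lt (by simpa using h)
      simp only [this, List.getElem_append_left h, List.getElem_cons_succ]
    · simp
  · simp only [Equiv.ofBijective_apply, f, next, Fin.val_cast, hlen]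

/-- The base point moves past one passage at a time. This makes it unnecessary to count faces again
after a rotation. -/
theorem IsKnotDiagram.rotate {A B : GaussCode} (h : IsKnotDiagram (A ++ B)) :
    IsKnotDiagram (B ++ A) := by
  induction A generalizing B with
  | nil => simpa using h
  | cons p t ih =>
    have h1 : IsKnotDiagram ((t ++ B) ++ [p]) := by
      refine ⟨h.1.of_perm (List.perm_append_singleton p (t ++ B)).symm, Or.inr ?_⟩
      rcases h.2 with h2 | h2
      · simp at h2
      · rw [card_face_rotate_one, ← List.cons_append, h2]; simp; omega
    rw [List.append_assoc] at h1
    simpa using ih h1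


/-! ### Counting faces -/

/-- The next dart along a face. The dart `(i, b)` has the number `2 * i + b`. -/
def stepN (l : List ℕ) (N x : ℕ) : ℕ :=
  let h := bif Nat.beq (x % 2) 1 then (x / 2 + 1) % N else x / 2
  let v := getN l h
  let j := idxN (otherN v) l
  bif Nat.beq ((v + v / 2 + x) % 2) 1 then 2 * j + 1 else 2 * ((j + N - 1) % N)

/-- The orbit of a dart. -/
def orbit (l : List ℕ) (N f : ℕ) : ℕ → ℕ → List ℕ
  | 0, x => [x]
  | n + 1, x => bif Nat.beq (stepN l N x) f then [x] else x :: orbit l N f n (stepN l N x)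

/-- The orbits of a list of darts. -/
def orbits (l : List ℕ) (N : ℕ) : ℕ → List ℕ → List (List ℕ)
  | 0, _ => []
  | _ + 1, [] => []
  | n + 1, x :: r =>
    let o := orbit l N x (2 * N) x
    o :: orbits l N n (r.filter fun y => !memN y o)

/-- Is the list of darts a cycle of `stepN`? -/
def chainN (l : List ℕ) (N f : ℕ) : List ℕ → Bool
  | [] => true
  | [x] => Nat.beq (stepN l N x) f
  | x :: y :: t => Nat.beq (stepN l N x) y && chainN l N f (y :: t)

/-- Only members of the recorded orbit are ever discarded, and it contains its starting dart; so
every dart is covered, whether or not the computed lists are true orbits. That they are is tested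
separately by `partsN`. -/
theorem mem_flatten_orbits (l : List ℕ) (N n : ℕ) (r : List ℕ) (hn : r.length ≤ n) (y : ℕ)
    (hy : y ∈ r) : y ∈ (orbits l N n r).flatten := by
  induction n generalizing r with
  | zero => simp [List.length_eq_zero_iff.1 (Nat.le_zero.1 hn)] at hy
  | succ n ih =>
    cases r with
    | nil => simp at hy
    | cons x r =>
      simp only [orbits, List.flatten_cons, List.mem_append]
      by_cases h : y ∈ orbit l N x (2 * N) x
      · exact Or.inl h
      · right
        have hx : x ∈ orbit l N x (2 * N) x := by
          cases N with
          | zero => simp [orbit]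
          | succ N => rw [Nat.mul_succ, orbit]; cases Nat.beq (stepN l (N + 1) x) x <;> simp
        refine ih _ ((List.length_filter_le _ _).trans (Nat.le_of_succ_le_succ hn)) ?_
        rw [List.mem_filter]
        refine ⟨(List.mem_cons.1 hy).resolve_left fun hyx => h (hyx ▸ hx), ?_⟩
        rw [Bool.not_eq_true', ← Bool.not_eq_true, memN_iff]
        exact h

/-- Are the members of `P` the faces of a diagram on the sphere, if every dart is in one? -/
def partsN (l : List ℕ) (N : ℕ) (P : List (List ℕ)) : Bool :=
  (P.all fun o => match o with | [] => false | x :: t => chainN l N x (x :: t)) &&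
    Nat.beq (P.flatten.length) (2 * N) && Nat.beq (2 * P.length) (N + 4)

/-- Does the code, if valid, belong to a diagram on the sphere? -/
def sphereN (l : List ℕ) : Bool :=
  l.isEmpty || partsN l l.length (orbits l l.length (2 * l.length) (List.range (2 * l.length)))

section Faces

variable {l : List ℕ}

/-- The number of a dart. -/
def dartN (d : Fin (decodeList l).length × Bool) : ℕ := 2 * d.1 + d.2.toNat

theorem dartN_injective : Function.Injective (dartN (l := l)) := by
  rintro ⟨i, b⟩ ⟨j, c⟩ h
  have : (i : ℕ) = j ∧ b = c := by
    cases b <;> cases c <;> simp only [dartN, Bool.toNat_true, Bool.toNat_false] at h <;>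
      first | omega | (refine ⟨by omega, rfl⟩)
  exact Prod.ext (Fin.ext this.1) this.2

theorem dartN_lt (d : Fin (decodeList l).length × Bool) : dartN d < 2 * l.length := by
  have h1 : (d.1 : ℕ) < l.length := by simpa using d.1.2
  have h2 : d.2.toNat < 2 := by cases d.2 <;> simp
  unfold dartN; omega

theorem exists_dartN {x : ℕ} (h : x < 2 * l.length) :
    ∃ d : Fin (decodeList l).length × Bool, dartN d = x := by
  refine ⟨(⟨x / 2, by simp; omega⟩, decide (x % 2 = 1)), ?_⟩
  by_cases hx : x % 2 = 1 <;> simp [dartN, hx] <;> omega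

/-- A product of three signs is 1 exactly when an odd number of them are positive. For `v = 4 * x +
2 * o + s` the sum `v + v / 2` has the parity of `s + o`, and the number of the dart contributes the
direction bit. -/
theorem turn_eq_one_iff (d : Fin (decodeList l).length × Bool) (v : ℕ)
    (hv : (decodeList l).get (head _ d) = decode v) :
    turn _ d = 1 ↔ (v + v / 2 + dartN d) % 2 = 1 := by
  obtain ⟨x, o, s, rfl⟩ := exists_code v
  unfold turn
  rw [hv, decode_code]
  obtain ⟨i, b⟩ := d
  have e : ∀ o s b : Bool, (unitOf s * (if o = true then 1 else -1) *
      (if b = true then 1 else -1) : ℤˣ) = 1 ↔ (s.toNat + o.toNat + b.toNat) % 2 = 1 := by decide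
  simp only [e, dartN, code]
  cases o <;> cases s <;> cases b <;> simp <;> omega

/-- In a valid code the other passage of a crossing is unique, so the relation `FaceStep` is the
graph of a function, computed by `stepN`. -/
theorem dartN_of_faceStep (hl : validN l = true) {d d' : Fin (decodeList l).length × Bool}
    (h : FaceStep _ d d') : dartN d' = stepN l l.length (dartN d) := by
  obtain ⟨j, hj, hlab, rfl⟩ := h
  have hlen : (decodeList l).length = l.length := List.length_map _
  have hx2 : (dartN d) / 2 = d.1 := by
    obtain ⟨i, b⟩ := d; cases b <;> simp [dartN]; omega
  have hh : (bif Nat.beq (dartN d % 2) 1 then (dartN d / 2 + 1) % l.length else dartN d / 2) =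
      (head _ d : ℕ) := by
    rw [hx2]
    obtain ⟨i, b⟩ := d
    cases b
    · have : Nat.beq (dartN (i, false) % 2) 1 = false := by
        rw [← Bool.not_eq_true, Nat.beq_eq]; simp [dartN]
      simp [this, head]
    · have : Nat.beq (dartN (i, true) % 2) 1 = true := by rw [Nat.beq_eq]; simp [dartN]
      simp [this, head, next]
  have hlt : (head _ d : ℕ) < l.length := hlen ▸ (head _ d).2
  have hjlt : (j : ℕ) < l.length := hlen ▸ j.2
  have hv : (decodeList l).get (head _ d) = decode l[(head _ d : ℕ)] := by simp
  obtain ⟨hnd, hval⟩ := validN.spec hl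
  have hj2 : l[(j : ℕ)] = otherN l[(head _ d : ℕ)] := by
    rcases (hval _ (List.getElem_mem hlt)).2 _ (List.getElem_mem hjlt)
      (by simpa [decode] using hlab) with h | h
    · exact absurd (Fin.ext ((hnd.getElem_inj_iff).1 h)) hj
    · exact h
  unfold stepN
  simp only [hh, getN_eq l _ hlt, ← hj2, idxN_eq l hnd _ hjlt]
  by_cases ht : turn _ d = 1
  · have h1 := (turn_eq_one_iff d _ hv).1 ht
    rw [← Nat.beq_eq] at h1
    rw [if_pos ht, h1]
    simp [dartN]
  · have h1 := mt (turn_eq_one_iff d _ hv).2 ht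
    rw [← Nat.beq_eq, Bool.not_eq_true] at h1
    rw [if_neg ht, h1]
    simp [dartN, prev]

theorem exists_faceStep (hl : validN l = true) (d : Fin (decodeList l).length × Bool) :
    ∃ d', FaceStep _ d d' := by
  obtain ⟨hnd, hval⟩ := isValid_decodeList hl
  set p := (decodeList l).get (head _ d) with hp
  obtain ⟨j, hj⟩ := List.get_of_mem (hval p (List.get_mem _ _)).1
  refine ⟨_, j, ?_, ?_, rfl⟩
  · rintro rfl
    have := congrArg Pass.isOver (hp.trans hj)
    simp [Pass.other] at this
  · rw [hj]; rfl

/-- Each dart of the chain is identified with its successor, and the last one with `f`. -/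
theorem mk_eq_of_chainN (hl : validN l = true) (f : Fin (decodeList l).length × Bool)
    (o : List ℕ) (ho : chainN l l.length (dartN f) o = true) (d : Fin (decodeList l).length × Bool)
    (hd : dartN d ∈ o) : (Quot.mk _ d : Face (decodeList l)) = Quot.mk _ f := by
  induction o generalizing d with
  | nil => simp at hd
  | cons x t ih =>
    cases t with
    | nil =>
      obtain ⟨d', hd'⟩ := exists_faceStep hl d
      have h1 := dartN_of_faceStep hl hd'
      have h2 : dartN d = x := by simpa using hd
      rw [chainN, Nat.beq_eq, ← h2, ← h1] at ho
      rw [← dartN_injective ho]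
      exact Quot.sound hd'
    | cons y t =>
      rw [chainN, Bool.and_eq_true, Nat.beq_eq] at ho
      rcases List.mem_cons.1 hd with h2 | h2
      · obtain ⟨d', hd'⟩ := exists_faceStep hl d
        have h1 := dartN_of_faceStep hl hd'
        rw [h2, ho.1] at h1
        rw [← ih ho.2 d' (by simp [h1])]
        exact Quot.sound hd'
      · exact ih ho.2 d h2

theorem stepN_mem_of_chainN {N f x : ℕ} {o : List ℕ} (hf : f ∈ o) (hx : x ∈ o)
    (ho : chainN l N f o = true) : stepN l N x ∈ o := by
  have key : ∀ t : List ℕ, chainN l N f t = true → x ∈ t → stepN l N x ∈ t ∨ stepN l N x = f := by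
    intro t
    induction t with
    | nil => simp
    | cons a t ih =>
      cases t with
      | nil =>
        intro h hx
        rw [chainN, Nat.beq_eq] at h
        rw [List.mem_singleton] at hx
        exact Or.inr (hx ▸ h)
      | cons b t =>
        intro h hx
        rw [chainN, Bool.and_eq_true, Nat.beq_eq] at h
        rcases List.mem_cons.1 hx with rfl | hx
        · left; simp [h.1]
        · rcases ih h.2 hx with h | h
          · left; exact List.mem_cons_of_mem _ h
          · right; exact h
  rcases key o ho hx with h | h
  · exact h
  · rwa [h]

/-- The lists cover all darts and their total length is the number of darts, so they form a
partition. Each list is closed under the face step and its members are all equivalent; hence lists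
and faces correspond bijectively, and the Euler characteristic can be read off from `P.length`. -/
theorem card_face (hl : validN l = true) {P : List (List ℕ)} (hP : partsN l l.length P = true)
    (hcov : ∀ x < 2 * l.length, x ∈ P.flatten) :
    2 * Nat.card (Face (decodeList l)) = l.length + 4 := by
  simp only [partsN, Bool.and_eq_true, Nat.beq_eq, List.all_eq_true] at hP
  obtain ⟨⟨hchain, hlen⟩, hcard⟩ := hP
  have hperm : (List.range (2 * l.length)).Perm P.flatten := by
    refine List.Subperm.perm_of_length_le (List.Nodup.subperm List.nodup_range ?_) ?_
    · intro d hd; exact hcov d (List.mem_range.1 hd)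
    · rw [hlen, List.length_range]
  have hnd : P.flatten.Nodup := hperm.nodup_iff.1 List.nodup_range
  have hdisj : ∀ i j : Fin P.length, ∀ x, x ∈ P.get i → x ∈ P.get j → i = j := by
    intro i j x hi hj
    have hpw := (List.nodup_flatten.1 hnd).2
    by_contra hij
    rcases lt_or_gt_of_ne hij with h | h
    · exact (List.pairwise_iff_get.1 hpw i j h) hi hj
    · exact (List.pairwise_iff_get.1 hpw j i h) hj hi
  have hlt : ∀ i : Fin P.length, ∀ x ∈ P.get i, x < 2 * l.length := by
    intro i x hx
    exact List.mem_range.1 (hperm.mem_iff.2 (List.mem_flatten.2 ⟨_, List.get_mem _ _, hx⟩))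
  have hhead : ∀ i : Fin P.length, ∃ f : Fin (decodeList l).length × Bool,
      dartN f ∈ P.get i ∧ chainN l l.length (dartN f) (P.get i) = true := by
    intro i
    have h1 := hchain _ (List.get_mem P i)
    rcases hPi : P.get i with _ | ⟨x, t⟩
    · rw [hPi] at h1; simp at h1
    · rw [hPi] at h1
      obtain ⟨f, hf⟩ := exists_dartN (hlt i x (by rw [hPi]; simp))
      exact ⟨f, by simp [hf], by rw [hf]; exact h1⟩
  choose f hf1 hf2 using hhead
  have hbij : Function.Bijective (fun i => (Quot.mk _ (f i) : Face (decodeList l))) := by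
    constructor
    · intro i j hij
      -- Membership in the `i`-th list descends to faces. Forwards this is closure under the step;
      -- backwards, the list containing `d` also contains its successor, and by disjointness it is
      -- the `i`-th list.
      let R : Face (decodeList l) → Prop := Quot.lift (fun d => dartN d ∈ P.get i) (by
        intro d d' h
        have h1 := dartN_of_faceStep hl h
        refine propext ⟨fun hd => ?_, fun hd => ?_⟩
        · rw [h1]; exact stepN_mem_of_chainN (hf1 i) hd (hf2 i)
        · obtain ⟨o, ho, hdo⟩ := List.mem_flatten.1 (hcov (dartN d) (dartN_lt d))
          obtain ⟨k, rfl⟩ := List.get_of_mem ho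
          have h2 := stepN_mem_of_chainN (hf1 k) hdo (hf2 k)
          rw [← h1] at h2
          rwa [hdisj i k _ hd h2])
      have h1 : R (Quot.mk _ (f i)) := hf1 i
      rw [show (Quot.mk _ (f i) : Face (decodeList l)) = Quot.mk _ (f j) from hij] at h1
      exact hdisj i j _ h1 (hf1 j)
    · intro q
      induction q using Quot.ind with
      | mk d =>
        obtain ⟨o, ho, hdo⟩ := List.mem_flatten.1 (hcov (dartN d) (dartN_lt d))
        obtain ⟨k, rfl⟩ := List.get_of_mem ho
        exact ⟨k, (mk_eq_of_chainN hl (f k) _ (hf2 k) d hdo).symm⟩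
  have h : P.length = Nat.card (Face (decodeList l)) :=
    (Nat.card_fin _).symm.trans (Nat.card_congr (Equiv.ofBijective _ hbij))
  rw [← h, hcard]

end Faces

theorem isKnotDiagram_decodeList {l : List ℕ} (hl : validN l = true) (h : sphereN l = true) :
    IsKnotDiagram (decodeList l) := by
  refine ⟨isValid_decodeList hl, ?_⟩
  rcases Bool.or_eq_true_iff.1 h with h2 | h2
  · left; rw [List.isEmpty_iff.1 h2]; rfl
  · right; rw [List.length_map]
    exact card_face hl h2 fun x hx =>
      mem_flatten_orbits _ _ _ _ (by simp) x (List.mem_range.2 hx)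

/-! ### Executable Reidemeister moves and crossing changes -/

/-- Numerical version of `arc`. -/
def arcN (t : Bool) (p q : ℕ) : List ℕ := bif t then [p, q] else [q, p]

/-- The larger code of a first Reidemeister move. -/
def kinkN (x : ℕ) (o s : Bool) (A : List ℕ) : List ℕ := code x o s :: code x (!o) s :: A

/-- The larger code of a second Reidemeister move. -/
def bigonN (x y : ℕ) (o s t : Bool) (A B : List ℕ) : List ℕ :=
  code x o s :: code y o (!s) :: (A ++ (arcN t (code x (!o) s) (code y (!o) (!s)) ++ B))

/-- A code of a third Reidemeister move. The middle strand is visited before the bottom strand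
if `k` is true. -/
def triangleN (k : Bool) (x y z : ℕ) (t m b sx sy sz : Bool) (A B C : List ℕ) : List ℕ :=
  arcN t (code x true sx) (code y true sy) ++ (A ++
    ((bif k then arcN m (code z true sz) (code x false sx)
      else arcN b (code y false sy) (code z false sz)) ++ (B ++
    ((bif k then arcN b (code y false sy) (code z false sz)
      else arcN m (code z true sz) (code x false sx)) ++ C))))

/-- The condition on the signs in a third Reidemeister move. -/
def triangleSigns (t m b sx sy sz : Bool) : Bool :=
  (sy == (sx ^^ (m ^^ !b))) && (sz == (sx ^^ (t ^^ b)))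

/-- Instructions for the transformation of a code. -/
inductive Instruction
  | rotate (k : ℕ)
  | remove1
  | insert1 (x : ℕ) (o s : Bool)
  | remove2 (a : ℕ)
  | insert2 (x y : ℕ) (o s t : Bool) (a : ℕ)
  | slide (a b : ℕ)
  | change (x : ℕ)

/-- Removal of a kink at the base point. -/
def remove1N (l : List ℕ) (k : List ℕ → Bool) : Bool :=
  let p := getN l 0
  eqN l (kinkN (p / 4) (overBit p) (signBit p) (l.drop 2)) && k (l.drop 2)

/-- Removal of a bigon whose first side starts at the base point. -/
def remove2N (a : ℕ) (l : List ℕ) (k : List ℕ → Bool) : Bool :=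
  let p := getN l 0
  let q := getN l 1
  let A := (l.drop 2).take a
  let B := l.drop (a + 4)
  eqN l (bigonN (p / 4) (q / 4) (overBit p) (signBit p) (Nat.beq (getN l (a + 2) / 4) (p / 4))
    A B) && k (A ++ B)

/-- The third Reidemeister move for a triangle whose top side starts at the base point. -/
def slideN (a b : ℕ) (l : List ℕ) (k : List ℕ → Bool) : Bool :=
  let p := getN l 0
  let u1 := getN l (a + 2)
  let u2 := getN l (a + 3)
  let v1 := getN l (a + b + 4)
  let v2 := getN l (a + b + 5)
  let first := overBit u1 || overBit u2
  let m1 := bif first then u1 else v1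
  let m2 := bif first then u2 else v2
  let b1 := bif first then v1 else u1
  let m := overBit m1
  let z := bif m then m1 else m2
  let x := bif m then m2 else m1
  let t := Nat.beq (x / 4) (p / 4)
  let y := bif t then getN l 1 else p
  let c := Nat.beq (b1 / 4) (y / 4)
  let A := (l.drop 2).take a
  let B := (l.drop (a + 4)).take b
  let C := l.drop (a + b + 6)
  triangleSigns t m c (signBit x) (signBit y) (signBit z) &&
  eqN l (triangleN first (x / 4) (y / 4) (z / 4) t m c (signBit x) (signBit y) (signBit z) A B C) &&
  k (triangleN first (x / 4) (y / 4) (z / 4) (!t) (!m) (!c) (signBit x) (signBit y) (signBit z)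
    A B C)

/-- A crossing change. -/
def changeN (x : ℕ) (l : List ℕ) : List ℕ :=
  l.map fun n => bif Nat.beq (n / 4) x then code (n / 4) (!overBit n) (!signBit n) else n

/-- Execute the instructions, check that all codes are codes of diagrams on the sphere and that
there is no crossing at the end. -/
def unknotsN : List Instruction → List ℕ → Bool
  | [], l => l.isEmpty
  | i :: is, l =>
    let k : List ℕ → Bool := fun l' =>
      forceList l' fun m => validN m && sphereN m && unknotsN is m
    match i with
    | .rotate n => forceList (l.drop n ++ l.take n) (unknotsN is)
    | .remove1 => remove1N l k
    | .insert1 x o s => k (kinkN x o s l)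
    | .remove2 a => remove2N a l k
    | .insert2 x y o s t a => k (bigonN x y o s t (l.take a) (l.drop a))
    | .slide a b => slideN a b l fun l' => forceList l' fun m => sphereN m && unknotsN is m
    | .change x => (l.any fun n => Nat.beq (n / 4) x) && k (changeN x l)

/-- The number of crossing changes. -/
def changes : List Instruction → ℕ
  | [] => 0
  | .change _ :: is => changes is + 1
  | _ :: is => changes is

/-! ### Soundness of the executable moves -/

theorem decodeList_arcN (t : Bool) (p q : ℕ) :
    decodeList (arcN t p q) = arc (unitOf t) (decode p) (decode q) := by
  cases t <;> rfl

theorem move_kinkN (x : ℕ) (o s : Bool) (A : List ℕ) :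
    Move (decodeList (kinkN x o s A)) (decodeList A) := by
  have := Move.reidemeister1 x o (unitOf s) (decodeList A)
  simpa [kinkN, decode_code] using this

theorem move_bigonN (x y : ℕ) (o s t : Bool) (A B : List ℕ) :
    Move (decodeList (bigonN x y o s t A B)) (decodeList (A ++ B)) := by
  have := Move.reidemeister2 x y o (unitOf s) (unitOf t) (decodeList A) (decodeList B)
  have h : decodeList (arcN t (code x (!o) s) (code y (!o) (!s))) =
      arc (unitOf t) ⟨x, !o, unitOf s⟩ ⟨y, !o, -unitOf s⟩ := by
    rw [decodeList_arcN, decode_code, decode_code, unitOf_not]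
  simp only [bigonN, decodeList, List.map_cons, List.map_append, decode_code, unitOf_not] at h ⊢
  rw [h]
  simpa using this

/-- The orientation `e` of the triangle can be recovered from the crossing `x` alone; the Boolean
test says that the two other crossings agree with it. -/
theorem triangleSigns_spec {t m b sx sy sz : Bool} (h : triangleSigns t m b sx sy sz = true) :
    ∃ e : ℤˣ, unitOf sx = -(e * unitOf t * unitOf m) ∧ unitOf sy = e * unitOf t * unitOf b ∧
      unitOf sz = -(e * unitOf m * unitOf b) := by
  refine ⟨-(unitOf sx * unitOf t * unitOf m), ?_⟩
  revert h t m b sx sy sz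
  decide

theorem move_triangleN (k : Bool) (x y z : ℕ) {t m b sx sy sz : Bool}
    (h : triangleSigns t m b sx sy sz = true) (A B C : List ℕ) :
    Move (decodeList (triangleN k x y z t m b sx sy sz A B C))
      (decodeList (triangleN k x y z (!t) (!m) (!b) sx sy sz A B C)) := by
  obtain ⟨e, hx, hy, hz⟩ := triangleSigns_spec h
  have harc : ∀ (t : Bool) (x y : ℕ) (o o' s s' : Bool),
      List.map decode (arcN t (code x o s) (code y o' s')) =
        arc (unitOf t) ⟨x, o, unitOf s⟩ ⟨y, o', unitOf s'⟩ := by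
    intro t x y o o' s s'
    rw [← decode_code, ← decode_code]
    exact decodeList_arcN _ _ _
  cases k
  · have := Move.reidemeister3' x y z e _ _ _ _ _ _ (decodeList A) (decodeList B) (decodeList C)
      hx hy hz
    simpa [triangleN, decodeList, harc, unitOf_not] using this
  · have := Move.reidemeister3 x y z e _ _ _ _ _ _ (decodeList A) (decodeList B) (decodeList C)
      hx hy hz
    simpa [triangleN, decodeList, harc, unitOf_not] using this

theorem arcN_perm (t : Bool) (p q : ℕ) : (arcN t p q).Perm (arcN (!t) p q) := by
  cases t
  · exact .swap p q []
  · exact .swap q p []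

/-- This is why after a slide only the sphere condition is evaluated. -/
theorem triangleN_perm (k : Bool) (x y z : ℕ) (t m b sx sy sz : Bool) (A B C : List ℕ) :
    (triangleN k x y z t m b sx sy sz A B C).Perm
      (triangleN k x y z (!t) (!m) (!b) sx sy sz A B C) := by
  cases k <;> exact (arcN_perm _ _ _).append (.append_left _ ((arcN_perm _ _ _).append
    (.append_left _ ((arcN_perm _ _ _).append_right _))))

theorem decodeList_changeN (x : ℕ) (l : List ℕ) :
    decodeList (changeN x l) = changeCrossing (decodeList l) x := by
  simp only [decodeList, changeN, changeCrossing, List.map_map]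
  refine List.map_congr_left fun n _ => ?_
  obtain ⟨y, o, s, rfl⟩ := exists_code n
  have h := decode_code y o s
  have h1 : code y o s / 4 = y := congrArg Pass.label h
  have h2 : overBit (code y o s) = o := congrArg Pass.isOver h
  have h3 : signBit (code y o s) = s := unitOf_injective (congrArg Pass.sign h)
  simp only [Function.comp, h1, h2, h3, h]
  by_cases hx : y = x
  · subst hx; simp [decode_code, Pass.flip, unitOf_not]
  · have : Nat.beq y x = false := by rw [← Bool.not_eq_true, Nat.beq_eq]; exact hx
    simp [this, hx, h]

theorem UnknotsIn.of_isotopic {c d : GaussCode} (h : Isotopic c d) {n : ℕ} (hn : UnknotsIn n d) :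
    UnknotsIn n c := by
  cases hn with
  | isotopy h' => exact .isotopy (h.trans _ _ _ h')
  | change h' hx hd => exact .change (h.trans _ _ _ h') hx hd

/-- The invariant of the induction is that the current list is valid and decodes to a diagram on the
sphere, which the isotopy relation demands at both ends of every move. Insertions are Reidemeister
moves read backwards. -/
theorem unknotsIn_of_unknotsN (is : List Instruction) (l : List ℕ) (hv : validN l = true)
    (hl : IsKnotDiagram (decodeList l)) (h : unknotsN is l = true) :
    UnknotsIn (changes is) (decodeList l) := by
  induction is generalizing l with
  | nil =>
    rw [unknotsN] at h
    rw [List.isEmpty_iff.1 h]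
    exact .isotopy (.refl _)
  | cons i is ih =>
    have of_move : ∀ m : List ℕ, validN m = true → IsKnotDiagram (decodeList m) →
        (Move (decodeList l) (decodeList m) ∨ Move (decodeList m) (decodeList l)) →
        unknotsN is m = true → UnknotsIn (changes is) (decodeList l) := by
      intro m hv hd hm hk
      refine UnknotsIn.of_isotopic ?_ (ih m hv hd hk)
      rcases hm with hm | hm
      · exact .rel _ _ ⟨hl, hd, hm⟩
      · exact .symm _ _ (.rel _ _ ⟨hd, hl, hm⟩)
    have key : ∀ m : List ℕ, (Move (decodeList l) (decodeList m) ∨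
        Move (decodeList m) (decodeList l)) →
        (forceList m fun m => validN m && sphereN m && unknotsN is m) = true →
        UnknotsIn (changes is) (decodeList l) := by
      intro m hm hk
      simp only [forceList_eq, Bool.and_eq_true] at hk
      exact of_move m hk.1.1 (isKnotDiagram_decodeList hk.1.1 hk.1.2) hm hk.2
    cases i with
    | rotate n =>
      have h1 : l.Perm (l.drop n ++ l.take n) := by
        conv_lhs => rw [← List.take_append_drop n l]
        exact List.perm_append_comm
      have h2 : decodeList l = decodeList (l.take n) ++ decodeList (l.drop n) := by
        simp only [decodeList, ← List.map_append, List.take_append_drop]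
      have h3 : decodeList (l.drop n ++ l.take n) =
          decodeList (l.drop n) ++ decodeList (l.take n) := List.map_append
      refine of_move (l.drop n ++ l.take n) (validN.of_perm h1 hv) ?_ (Or.inl ?_)
        ((forceList_eq _ _).symm.trans h)
      · rw [h3]
        exact IsKnotDiagram.rotate (h2 ▸ hl)
      · rw [h2, h3]
        exact .rotate _ _
    | remove1 =>
      obtain ⟨h1, h2⟩ := Bool.and_eq_true_iff.1 h
      refine key _ (Or.inl ?_) h2
      conv_lhs => rw [eqN_eq h1]
      exact move_kinkN _ _ _ _
    | insert1 x o s => exact key _ (Or.inr (move_kinkN _ _ _ _)) h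
    | remove2 a =>
      obtain ⟨h1, h2⟩ := Bool.and_eq_true_iff.1 h
      refine key _ (Or.inl ?_) h2
      conv_lhs => rw [eqN_eq h1]
      exact move_bigonN _ _ _ _ _ _ _
    | insert2 x y o s t a =>
      refine key _ (Or.inr ?_) h
      have := move_bigonN x y o s t (l.take a) (l.drop a)
      rwa [List.take_append_drop] at this
    | slide a b =>
      obtain ⟨h1, h2⟩ := Bool.and_eq_true_iff.1 h
      obtain ⟨h0, h1⟩ := Bool.and_eq_true_iff.1 h1
      simp only [forceList_eq, Bool.and_eq_true] at h2
      have h3 := validN.of_perm (triangleN_perm _ _ _ _ _ _ _ _ _ _ _ _ _) (eqN_eq h1 ▸ hv)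
      refine of_move _ h3 (isKnotDiagram_decodeList h3 h2.1) (Or.inl ?_) h2.2
      conv_lhs => rw [eqN_eq h1]
      exact move_triangleN _ _ _ _ h0 _ _ _
    | change x =>
      obtain ⟨h1, h2⟩ := Bool.and_eq_true_iff.1 h
      simp only [forceList_eq, Bool.and_eq_true] at h2
      obtain ⟨n, hn, hx⟩ := List.any_eq_true.1 h1
      have h3 := ih _ h2.1.1 (isKnotDiagram_decodeList h2.1.1 h2.1.2) h2.2
      rw [decodeList_changeN] at h3
      exact .change (.refl _) ⟨decode n, List.mem_map_of_mem hn, by simpa [decode] using hx⟩ h3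

/-- The numbers encoding a Gauss code. -/
def encodeList (c : GaussCode) : List ℕ :=
  c.map fun p => code p.label p.isOver (decide (p.sign = 1))

theorem decodeList_encodeList (c : GaussCode) : decodeList (encodeList c) = c := by
  have : ∀ p ∈ c, (decode ∘ fun p : Pass => code p.label p.isOver (decide (p.sign = 1))) p = p := by
    intro p _
    rcases Int.units_eq_one_or p.sign with h | h
    · ext <;> simp [decode_code, h, unitOf]
    · ext <;> simp [decode_code, h, unitOf]
  simpa [encodeList, decodeList] using List.map_congr_left this

/-- This reduces an upper bound to one Boolean evaluation. -/
theorem unknottingNumber_le_of_unknotsN (is : List Instruction) (c : GaussCode)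
    (h : (forceList (encodeList c) fun l => validN l && sphereN l && unknotsN is l) = true) :
    unknottingNumber c ≤ changes is := by
  simp only [forceList_eq, Bool.and_eq_true] at h
  have h1 := unknotsIn_of_unknotsN is _ h.1.1 (isKnotDiagram_decodeList h.1.1 h.1.2) h.2
  rw [decodeList_encodeList] at h1
  exact iInf₂_le (f := fun (n : ℕ) (_ : UnknotsIn n c) => (n : ℕ∞)) _ h1

/-- A sequence of moves unknotting `5₁`. -/
def fiveOneMoves : List Instruction :=
  [.change 1, .remove2 3, .change 3, .remove2 1, .remove1]

/-- A sequence of moves unknotting the mirror image of `5₁`. -/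
def mirrorFiveOneMoves : List Instruction :=
  [.change 1, .remove2 3, .change 3, .remove2 1, .remove1]

/-- A sequence of moves unknotting `8₂`. -/
def eightTwoMoves : List Instruction :=
  [.change 1, .rotate 2, .slide 4 5, .rotate 7, .remove2 5, .rotate 4, .remove1, .remove2 3,
   .change 4, .remove2 1, .remove1]

/-- A sequence of moves unknotting the mirror image of `8₂`. -/
def mirrorEightTwoMoves : List Instruction :=
  [.change 1, .slide 0 5, .rotate 1, .remove1, .remove2 5, .rotate 3, .remove2 3, .change 4,
   .remove2 1, .remove1]

/-- A sequence of moves unknotting `5₁ # m(8₂)`. -/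
def fiveOneMirrorEightTwoMoves : List Instruction :=
  [.rotate 13, .insert2 0 1 true true false 18, .rotate 1, .slide 16 5, .slide 15 5,
   .slide 14 5, .slide 13 5, .rotate 29, .slide 13 4, .rotate 22, .remove2 7, .rotate 25,
   .insert2 0 3 true true false 14, .rotate 29, .slide 5 9, .rotate 6, .slide 10 9, .rotate 22,
   .slide 5 11, .rotate 6, .slide 12 7, .rotate 22, .slide 4 13, .rotate 22, .remove2 13,
   .rotate 24, .insert2 3 12 true true true 13, .rotate 1, .slide 13 4, .rotate 29, .slide 12 5,
   .slide 11 5, .slide 10 5, .slide 9 5, .rotate 17, .remove2 12, .rotate 25,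
   .insert2 5 12 true false true 19, .rotate 1, .slide 4 13, .rotate 5, .slide 13 6, .rotate 22,
   .slide 5 14, .rotate 6, .slide 15 4, .rotate 22, .slide 4 18, .rotate 25, .remove2 10,
   .rotate 22, .insert2 1 12 false false false 12, .rotate 15, .slide 4 6, .rotate 29,
   .slide 6 7, .slide 7 7, .slide 8 7, .slide 9 7, .insert2 13 14 true true false 26, .rotate 1,
   .slide 20 2, .rotate 1, .slide 10 10, .rotate 33, .slide 12 7, .rotate 24, .remove2 9,
   .rotate 21, .remove2 15, .rotate 11, .insert1 1 true true, .rotate 27, .slide 0 3,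
   .rotate 23, .insert2 10 12 true false true 11, .change 12, .rotate 27,
   .insert2 14 16 false true false 30, .rotate 33, .slide 0 9, .rotate 1, .remove1, .rotate 11,
   .slide 20 8, .rotate 33, .remove1, .rotate 23, .insert2 5 14 false true false 18, .rotate 21,
   .slide 12 8, .rotate 1, .slide 10 11, .rotate 35, .remove2 23, .rotate 31,
   .insert2 12 13 false false true 11, .rotate 14, .slide 3 16, .change 16, .rotate 15,
   .slide 0 7, .rotate 1, .remove1, .rotate 32, .slide 7 11, .slide 6 11, .rotate 24,
   .slide 7 19, .rotate 7, .slide 6 11, .rotate 22, .remove2 11, .rotate 28, .slide 9 5,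
   .rotate 10, .slide 6 9, .rotate 18, .slide 9 7, .rotate 10, .slide 7 7, .rotate 19,
   .remove2 19, .rotate 6, .slide 5 13, .slide 4 13, .slide 3 13, .rotate 3, .slide 6 5,
   .rotate 9, .slide 5 6, .rotate 16, .remove2 14, .rotate 17, .slide 7 4, .rotate 17,
   .slide 4 7, .rotate 7, .slide 1 4, .slide 0 6, .rotate 1, .remove1, .change 6, .rotate 13,
   .slide 2 10, .rotate 15, .remove2 8, .rotate 2, .slide 8 2, .rotate 15, .remove1, .slide 1 3,
   .rotate 7, .remove2 6, .rotate 5, .remove1, .rotate 7, .remove2 2, .rotate 3, .remove1,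
   .remove1]

/-- A sequence of moves unknotting `m(5₁) # 8₂`. -/
def mirrorFiveOneEightTwoMoves : List Instruction :=
  [.rotate 13, .insert2 0 1 false false false 18, .rotate 26, .slide 3 16, .rotate 22,
   .slide 5 4, .rotate 6, .slide 5 14, .rotate 22, .slide 5 6, .rotate 5, .slide 7 13,
   .rotate 10, .remove2 19, .rotate 18, .insert2 0 3 false false false 14, .rotate 17,
   .slide 10 5, .slide 9 5, .slide 8 5, .slide 7 5, .rotate 29, .slide 7 4, .rotate 16,
   .remove2 13, .rotate 24, .insert2 3 12 true false true 13, .rotate 7, .slide 7 13,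
   .rotate 22, .slide 5 7, .rotate 6, .slide 8 11, .rotate 22, .slide 5 9, .rotate 6,
   .slide 10 9, .rotate 29, .remove2 12, .rotate 25, .insert2 5 12 false true true 19,
   .rotate 22, .slide 7 4, .rotate 29, .slide 6 5, .slide 5 5, .slide 4 5, .rotate 1,
   .slide 2 4, .rotate 29, .remove2 10, .rotate 22, .insert2 1 12 true true false 12,
   .rotate 21, .slide 6 14, .rotate 10, .slide 11 6, .rotate 22, .slide 7 10, .rotate 10,
   .slide 9 8, .rotate 22, .slide 7 8, .rotate 19, .insert2 13 14 false false false 26,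
   .rotate 23, .slide 2 6, .rotate 3, .slide 8 10, .rotate 23, .slide 7 9, .rotate 21,
   .remove2 21, .rotate 29, .remove2 11, .rotate 22, .insert1 1 false false, .rotate 1,
   .slide 3 19, .rotate 21, .insert2 10 12 false true true 11, .change 12, .rotate 27,
   .insert2 14 16 true false false 30, .rotate 35, .slide 9 21, .rotate 35, .remove1, .rotate 9,
   .slide 0 20, .rotate 1, .remove1, .rotate 23, .insert2 5 14 true false false 18, .rotate 9,
   .slide 10 12, .rotate 25, .slide 11 9, .rotate 23, .remove2 23, .rotate 31,
   .insert2 12 13 true true true 11, .rotate 19, .slide 16 11, .change 16, .rotate 12,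
   .slide 7 23, .rotate 35, .remove1, .rotate 20, .slide 10 7, .rotate 20, .slide 11 11,
   .rotate 12, .slide 2 7, .rotate 19, .slide 11 11, .rotate 27, .remove2 19, .rotate 5,
   .slide 10 9, .slide 9 9, .slide 8 9, .rotate 29, .slide 7 10, .rotate 10, .remove2 19,
   .rotate 13, .slide 13 2, .rotate 14, .slide 3 4, .rotate 10, .slide 13 4, .rotate 13,
   .slide 9 6, .rotate 1, .slide 6 9, .rotate 25, .remove2 8, .rotate 18, .slide 5 7,
   .rotate 17, .slide 5 4, .rotate 1, .slide 11 1, .rotate 15, .slide 6 10, .rotate 21,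
   .remove1, .change 6, .rotate 9, .slide 2 2, .rotate 19, .remove2 8, .slide 0 8, .rotate 1,
   .remove1, .rotate 3, .slide 3 4, .rotate 12, .remove2 4, .rotate 9, .remove1, .rotate 7,
   .remove2 2, .rotate 3, .remove1, .remove1]

/-! ### The upper bounds -/

theorem unknottingNumber_fiveOne_le : unknottingNumber fiveOne ≤ 2 :=
  unknottingNumber_le_of_unknotsN fiveOneMoves _ (by decide +kernel)

theorem unknottingNumber_mirror_fiveOne_le : unknottingNumber (mirror fiveOne) ≤ 2 :=
  unknottingNumber_le_of_unknotsN mirrorFiveOneMoves _ (by decide +kernel)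

theorem unknottingNumber_eightTwo_le : unknottingNumber eightTwo ≤ 2 :=
  unknottingNumber_le_of_unknotsN eightTwoMoves _ (by decide +kernel)

theorem unknottingNumber_mirror_eightTwo_le : unknottingNumber (mirror eightTwo) ≤ 2 :=
  unknottingNumber_le_of_unknotsN mirrorEightTwoMoves _ (by decide +kernel)

/-- Of the three changed crossings 12, 16 and 6, the first two do not occur in the standard diagram
of the sum: the isotopy creates them beforehand by second Reidemeister moves. -/
theorem unknottingNumber_connSum_fiveOne_mirror_eightTwo_le :
    unknottingNumber (connSum fiveOne (mirror eightTwo)) ≤ 3 :=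
  unknottingNumber_le_of_unknotsN fiveOneMirrorEightTwoMoves _ (by decide +kernel)

/-- Mirroring exchanges the top and the bottom strand of a triangle, and a slide expects the top
strand at the base point; so the mirrored sum has a sequence of its own, with other rotations and
slides but changes at the same labels. -/
theorem unknottingNumber_connSum_mirror_fiveOne_eightTwo_le :
    unknottingNumber (connSum (mirror fiveOne) eightTwo) ≤ 3 :=
  unknottingNumber_le_of_unknotsN mirrorFiveOneEightTwoMoves _ (by decide +kernel)

end GaussCode
end KnotTheory

namespace KnotTheory

/-! ### Indices of functions on real vector spaces -/

section Index

variable {V : Type*} [AddCommGroup V] [Module ℝ V]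

/-- There is a linear map from an `r`-dimensional space along which `Q` is positive. -/
def PosDim (Q : V → ℝ) (r : ℕ) : Prop :=
  ∃ f : (Fin r → ℝ) →ₗ[ℝ] V, ∀ x, x ≠ 0 → 0 < Q (f x)

theorem PosDim.of_finrank {Q : V → ℝ} {U : Type*} [AddCommGroup U] [Module ℝ U]
    [FiniteDimensional ℝ U] (g : U →ₗ[ℝ] V) (hg : ∀ u, u ≠ 0 → 0 < Q (g u)) {r : ℕ}
    (hr : r ≤ Module.finrank ℝ U) : PosDim Q r := by
  let b := Module.finBasis ℝ U
  have hb : LinearIndependent ℝ fun i : Fin r => b (Fin.castLE hr i) :=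
    b.linearIndependent.comp _ (Fin.castLE_injective hr)
  refine ⟨g ∘ₗ Fintype.linearCombination ℝ fun i : Fin r => b (Fin.castLE hr i), fun x hx => ?_⟩
  refine hg _ fun h => hx ?_
  exact (linearIndependent_iff_injective_fintypeLinearCombination.1 hb) (h.trans (map_zero _).symm)

theorem posDim_zero (Q : V → ℝ) : PosDim Q 0 := ⟨0, fun x hx => absurd (Subsingleton.elim x 0) hx⟩

theorem PosDim.comp {V' : Type*} [AddCommGroup V'] [Module ℝ V'] {Q : V → ℝ} {Q' : V' → ℝ}
    (E : V →ₗ[ℝ] V') (h : ∀ v, Q' (E v) = Q v) {r : ℕ} (hr : PosDim Q r) : PosDim Q' r := by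
  obtain ⟨f, hf⟩ := hr
  exact ⟨E ∘ₗ f, fun x hx => by simpa [h] using hf x hx⟩

/-- One linear condition costs at most one dimension. -/
theorem PosDim.of_eq_on_ker {V' : Type*} [AddCommGroup V'] [Module ℝ V'] {Q : V → ℝ} {Q' : V' → ℝ}
    (E : V →ₗ[ℝ] V') (l : V →ₗ[ℝ] ℝ) (h : ∀ v, l v = 0 → Q' (E v) = Q v) {r : ℕ}
    (hr : PosDim Q (r + 1)) : PosDim Q' r := by
  obtain ⟨f, hf⟩ := hr
  refine .of_finrank (E ∘ₗ f ∘ₗ (LinearMap.ker (l ∘ₗ f)).subtype) (fun u hu => ?_) ?_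
  · have h1 : l (f u) = 0 := u.2
    simp only [LinearMap.comp_apply, Submodule.subtype_apply, h _ h1]
    exact hf _ (by simpa using hu)
  · have h1 := LinearMap.finrank_range_add_finrank_ker (l ∘ₗ f)
    have h2 : Module.finrank ℝ (LinearMap.range (l ∘ₗ f)) ≤ 1 :=
      (Submodule.finrank_le _).trans (by simp)
    simp only [Module.finrank_fin_fun] at h1
    omega

/-- In more than `k` dimensions the `k` linear forms have a common nonzero zero. Applied to the
forms whose squares enter a diagonalization positively, this bounds the index from above. -/
theorem PosDim.le_of_le_sum {Q : V → ℝ} {k r : ℕ} (l : Fin k → V →ₗ[ℝ] ℝ)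
    (h : ∀ v, (∀ i, l i v = 0) → Q v ≤ 0) (hr : PosDim Q r) : r ≤ k := by
  obtain ⟨f, hf⟩ := hr
  by_contra hk
  obtain ⟨x, hx, h0⟩ := Submodule.exists_mem_ne_zero_of_ne_bot
    (LinearMap.ker_ne_bot_of_finrank_lt (f := LinearMap.pi l ∘ₗ f) (by simpa using hk))
  refine absurd (hf x h0) (not_lt.2 (h _ fun i => ?_))
  exact congrFun (LinearMap.mem_ker.1 hx) i

/-- The positive and negative indices of `Q'` are larger by `a` and `b` than those of `Q`. -/
def IndexShift {V' : Type*} [AddCommGroup V'] [Module ℝ V'] (Q' : V' → ℝ) (Q : V → ℝ)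
    (a b : ℕ) : Prop :=
  (∀ r, PosDim Q' (r + a) ↔ PosDim Q r) ∧
    ∀ r, PosDim (fun v => -Q' v) (r + b) ↔ PosDim (fun v => -Q v) r

theorem IndexShift.trans {Q₁ Q₂ Q₃ : V → ℝ} {a b a' b' : ℕ} (h : IndexShift Q₁ Q₂ a b)
    (h' : IndexShift Q₂ Q₃ a' b') : IndexShift Q₁ Q₃ (a' + a) (b' + b) :=
  ⟨fun r => by rw [← add_assoc, h.1, h'.1], fun r => by rw [← add_assoc, h.2, h'.2]⟩

theorem IndexShift.neg {Q₁ Q₂ : V → ℝ} {a b : ℕ} (h : IndexShift Q₁ Q₂ a b) :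
    IndexShift (fun v => -Q₁ v) (fun v => -Q₂ v) b a :=
  ⟨h.2, by simpa only [neg_neg] using h.1⟩

theorem IndexShift.of_equiv {Q₁ Q₂ : V → ℝ} (E F : V →ₗ[ℝ] V) (hE : ∀ v, Q₂ (E v) = Q₁ v)
    (hF : ∀ v, Q₁ (F v) = Q₂ v) : IndexShift Q₁ Q₂ 0 0 :=
  ⟨fun _ => ⟨.comp E hE, .comp F hF⟩,
    fun _ => ⟨.comp E fun v => by rw [hE], .comp F fun v => by rw [hF]⟩⟩

/-- The space is the direct sum of the kernel of `l` and the line of `e`. Since `Q` does not see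
`e`, the projection to the kernel along `e` preserves `Q`, and the line contributes one new positive
square. -/
theorem IndexShift.add_sq {Q : V → ℝ} (hQ0 : Q 0 = 0) (l : V →ₗ[ℝ] ℝ) (e : V) (hl : l e ≠ 0)
    (hQ : ∀ v (t : ℝ), Q (v + t • e) = Q v) {c : ℝ} (hc : 0 < c) :
    IndexShift (fun v => Q v + c * l v ^ 2) Q 1 0 := by
  let E : V →ₗ[ℝ] V := LinearMap.id - (LinearMap.toSpanSingleton ℝ V e) ∘ₗ ((l e)⁻¹ • l)
  have hE : ∀ v, E v = v + (-((l e)⁻¹ * l v)) • e := fun v => by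
    simp [E, sub_eq_add_neg, LinearMap.toSpanSingleton_apply]
  have hlE : ∀ v, l (E v) = 0 := fun v => by
    rw [hE, map_add, map_smul, smul_eq_mul]; field_simp; ring
  refine ⟨fun r => ⟨fun h => ?_, fun h => ?_⟩, fun r => ⟨fun h => ?_, fun h => ?_⟩⟩
  · exact h.of_eq_on_ker LinearMap.id l fun v hv => by simp [hv]
  · obtain ⟨f, hf⟩ := h
    refine .of_finrank (U := (Fin r → ℝ) × ℝ) ((E ∘ₗ f).coprod (LinearMap.toSpanSingleton ℝ V e))
      (fun u hu => ?_) (by simp)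
    obtain ⟨x, t⟩ := u
    have h1 : Q (E (f x) + t • e) = Q (f x) := by rw [hQ, hE, hQ]
    simp only [LinearMap.coprod_apply, LinearMap.comp_apply, LinearMap.toSpanSingleton_apply, h1,
      map_add, hlE, map_smul, smul_eq_mul, zero_add]
    by_cases hx : x = 0
    · subst hx
      have ht : t ≠ 0 := fun h => hu (by simp [h])
      rw [map_zero, hQ0]
      positivity
    · have := hf x hx
      positivity
  · obtain ⟨f, hf⟩ := h
    refine ⟨f, fun x hx => ?_⟩
    have := hf x hx
    have h2 : 0 ≤ c * l (f x) ^ 2 := by positivity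
    linarith
  · refine h.comp E fun v => ?_
    simp only [hlE]
    rw [hE, hQ]; simp

theorem IndexShift.sub_sq {Q : V → ℝ} (hQ0 : Q 0 = 0) (l : V →ₗ[ℝ] ℝ) (e : V) (hl : l e ≠ 0)
    (hQ : ∀ v (t : ℝ), Q (v + t • e) = Q v) {c : ℝ} (hc : 0 < c) :
    IndexShift (fun v => Q v - c * l v ^ 2) Q 0 1 := by
  have := (IndexShift.add_sq (Q := fun v => -Q v) (by simp [hQ0]) l e hl
    (fun v t => by rw [hQ]) hc).neg
  simpa only [neg_add, neg_neg, ← sub_eq_add_neg] using this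

/-- A hyperbolic plane: `h * l` is a quarter of `(h + l)² - (h - l)²`, and the two squares are added
one after the other. -/
theorem IndexShift.add_mul {Q : V → ℝ} (hQ0 : Q 0 = 0) (h l : V →ₗ[ℝ] ℝ) (e f : V)
    (he : h e = 0) (hle : l e ≠ 0) (hf : h f ≠ 0) (hQe : ∀ v (t : ℝ), Q (v + t • e) = Q v)
    (hQf : ∀ v (t : ℝ), Q (v + t • f) = Q v) :
    IndexShift (fun v => Q v + h v * l v) Q 1 1 := by
  -- Both vectors leave `Q` fixed. The first, with `l g = 1`, detects `h + l`; the second, with `l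
  -- g' = -1`, detects `h - l` and is killed by `h + l`, so it also leaves the already added square
  -- fixed.
  have hex : ∀ y : ℝ, ∃ g : V, h g = 1 ∧ l g = y ∧ ∀ v (t : ℝ), Q (v + t • g) = Q v := by
    intro y
    refine ⟨((y - l f / h f) / l e) • e + (1 / h f) • f, ?_, ?_, fun v t => ?_⟩
    · simp [he, hf]
    · simp only [map_add, map_smul, smul_eq_mul]; field_simp; ring
    · rw [smul_add, ← add_assoc, smul_smul, smul_smul, hQf, hQe]
  obtain ⟨g, hg, hlg, hQg⟩ := hex 1
  obtain ⟨g', hg', hlg', hQg'⟩ := hex (-1)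
  have h1 := IndexShift.add_sq hQ0 (h + l) g (by simp [hg, hlg]) hQg
    (c := 1 / 4) (by norm_num)
  have h2 := IndexShift.sub_sq (Q := fun v => Q v + 1 / 4 * (h + l) v ^ 2) (by simp [hQ0]) (h - l) g'
    (by simp [hg', hlg'])
    (fun v t => by simp only [hQg', map_add, map_smul, LinearMap.add_apply, hg', hlg']; simp)
    (c := 1 / 4) (by norm_num)
  have h3 := h2.trans h1
  convert h3 using 2
  simp only [LinearMap.add_apply, LinearMap.sub_apply]; ring

theorem isGreatest_posDim_iff {V' : Type*} [AddCommGroup V'] [Module ℝ V'] {Q' : V' → ℝ}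
    {Q : V → ℝ} {a : ℕ} (h : ∀ r, PosDim Q' (r + a) ↔ PosDim Q r) (p' : ℕ) :
    IsGreatest {r | PosDim Q' r} p' ↔ ∃ p, IsGreatest {r | PosDim Q r} p ∧ p' = p + a := by
  constructor
  · rintro ⟨h1, h2⟩
    have ha : a ≤ p' := h2 (by simpa using (h 0).2 (posDim_zero Q))
    obtain ⟨p, rfl⟩ := Nat.exists_eq_add_of_le' ha
    exact ⟨p, ⟨(h p).1 h1, fun r hr => Nat.le_of_add_le_add_right (h2 ((h r).2 hr))⟩, rfl⟩
  · rintro ⟨p, ⟨h1, h2⟩, rfl⟩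
    refine ⟨(h p).2 h1, fun r hr => ?_⟩
    rcases le_total a r with ha | ha
    · obtain ⟨r, rfl⟩ := Nat.exists_eq_add_of_le' ha
      exact Nat.add_le_add_right (h2 ((h r).1 hr)) a
    · omega

theorem exists_isGreatest_posDim {Q : V → ℝ} {n : ℕ} (h : ∀ r, PosDim Q r → r ≤ n) :
    ∃ p, IsGreatest {r | PosDim Q r} p := by
  have := Nat.sSup_mem (s := {r | PosDim Q r}) ⟨0, posDim_zero Q⟩ ⟨n, fun r hr => h r hr⟩
  exact ⟨_, this, fun r hr => le_csSup ⟨n, fun r hr => h r hr⟩ hr⟩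

end Index
end KnotTheory

namespace KnotTheory
namespace GaussCode

/-! ### A quadratic function on the 1-cycles of a diagram -/

/-- The parameters of a 1-cycle of a diagram: its coefficient at the edge that ends at the base
point, and for every crossing the increase of the coefficient along the over strand, which is the
decrease along the under strand. -/
abbrev CycleSpace : Type := ℝ × (ℕ → ℝ)

/-- The increase of the coefficient at a passage. -/
def jump (p : Pass) : CycleSpace →ₗ[ℝ] ℝ :=
  (if p.isOver then 1 else -1 : ℝ) • LinearMap.proj p.label ∘ₗ LinearMap.snd ℝ ℝ (ℕ → ℝ)

/-- The increase of the coefficient along a part of a code. -/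
def totalJump (c : GaussCode) : CycleSpace →ₗ[ℝ] ℝ := (c.map jump).sum

/-- The passages of a part of a code, with the sums of the coefficients before and after the
passages, if the coefficient before the first one is `b`. -/
def trace (v : CycleSpace) : ℝ → GaussCode → List (Pass × ℝ)
  | _, [] => []
  | b, p :: c => (p, 2 * b + jump p v) :: trace v (b + jump p v) c

/-- The sign of the crossing if the passages are the two passages through the same crossing. -/
def weight (p q : Pass) : ℝ := if q = p.other then ((p.sign : ℤ) : ℝ) else 0

/-- The pairing of lists of passages with coefficients. -/
def pairing (L M : List (Pass × ℝ)) : ℝ :=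
  (L.map fun u => (M.map fun w => weight u.1 w.1 * (u.2 * w.2)).sum).sum

/-- Twice the sum over the crossings of the product of the sign of the crossing, the sum of the
coefficients along the over strand and the sum of the coefficients along the under strand. -/
def strandForm (c : GaussCode) (v : CycleSpace) : ℝ := pairing (trace v v.1 c) (trace v v.1 c)

/-- Twice the writhe of the diagram. -/
def signSum (c : GaussCode) : ℤ := (c.map fun p => (p.sign : ℤ)).sum

theorem jump_apply (p : Pass) (v : CycleSpace) :
    jump p v = (if p.isOver then 1 else -1) * v.2 p.label := rfl

theorem jump_other (p : Pass) (v : CycleSpace) : jump p.other v = -jump p v := by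
  rw [jump_apply, jump_apply]
  cases h : p.isOver <;> simp [Pass.other, h]

theorem totalJump_nil : totalJump [] = 0 := rfl

theorem totalJump_cons (p : Pass) (c : GaussCode) : totalJump (p :: c) = jump p + totalJump c := by
  simp [totalJump]

theorem totalJump_append (c d : GaussCode) : totalJump (c ++ d) = totalJump c + totalJump d := by
  simp [totalJump]

theorem totalJump_apply (c : GaussCode) (v : CycleSpace) :
    totalJump c v = (c.map fun p => jump p v).sum := by
  induction c with
  | nil => rfl
  | cons p c ih => rw [totalJump_cons, LinearMap.add_apply, ih, List.map_cons, List.sum_cons]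

theorem trace_append (v : CycleSpace) (b : ℝ) (c d : GaussCode) :
    trace v b (c ++ d) = trace v b c ++ trace v (b + totalJump c v) d := by
  induction c generalizing b with
  | nil => simp [trace, totalJump_nil]
  | cons p c ih => simp [trace, ih, totalJump_cons, add_assoc]

theorem map_fst_trace (v : CycleSpace) (b : ℝ) (c : GaussCode) :
    (trace v b c).map Prod.fst = c := by
  induction c generalizing b with
  | nil => rfl
  | cons p c ih => simp [trace, ih]

theorem fst_mem_of_mem_trace {v : CycleSpace} {b : ℝ} {c : GaussCode} {u : Pass × ℝ}
    (h : u ∈ trace v b c) : u.1 ∈ c := by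
  rw [← map_fst_trace v b c]
  exact List.mem_map_of_mem h

theorem trace_add (v : CycleSpace) (b h : ℝ) (c : GaussCode) :
    trace v (b + h) c = (trace v b c).map fun u => (u.1, u.2 + 2 * h) := by
  induction c generalizing b with
  | nil => rfl
  | cons p c ih =>
    rw [trace, trace, List.map_cons, ← ih]
    congr 1
    · ext <;> simp; ring
    · congr 1; ring

theorem trace_congr {v w : CycleSpace} (b : ℝ) {c : GaussCode}
    (h : ∀ p ∈ c, jump p v = jump p w) : trace v b c = trace w b c := by
  induction c generalizing b with
  | nil => rfl
  | cons p c ih =>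
    rw [trace, trace, h p (by simp), ih _ fun q hq => h q (List.mem_cons_of_mem _ hq)]

theorem totalJump_congr {v w : CycleSpace} {c : GaussCode}
    (h : ∀ p ∈ c, jump p v = jump p w) : totalJump c v = totalJump c w := by
  induction c with
  | nil => rfl
  | cons p c ih =>
    rw [totalJump_cons, LinearMap.add_apply, LinearMap.add_apply, h p (by simp),
      ih fun q hq => h q (List.mem_cons_of_mem _ hq)]

theorem weight_comm (p q : Pass) : weight p q = weight q p := by
  have h : ∀ p q : Pass, q = p.other → weight p q = weight q p := by
    rintro p _ rfl
    have : p = p.other.other := by simp [Pass.other]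
    rw [weight, if_pos rfl, weight, if_pos this]; rfl
  by_cases h1 : q = p.other
  · exact h p q h1
  · by_cases h2 : p = q.other
    · exact (h q p h2).symm
    · rw [weight, if_neg h1, weight, if_neg h2]

theorem weight_eq_zero_of_label_ne {p q : Pass} (h : q.label ≠ p.label) : weight p q = 0 := by
  rw [weight, if_neg]
  rintro rfl
  exact h rfl

theorem pairing_append_left (L L' M : List (Pass × ℝ)) :
    pairing (L ++ L') M = pairing L M + pairing L' M := by
  simp [pairing]

theorem pairing_cons_left (u : Pass × ℝ) (L M : List (Pass × ℝ)) :
    pairing (u :: L) M = (M.map fun w => weight u.1 w.1 * (u.2 * w.2)).sum + pairing L M := by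
  simp [pairing]

theorem pairing_comm (L M : List (Pass × ℝ)) : pairing L M = pairing M L := by
  induction L with
  | nil => simp [pairing]
  | cons u L ih =>
    rw [pairing_cons_left, ih]
    simp only [pairing, List.map_cons, List.sum_cons, List.sum_map_add, add_left_inj]
    congr 1
    refine List.map_congr_left fun w _ => ?_
    rw [weight_comm]; ring

theorem pairing_append_right (L M M' : List (Pass × ℝ)) :
    pairing L (M ++ M') = pairing L M + pairing L M' := by
  rw [pairing_comm, pairing_append_left, pairing_comm M, pairing_comm M']

theorem pairing_perm {L L' M M' : List (Pass × ℝ)} (h : L.Perm L') (h' : M.Perm M') :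
    pairing L M = pairing L' M' := by
  have key : ∀ {L L' : List (Pass × ℝ)} (M), L.Perm L' → pairing L M = pairing L' M :=
    fun M h => (h.map _).sum_eq
  rw [key M h, pairing_comm, key L' h', pairing_comm]

theorem pairing_eq_zero {L M : List (Pass × ℝ)} (h : ∀ u ∈ L, ∀ w ∈ M, weight u.1 w.1 = 0) :
    pairing L M = 0 := by
  refine List.sum_eq_zero fun x hx => ?_
  obtain ⟨u, hu, rfl⟩ := List.mem_map.1 hx
  refine List.sum_eq_zero fun x hx => ?_
  obtain ⟨w, hw, rfl⟩ := List.mem_map.1 hx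
  rw [h u hu w hw, zero_mul]

theorem IsValid.label_ne {c d : GaussCode} (h : IsValid (c ++ d)) (hc : ∀ p ∈ c, p.other ∈ c) :
    ∀ p ∈ c, ∀ q ∈ d, q.label ≠ p.label := by
  intro p hp q hq hpq
  have hdis := List.disjoint_of_nodup_append h.1
  rcases (h.2 p (by simp [hp])).2 q (by simp [hq]) hpq with rfl | rfl
  · exact hdis hp hq
  · exact hdis (hc p hp) hq

/-- The quadratic function splits if the code splits. -/
theorem pairing_self_append {L M : List (Pass × ℝ)}
    (h : ∀ u ∈ L, ∀ w ∈ M, w.1.label ≠ u.1.label) :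
    pairing (L ++ M) (L ++ M) = pairing L L + pairing M M := by
  have h0 : pairing L M = 0 :=
    pairing_eq_zero fun u hu w hw => weight_eq_zero_of_label_ne (h u hu w hw)
  rw [pairing_append_left, pairing_append_right, pairing_append_right, pairing_comm M L, h0]
  ring

theorem strandForm_zero (c : GaussCode) : strandForm c 0 = 0 := by
  have h : ∀ c, ∀ u ∈ trace 0 0 c, u.2 = 0 := by
    intro c
    induction c with
    | nil => simp [trace]
    | cons p c ih => simpa [trace] using ih
  refine List.sum_eq_zero fun x hx => ?_
  obtain ⟨u, hu, rfl⟩ := List.mem_map.1 hx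
  refine List.sum_eq_zero fun x hx => ?_
  obtain ⟨w, hw, rfl⟩ := List.mem_map.1 hx
  simp [h c u hu]

theorem strandForm_congr {c : GaussCode} {v w : CycleSpace} (h1 : v.1 = w.1)
    (h : ∀ p ∈ c, jump p v = jump p w) : strandForm c v = strandForm c w := by
  rw [strandForm, strandForm, h1, trace_congr _ h]

/-- Both directions in one formula: the factor `1 ∓ t` is 2 or 0, according to whether the other
passage of the arc comes before this one. -/
theorem trace_arc (v : CycleSpace) (b : ℝ) (t : ℤˣ) (p q : Pass) :
    (trace v b (arc t p q)).Perm
      [(p, 2 * b + jump p v + (1 - (t : ℤ)) * jump q v),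
        (q, 2 * b + jump q v + (1 + (t : ℤ)) * jump p v)] := by
  rcases Int.units_eq_one_or t with rfl | rfl
  · refine List.Perm.of_eq ?_
    simp [arc, trace]; ring
  · refine (List.Perm.of_eq ?_).trans (List.Perm.swap _ _ _)
    simp [arc, trace]; ring

theorem totalJump_arc (v : CycleSpace) (t : ℤˣ) (p q : Pass) :
    totalJump (arc t p q) v = jump p v + jump q v := by
  rcases Int.units_eq_one_or t with rfl | rfl
  · simp [arc, totalJump]
  · simp [arc, totalJump, add_comm]

theorem arc_perm (t : ℤˣ) (p q : Pass) : (arc t p q).Perm [p, q] := by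
  rcases Int.units_eq_one_or t with rfl | rfl
  · simp [arc]
  · exact List.Perm.swap p q []

/-! ### Invariance under the moves -/

/-- The two passages of a crossing cancel, so the coefficient returns to its initial value after one
turn around the knot. -/
theorem totalJump_eq_zero {c : GaussCode} (h : IsValid c) (v : CycleSpace) : totalJump c v = 0 := by
  have h1 : totalJump c v = ∑ p ∈ c.toFinset, jump p v := by
    rw [List.sum_toFinset _ h.1, totalJump_apply]
  rw [h1]
  refine Finset.sum_involution (fun p _ => p.other) ?_ ?_ ?_ ?_
  · intro p _; rw [jump_other]; ring
  · intro p _ _ h2; simpa [Pass.other] using congrArg Pass.isOver h2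
  · intro p hp; simpa using (h.2 p (by simpa using hp)).1
  · intro p _; simp [Pass.other]

theorem strandForm_rotate {A B : GaussCode} (h : IsValid (A ++ B)) (v : CycleSpace) :
    strandForm (A ++ B) v = strandForm (B ++ A) (v.1 + totalJump A v, v.2) := by
  have h1 := totalJump_eq_zero h v
  rw [totalJump_append, LinearMap.add_apply] at h1
  set w : CycleSpace := (v.1 + totalJump A v, v.2)
  have hw : ∀ p, jump p v = jump p w := fun p => rfl
  have h2 : totalJump B w = totalJump B v := totalJump_congr fun p _ => (hw p).symm
  rw [strandForm, strandForm, trace_append, trace_append, h2,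
    show w.1 + totalJump B v = v.1 by simp only [w]; linarith,
    ← trace_congr w.1 fun p _ => hw p, ← trace_congr v.1 fun p _ => hw p]
  exact pairing_perm List.perm_append_comm List.perm_append_comm

theorem indexShift_rotate {A B : GaussCode} (h : IsValid (A ++ B)) :
    IndexShift (strandForm (A ++ B)) (strandForm (B ++ A)) 0 0 := by
  have h' := h.of_perm List.perm_append_comm
  refine .of_equiv
    (((LinearMap.fst ℝ ℝ (ℕ → ℝ)) + totalJump A).prod (LinearMap.snd ℝ ℝ (ℕ → ℝ)))
    (((LinearMap.fst ℝ ℝ (ℕ → ℝ)) + totalJump B).prod (LinearMap.snd ℝ ℝ (ℕ → ℝ)))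
    (fun v => ?_) (fun v => ?_)
  · rw [strandForm_rotate h]; rfl
  · rw [strandForm_rotate h']; rfl

theorem indexShift_relabel (f : ℕ → ℕ) (hf : Function.Injective f) (c : GaussCode) :
    IndexShift (strandForm c)
      (strandForm (c.map fun p => ⟨f p.label, p.isOver, p.sign⟩)) 0 0 := by
  have key : ∀ v : CycleSpace, strandForm (c.map fun p => ⟨f p.label, p.isOver, p.sign⟩) v =
      strandForm c (v.1, v.2 ∘ f) := by
    intro v
    have h1 : ∀ b, trace v b (c.map fun p => ⟨f p.label, p.isOver, p.sign⟩) =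
        (trace (v.1, v.2 ∘ f) b c).map fun u => (⟨f u.1.label, u.1.isOver, u.1.sign⟩, u.2) := by
      intro b
      induction c generalizing b with
      | nil => rfl
      | cons p c ih => rw [List.map_cons, trace, trace, List.map_cons, ← ih]; rfl
    have h2 : ∀ p q : Pass, weight ⟨f p.label, p.isOver, p.sign⟩ ⟨f q.label, q.isOver, q.sign⟩ =
        weight p q := by
      intro p q
      simp only [weight, Pass.ext_iff, Pass.other, hf.eq_iff]
    simp only [strandForm, h1, pairing, List.map_map, Function.comp_def, h2]
  have hf' : ∀ g : ℕ → ℕ, ∃ E : CycleSpace →ₗ[ℝ] CycleSpace, ∀ v, E v = (v.1, v.2 ∘ g) :=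
    fun g => ⟨LinearMap.prodMap LinearMap.id (LinearMap.funLeft ℝ ℝ g), fun v => rfl⟩
  -- A left inverse of `f` reads the parameters of the old crossings back from the new names;
  -- parameters at other labels play no role.
  obtain ⟨E, hE⟩ := hf' (Function.invFun f)
  obtain ⟨F, hF⟩ := hf' f
  refine .of_equiv E F (fun v => ?_) (fun v => ?_)
  · rw [hE, key]
    simp [Function.comp_assoc, Function.invFun_comp hf]
  · rw [hF, key]

theorem jump_add_smul_of_label_ne (p : Pass) (v : CycleSpace) (t : ℝ) (d : ℕ → ℝ)
    (h : d p.label = 0) : jump p (v + t • (0, d)) = jump p v := by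
  rw [map_add, map_smul, jump_apply p (0, d)]
  simp [h]

theorem strandForm_add_smul {c : GaussCode} (v : CycleSpace) (t : ℝ) (d : ℕ → ℝ)
    (h : ∀ p ∈ c, d p.label = 0) : strandForm c (v + t • (0, d)) = strandForm c v :=
  strandForm_congr (by simp) fun p hp => jump_add_smul_of_label_ne p v t d (h p hp)

/-- At a kink the coefficient rises and falls back by the same amount, so both passages have the
same coefficient sum `l`, and the crossing contributes `2 * s * l²`. The parameter of `x` is free
with respect to `A`. -/
theorem indexShift_kink {x : ℕ} {o : Bool} {s : ℤˣ} {A : GaussCode}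
    (h : IsValid ([⟨x, o, s⟩, ⟨x, !o, s⟩] ++ A)) :
    ∃ a b : ℕ, IndexShift (strandForm ([⟨x, o, s⟩, ⟨x, !o, s⟩] ++ A)) (strandForm A) a b ∧
      (a : ℤ) - b = s := by
  have hne : ∀ q ∈ A, q.label ≠ x := fun q hq =>
    h.label_ne (by simp [Pass.other]) ⟨x, o, s⟩ (by simp) q hq
  let l : CycleSpace →ₗ[ℝ] ℝ := (2 : ℝ) • LinearMap.fst ℝ ℝ (ℕ → ℝ) + jump ⟨x, o, s⟩
  have key : ∀ v, strandForm ([⟨x, o, s⟩, ⟨x, !o, s⟩] ++ A) v =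
      strandForm A v + 2 * (s : ℤ) * l v ^ 2 := by
    intro v
    have h1 : jump ⟨x, !o, s⟩ v = -jump ⟨x, o, s⟩ v := jump_other ⟨x, o, s⟩ v
    rw [strandForm, trace_append]
    have h2 : totalJump [⟨x, o, s⟩, ⟨x, !o, s⟩] v = 0 := by
      simp [totalJump, h1]
    rw [h2, add_zero, pairing_self_append, add_comm]
    · congr 1
      have h3 : (⟨x, o, s⟩ : Pass) = Pass.other ⟨x, !o, s⟩ := by simp [Pass.other]
      simp only [trace, pairing, weight, Pass.other, List.map_cons, List.map_nil, List.sum_cons,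
        List.sum_nil, h1, Pass.mk.injEq, Bool.not_not, Bool.eq_not_self, Bool.not_eq_self,
        l, LinearMap.add_apply, LinearMap.smul_apply, LinearMap.fst_apply]
      simp
      ring
    · intro u hu w hw
      have := hne _ (fst_mem_of_mem_trace hw)
      have h4 := fst_mem_of_mem_trace hu
      simp only [List.mem_cons, List.not_mem_nil, or_false] at h4
      rcases h4 with h4 | h4 <;> rw [h4] <;> exact this
  have hle : l (0, Pi.single x 1) ≠ 0 := by
    cases o <;> simp [l, jump_apply]
  have hQ : ∀ v (t : ℝ), strandForm A (v + t • (0, Pi.single x 1)) = strandForm A v :=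
    fun v t => strandForm_add_smul v t _ fun p hp => by simp [hne p hp]
  rcases Int.units_eq_one_or s with rfl | rfl
  · refine ⟨1, 0, ?_, by simp⟩
    have := IndexShift.add_sq (strandForm_zero A) l _ hle hQ (c := 2) (by norm_num)
    have hk : strandForm ([⟨x, o, 1⟩, ⟨x, !o, 1⟩] ++ A) = fun v => strandForm A v + 2 * l v ^ 2 :=
      funext fun v => by rw [key v]; simp
    rw [hk]; exact this
  · refine ⟨0, 1, ?_, by simp⟩
    have := IndexShift.sub_sq (strandForm_zero A) l _ hle hQ (c := 2) (by norm_num)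
    have hk : strandForm ([⟨x, o, -1⟩, ⟨x, !o, -1⟩] ++ A) = fun v => strandForm A v - 2 * l v ^ 2 :=
      funext fun v => by rw [key v]; simp; ring
    rw [hk]; exact this

/-- The linear coefficient of the change of the quadratic function if the coefficients along `A`
increase. -/
def contract (A : GaussCode) (M : List (Pass × ℝ)) : ℝ :=
  (A.map fun p => (M.map fun w => weight p w.1 * w.2).sum).sum

theorem pairing_shift (L M : List (Pass × ℝ)) (k : ℝ) :
    pairing (L.map fun u => (u.1, u.2 + k)) M =
      pairing L M + k * contract (L.map Prod.fst) M := by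
  induction L with
  | nil => simp [pairing, contract]
  | cons u L ih =>
    rw [List.map_cons, pairing_cons_left, pairing_cons_left, ih]
    simp only [contract, List.map_cons, List.sum_cons, mul_add]
    have : (M.map fun w => weight u.1 w.1 * ((u.2 + k) * w.2)).sum =
        (M.map fun w => weight u.1 w.1 * (u.2 * w.2)).sum +
          k * (M.map fun w => weight u.1 w.1 * w.2).sum := by
      rw [← List.sum_map_mul_left, ← List.sum_map_add]
      congr 1
      exact List.map_congr_left fun w _ => by ring
    linarith

/-- Contraction with a trace, as a linear functional. -/
def contractTrace (A : GaussCode) : (CycleSpace →ₗ[ℝ] ℝ) → GaussCode → CycleSpace →ₗ[ℝ] ℝ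
  | _, [] => 0
  | b, q :: c => (A.map fun p => weight p q).sum • ((2 : ℝ) • b + jump q) +
      contractTrace A (b + jump q) c

theorem contractTrace_apply (A : GaussCode) (b : CycleSpace →ₗ[ℝ] ℝ) (c : GaussCode)
    (v : CycleSpace) : contractTrace A b c v = contract A (trace v (b v) c) := by
  induction c generalizing b with
  | nil => simp [contractTrace, contract, trace]
  | cons q c ih =>
    rw [contractTrace, LinearMap.add_apply, ih, trace]
    simp only [contract, List.map_cons, List.sum_cons, List.sum_map_add, LinearMap.add_apply,
      LinearMap.smul_apply, smul_eq_mul, List.sum_map_mul_right]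

theorem contractTrace_eq_zero (A : GaussCode) (b : CycleSpace →ₗ[ℝ] ℝ) (c : GaussCode)
    {v : CycleSpace} (hb : b v = 0) (hv : ∀ p ∈ c, jump p v = 0) : contractTrace A b c v = 0 := by
  induction c generalizing b with
  | nil => rfl
  | cons q c ih =>
    rw [contractTrace, LinearMap.add_apply, ih _ (by simp [hb, hv q]) fun p hp => hv p (by simp [hp])]
    simp [hb, hv q]

/-- Inserting a bigon raises the coefficients along `A` by the total jump `h` of its first side; the
second side undoes this, so `B` is unaffected. The change consists of terms with the factor `h` and
of the contribution of the two new crossings. -/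
theorem strandForm_bigon {x y : ℕ} {o : Bool} {s t : ℤˣ} {A B : GaussCode} (hxy : x ≠ y)
    (hx : ∀ q ∈ A ++ B, q.label ≠ x) (hy : ∀ q ∈ A ++ B, q.label ≠ y) (v : CycleSpace) :
    ∃ X Y b q h : ℝ, X = jump ⟨x, o, s⟩ v ∧ Y = jump ⟨y, o, -s⟩ v ∧ b = v.1 ∧ h = X + Y ∧
      q = b + h + totalJump A v ∧
    strandForm ([⟨x, o, s⟩, ⟨y, o, -s⟩] ++ A ++ arc t ⟨x, !o, s⟩ ⟨y, !o, -s⟩ ++ B) v =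
      strandForm (A ++ B) v +
      h * (2 * contract A (trace v b A) + 2 * contract A (trace v (b + h) A) +
        4 * contract A (trace v (b + totalJump A v) B)) +
      2 * (s : ℤ) * ((2 * b + X) * (2 * q - X - (1 - (t : ℤ)) * Y) -
        (2 * b + 2 * X + Y) * (2 * q - Y - (1 + (t : ℤ)) * X)) := by
  refine ⟨_, _, _, _, _, rfl, rfl, rfl, rfl, rfl, ?_⟩
  have hX : jump ⟨x, !o, s⟩ v = -jump ⟨x, o, s⟩ v := jump_other ⟨x, o, s⟩ v
  have hY : jump ⟨y, !o, -s⟩ v = -jump ⟨y, o, -s⟩ v := jump_other ⟨y, o, -s⟩ v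
  set X := jump ⟨x, o, s⟩ v
  set Y := jump ⟨y, o, -s⟩ v
  set b := v.1
  set S := totalJump A v
  have h1 : totalJump [⟨x, o, s⟩, ⟨y, o, -s⟩] v = X + Y := by simp [totalJump, X, Y]
  have h2 : totalJump (arc t ⟨x, !o, s⟩ ⟨y, !o, -s⟩) v = -(X + Y) := by
    rw [totalJump_arc, hX, hY]; ring
  have h3 := trace_arc v (b + (X + Y + S)) t ⟨x, !o, s⟩ ⟨y, !o, -s⟩
  rw [hX, hY] at h3
  have h4 : (trace v b ([⟨x, o, s⟩, ⟨y, o, -s⟩] ++ A ++ arc t ⟨x, !o, s⟩ ⟨y, !o, -s⟩ ++ B)).Perm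
      ((trace v b [⟨x, o, s⟩, ⟨y, o, -s⟩] ++ trace v (b + (X + Y + S)) (arc t ⟨x, !o, s⟩ ⟨y, !o, -s⟩)) ++
        (trace v (b + (X + Y)) A ++ trace v (b + S) B)) := by
    rw [trace_append, trace_append, trace_append, totalJump_append ([_, _] ++ A),
      totalJump_append [_, _] A, LinearMap.add_apply, LinearMap.add_apply, LinearMap.add_apply, h1,
      h2, show b + (X + Y + S + -(X + Y)) = b + S by ring]
    simp only [List.append_assoc]
    refine List.Perm.append_left _ ?_
    rw [← List.append_assoc, ← List.append_assoc]
    exact List.Perm.append_right _ List.perm_append_comm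
  have hw : ∀ u w : Pass, u.label ≠ w.label → weight w u = 0 :=
    fun u w h => weight_eq_zero_of_label_ne h
  have h5 : (trace v b [⟨x, o, s⟩, ⟨y, o, -s⟩] ++
      trace v (b + (X + Y + S)) (arc t ⟨x, !o, s⟩ ⟨y, !o, -s⟩)).Perm
      ([(⟨x, o, s⟩, 2 * b + X), (⟨y, o, -s⟩, 2 * b + 2 * X + Y),
        (⟨x, !o, s⟩, 2 * (b + (X + Y + S)) + -X + (1 - (t : ℤ)) * -Y),
        (⟨y, !o, -s⟩, 2 * (b + (X + Y + S)) + -Y + (1 + (t : ℤ)) * -X)]) := by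
    refine (List.Perm.append_left _ h3).trans (List.Perm.of_eq ?_)
    simp only [trace, List.cons_append, List.nil_append]
    congr 3
    simp only [X, Y]; ring
  rw [strandForm, pairing_perm h4 h4, pairing_self_append, pairing_perm h5 h5, strandForm,
    trace_append, trace_add]
  · simp only [pairing_append_left, pairing_append_right]
    rw [pairing_shift, pairing_comm (trace v b A) (List.map _ _), pairing_shift, pairing_shift,
      pairing_comm (trace v (b + S) B) (List.map _ _), pairing_shift, map_fst_trace,
      pairing_comm (trace v (b + S) B) (trace v b A), trace_add]
    have h6 : ∀ M N : ℝ, ∀ P : List (Pass × ℝ), P = [(⟨x, o, s⟩, 2 * b + X),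
        (⟨y, o, -s⟩, 2 * b + 2 * X + Y), (⟨x, !o, s⟩, M), (⟨y, !o, -s⟩, N)] →
        pairing P P = 2 * (s : ℤ) * ((2 * b + X) * M - (2 * b + 2 * X + Y) * N) := by
      rintro M N _ rfl
      simp [pairing, weight, Pass.other, hxy, hxy.symm]
      ring
    rw [h6 _ _ _ rfl]
    ring
  · intro u hu w hw
    have hw' : w.1 ∈ A ++ B := by
      rcases List.mem_append.1 hw with hw | hw <;> simp [fst_mem_of_mem_trace hw]
    have hu' := List.mem_map_of_mem (f := Prod.fst) (h5.mem_iff.1 hu)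
    simp only [List.map_cons, List.map_nil, List.mem_cons, List.not_mem_nil, or_false] at hu'
    rcases hu' with h | h | h | h <;> rw [h]
    · exact hx _ hw'
    · exact hy _ hw'
    · exact hx _ hw'
    · exact hy _ hw'

theorem indexShift_bigon {x y : ℕ} {o : Bool} {s t : ℤˣ} {A B : GaussCode}
    (h : IsValid ([⟨x, o, s⟩, ⟨y, o, -s⟩] ++ A ++ arc t ⟨x, !o, s⟩ ⟨y, !o, -s⟩ ++ B)) :
    IndexShift (strandForm ([⟨x, o, s⟩, ⟨y, o, -s⟩] ++ A ++ arc t ⟨x, !o, s⟩ ⟨y, !o, -s⟩ ++ B))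
      (strandForm (A ++ B)) 1 1 := by
  have hp : (([⟨x, o, s⟩, ⟨y, o, -s⟩] : GaussCode) ++ A ++ arc t ⟨x, !o, s⟩ ⟨y, !o, -s⟩ ++ B).Perm
      (([⟨x, o, s⟩, ⟨y, o, -s⟩, ⟨x, !o, s⟩, ⟨y, !o, -s⟩] : GaussCode) ++ (A ++ B)) := by
    simp only [List.append_assoc]
    refine (List.Perm.append_left _ ?_).trans (List.Perm.of_eq (List.append_assoc _ [_, _] _).symm)
    rw [← List.append_assoc, ← List.append_assoc]
    exact List.Perm.append_right _
      (List.perm_append_comm.trans (List.Perm.append_right _ (arc_perm t _ _)))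
  have hv := h.of_perm hp
  have hl := hv.label_ne (by simp [Pass.other])
  have hx : ∀ q ∈ A ++ B, q.label ≠ x := hl ⟨x, o, s⟩ (by simp)
  have hy : ∀ q ∈ A ++ B, q.label ≠ y := hl ⟨y, o, -s⟩ (by simp)
  have hxy : x ≠ y := by
    rintro rfl
    have := (hv.2 ⟨x, o, s⟩ (by simp)).2 ⟨x, o, -s⟩ (by simp) rfl
    rcases Int.units_eq_one_or s with rfl | rfl <;> simp [Pass.other] at this
  let jX := jump ⟨x, o, s⟩
  let jY := jump ⟨y, o, -s⟩
  let b : CycleSpace →ₗ[ℝ] ℝ := LinearMap.fst ℝ ℝ (ℕ → ℝ)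
  -- The contribution of the two crossings is also divisible by `jX + jY`. The last summand is its
  -- cofactor, which depends on whether the strands are parallel or opposite.
  let l : CycleSpace →ₗ[ℝ] ℝ := (2 : ℝ) • contractTrace A b A +
    (2 : ℝ) • contractTrace A (b + (jX + jY)) A + (4 : ℝ) • contractTrace A (b + totalJump A) B +
    (2 * (s : ℤ) : ℝ) • (if t = 1 then jX - jY - (2 : ℝ) • totalJump A
      else -((4 : ℝ) • b + (3 : ℝ) • jX + jY + (2 : ℝ) • totalJump A))
  have key : strandForm ([⟨x, o, s⟩, ⟨y, o, -s⟩] ++ A ++ arc t ⟨x, !o, s⟩ ⟨y, !o, -s⟩ ++ B) =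
      fun v => strandForm (A ++ B) v + (jX + jY) v * l v := by
    funext v
    obtain ⟨X, Y, b', q, h, rfl, rfl, rfl, rfl, rfl, h1⟩ := strandForm_bigon (o := o) (s := s)
      (t := t) hxy hx hy v
    rw [h1]
    simp only [l, LinearMap.add_apply, LinearMap.smul_apply, contractTrace_apply, smul_eq_mul]
    rcases Int.units_eq_one_or t with rfl | rfl
    · simp only [if_true, LinearMap.sub_apply, LinearMap.smul_apply, b, jX, jY, smul_eq_mul,
        LinearMap.fst_apply]
      push_cast
      ring
    · rw [if_neg (by decide)]
      simp only [LinearMap.neg_apply, LinearMap.add_apply, LinearMap.smul_apply, b, jX, jY,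
        smul_eq_mul, LinearMap.fst_apply]
      push_cast
      ring
  rw [key]
  have hA : ∀ p ∈ A, ∀ d : ℕ → ℝ, (∀ n, n ≠ x → n ≠ y → d n = 0) → jump p (0, d) = 0 :=
    fun p hp d hd => by simp [jump_apply, hd _ (hx p (by simp [hp])) (hy p (by simp [hp]))]
  have hB : ∀ p ∈ B, ∀ d : ℕ → ℝ, (∀ n, n ≠ x → n ≠ y → d n = 0) → jump p (0, d) = 0 :=
    fun p hp d hd => by simp [jump_apply, hd _ (hx p (by simp [hp])) (hy p (by simp [hp]))]
  have hd : ∀ n, n ≠ x → n ≠ y → (Pi.single x 1 - Pi.single y 1 : ℕ → ℝ) n = 0 :=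
    fun n h1 h2 => by simp [h1, h2]
  have hS : totalJump A (0, Pi.single x 1 - Pi.single y 1) = 0 := by
    rw [totalJump_apply]
    refine List.sum_eq_zero fun r hr => ?_
    obtain ⟨p, hp, rfl⟩ := List.mem_map.1 hr
    exact hA p hp _ hd
  have hxe : jX (0, Pi.single x 1 - Pi.single y 1) = if o then 1 else -1 := by
    simp [jX, jump_apply, hxy]
  have hye : jY (0, Pi.single x 1 - Pi.single y 1) = -if o then 1 else -1 := by
    simp [jY, jump_apply, hxy.symm]
  -- The direction `x - y` annihilates the total jump of the side and all contractions, while the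
  -- local cofactor is `±2` on it up to the factor `±2`; the direction `x` alone detects the total
  -- jump.
  refine IndexShift.add_mul (strandForm_zero _) _ l (0, Pi.single x 1 - Pi.single y 1)
    (0, Pi.single x 1) ?_ ?_ ?_ ?_ ?_
  · rw [LinearMap.add_apply, hxe, hye]; ring
  · simp only [l, LinearMap.add_apply, LinearMap.smul_apply]
    rw [contractTrace_eq_zero A _ A (by simp [b]) fun p hp => hA p hp _ hd,
      contractTrace_eq_zero A _ A (by simp [b, hxe, hye]) fun p hp => hA p hp _ hd,
      contractTrace_eq_zero A _ B (by simp [b, hS]) fun p hp => hB p hp _ hd]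
    rcases Int.units_eq_one_or t with rfl | rfl
    · simp only [if_true, LinearMap.sub_apply, LinearMap.smul_apply, hxe, hye, hS]
      rcases Int.units_eq_one_or s with rfl | rfl <;> cases o <;> norm_num
    · rw [if_neg (by decide)]
      simp only [LinearMap.neg_apply, LinearMap.add_apply, LinearMap.smul_apply, hxe, hye, hS, b,
        LinearMap.fst_apply]
      rcases Int.units_eq_one_or s with rfl | rfl <;> cases o <;> norm_num
  · cases o <;> simp [jX, jY, jump_apply, hxy.symm]
  · exact fun v r => strandForm_add_smul v r _ fun p hp => hd _ (hx p hp) (hy p hp)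
  · exact fun v r => strandForm_add_smul v r _ fun p hp => by simp [hx p hp]

theorem IsValid.label_ne_of_isOver_eq {c : GaussCode} (h : IsValid c) {p q : Pass} (hp : p ∈ c)
    (hq : q ∈ c) (hpq : p ≠ q) (ho : p.isOver = q.isOver) : p.label ≠ q.label := by
  intro hl
  rcases (h.2 p hp).2 q hq hl.symm with h1 | h1
  · exact hpq h1.symm
  · rw [h1] at ho
    simp [Pass.other] at ho

theorem interleave_perm {α : Type*} (u₁ a u₂ b u₃ c : List α) :
    (u₁ ++ a ++ u₂ ++ b ++ u₃ ++ c).Perm ((u₁ ++ u₂ ++ u₃) ++ (a ++ b ++ c)) := by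
  rw [← Multiset.coe_eq_coe]
  simp only [← Multiset.coe_add]
  abel

/-- The quadratic function does not change if three parts of the code are replaced, and the
contribution of these parts is not changed. -/
theorem strandForm_replace {U₁ U₂ U₃ U₁' U₂' U₃' A B C : GaussCode} {v w : CycleSpace}
    (h0 : v.1 = w.1) (hR : ∀ p ∈ A ++ B ++ C, jump p v = jump p w)
    (h1 : totalJump U₁ v = totalJump U₁' w) (h2 : totalJump U₂ v = totalJump U₂' w)
    (h3 : totalJump U₃ v = totalJump U₃' w)
    (hl : ∀ p ∈ U₁ ++ U₂ ++ U₃, ∀ q ∈ A ++ B ++ C, q.label ≠ p.label)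
    (hl' : ∀ p ∈ U₁' ++ U₂' ++ U₃', ∀ q ∈ A ++ B ++ C, q.label ≠ p.label)
    (hP : ∀ a b c, pairing (trace v a U₁ ++ trace v b U₂ ++ trace v c U₃)
      (trace v a U₁ ++ trace v b U₂ ++ trace v c U₃) =
      pairing (trace w a U₁' ++ trace w b U₂' ++ trace w c U₃')
      (trace w a U₁' ++ trace w b U₂' ++ trace w c U₃')) :
    strandForm (U₁ ++ A ++ U₂ ++ B ++ U₃ ++ C) v =
      strandForm (U₁' ++ A ++ U₂' ++ B ++ U₃' ++ C) w := by
  have hA : ∀ p ∈ A, jump p v = jump p w := fun p hp => hR p (by simp [hp])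
  have hB : ∀ p ∈ B, jump p v = jump p w := fun p hp => hR p (by simp [hp])
  have hC : ∀ p ∈ C, jump p v = jump p w := fun p hp => hR p (by simp [hp])
  have mem : ∀ {u : CycleSpace} {a b c : ℝ} {X Y Z : GaussCode} {x : Pass × ℝ},
      x ∈ trace u a X ++ trace u b Y ++ trace u c Z → x.1 ∈ X ++ Y ++ Z := by
    intro u a b c X Y Z x hx
    simp only [List.mem_append] at hx ⊢
    exact hx.imp (Or.imp fst_mem_of_mem_trace fst_mem_of_mem_trace) fst_mem_of_mem_trace
  unfold strandForm
  simp only [trace_append]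
  rw [pairing_perm (interleave_perm _ _ _ _ _ _) (interleave_perm _ _ _ _ _ _),
    pairing_perm (interleave_perm (trace w _ _) _ _ _ _ _) (interleave_perm _ _ _ _ _ _),
    pairing_self_append fun x hx y hy => hl _ (mem hx) _ (mem hy),
    pairing_self_append fun x hx y hy => hl' _ (mem hx) _ (mem hy), hP]
  simp only [totalJump_append, LinearMap.add_apply, h0, h1, h2, h3, totalJump_congr hA,
    totalJump_congr hB, trace_congr _ hA, trace_congr _ hB, trace_congr _ hC]

theorem pairing_three {x y z : ℕ} (hxy : x ≠ y) (hxz : x ≠ z) (hyz : y ≠ z) (sx sy sz : ℤˣ)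
    (x₁ x₂ y₁ y₂ z₁ z₂ : ℝ) {P : List (Pass × ℝ)}
    (hP : P.Perm [(⟨x, true, sx⟩, x₁), (⟨y, true, sy⟩, y₁), (⟨z, true, sz⟩, z₁),
      (⟨x, false, sx⟩, x₂), (⟨y, false, sy⟩, y₂), (⟨z, false, sz⟩, z₂)]) :
    pairing P P = 2 * ((sx : ℤ) * (x₁ * x₂) + (sy : ℤ) * (y₁ * y₂) + (sz : ℤ) * (z₁ * z₂)) := by
  rw [pairing_perm hP hP]
  simp [pairing, weight, Pass.other, hxy, hxy.symm, hxz, hxz.symm, hyz, hyz.symm]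
  ring

/-- The change of the parameters under a third Reidemeister move. -/
def triangleMap (x y z : ℕ) : CycleSpace →ₗ[ℝ] CycleSpace :=
  LinearMap.id + (LinearMap.toSpanSingleton ℝ CycleSpace
    (0, (2 : ℝ) • (Pi.single x 1 - Pi.single y 1 + Pi.single z 1))) ∘ₗ jump ⟨y, true, 1⟩

theorem triangleMap_apply (x y z : ℕ) (v : CycleSpace) : triangleMap x y z v =
    v + v.2 y • (0, (2 : ℝ) • (Pi.single x 1 - Pi.single y 1 + Pi.single z 1)) := by
  simp [triangleMap, jump_apply, LinearMap.toSpanSingleton_apply]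

theorem jump_triangleMap_of_ne {x y z : ℕ} {p : Pass} (hx : p.label ≠ x) (hy : p.label ≠ y)
    (hz : p.label ≠ z) (v : CycleSpace) : jump p v = jump p (triangleMap x y z v) := by
  rw [triangleMap_apply, jump_add_smul_of_label_ne]
  simp [hx, hy, hz]

/-- The combinations `x + y`, `z - x` and `y + z` are preserved. They are, up to sign, the total
jumps of the three strands, so coefficients outside the triangle do not change. -/
theorem triangleMap_snd {x y z : ℕ} (hxy : x ≠ y) (hxz : x ≠ z) (hyz : y ≠ z) (v : CycleSpace) :
    (triangleMap x y z v).2 x = v.2 x + 2 * v.2 y ∧ (triangleMap x y z v).2 y = -v.2 y ∧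
      (triangleMap x y z v).2 z = v.2 z + 2 * v.2 y := by
  rw [triangleMap_apply]
  refine ⟨?_, ?_, ?_⟩ <;>
  simp [hxy, hxy.symm, hxz, hxz.symm, hyz, hyz.symm] <;> ring

theorem triangleMap_triangleMap {x y z : ℕ} (hxy : x ≠ y) (hxz : x ≠ z) (hyz : y ≠ z)
    (v : CycleSpace) : triangleMap x y z (triangleMap x y z v) = v := by
  rw [triangleMap_apply, (triangleMap_snd hxy hxz hyz v).2.1, triangleMap_apply,
    neg_smul, add_neg_cancel_right]

theorem pairing_triangle {x y z : ℕ} (hxy : x ≠ y) (hxz : x ≠ z) (hyz : y ≠ z)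
    (t m b sx sy sz : ℤˣ) (v : CycleSpace) (p q r : ℝ) :
    pairing (trace v p (arc t ⟨x, true, sx⟩ ⟨y, true, sy⟩) ++
        trace v q (arc m ⟨z, true, sz⟩ ⟨x, false, sx⟩) ++
        trace v r (arc b ⟨y, false, sy⟩ ⟨z, false, sz⟩))
      (trace v p (arc t ⟨x, true, sx⟩ ⟨y, true, sy⟩) ++
        trace v q (arc m ⟨z, true, sz⟩ ⟨x, false, sx⟩) ++
        trace v r (arc b ⟨y, false, sy⟩ ⟨z, false, sz⟩)) =
    2 * ((sx : ℤ) * ((2 * p + v.2 x + (1 - (t : ℤ)) * v.2 y) *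
        (2 * q - v.2 x + (1 + (m : ℤ)) * v.2 z)) +
      (sy : ℤ) * ((2 * p + v.2 y + (1 + (t : ℤ)) * v.2 x) *
        (2 * r - v.2 y - (1 - (b : ℤ)) * v.2 z)) +
      (sz : ℤ) * ((2 * q + v.2 z - (1 - (m : ℤ)) * v.2 x) *
        (2 * r - v.2 z - (1 + (b : ℤ)) * v.2 y))) := by
  refine pairing_three hxy hxz hyz _ _ _ _ _ _ _ _ _ ?_
  refine ((((trace_arc v p t _ _).append (trace_arc v q m _ _)).append
    (trace_arc v r b _ _))).trans ?_
  simp only [jump_apply, if_true, Bool.false_eq_true, if_false, one_mul, neg_one_mul,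
    List.cons_append, List.nil_append, mul_neg, ← sub_eq_add_neg]
  refine List.Perm.cons _ (List.Perm.cons _ (List.Perm.cons _ (List.Perm.cons _ ?_)))
  exact List.Perm.refl _

/-- With the new parameters this is a polynomial identity for each of the 16 choices of `e`, `t`,
`m`, `b`. The sign conditions of the third Reidemeister move are exactly what enters here. -/
theorem pairing_triangle_eq {x y z : ℕ} (hxy : x ≠ y) (hxz : x ≠ z) (hyz : y ≠ z)
    {e t m b sx sy sz : ℤˣ} (hx : sx = -(e * t * m)) (hy : sy = e * t * b)
    (hz : sz = -(e * m * b)) (v : CycleSpace) (p q r : ℝ) :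
    pairing (trace v p (arc t ⟨x, true, sx⟩ ⟨y, true, sy⟩) ++
        trace v q (arc m ⟨z, true, sz⟩ ⟨x, false, sx⟩) ++
        trace v r (arc b ⟨y, false, sy⟩ ⟨z, false, sz⟩))
      (trace v p (arc t ⟨x, true, sx⟩ ⟨y, true, sy⟩) ++
        trace v q (arc m ⟨z, true, sz⟩ ⟨x, false, sx⟩) ++
        trace v r (arc b ⟨y, false, sy⟩ ⟨z, false, sz⟩)) =
    pairing (trace (triangleMap x y z v) p (arc (-t) ⟨x, true, sx⟩ ⟨y, true, sy⟩) ++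
        trace (triangleMap x y z v) q (arc (-m) ⟨z, true, sz⟩ ⟨x, false, sx⟩) ++
        trace (triangleMap x y z v) r (arc (-b) ⟨y, false, sy⟩ ⟨z, false, sz⟩))
      (trace (triangleMap x y z v) p (arc (-t) ⟨x, true, sx⟩ ⟨y, true, sy⟩) ++
        trace (triangleMap x y z v) q (arc (-m) ⟨z, true, sz⟩ ⟨x, false, sx⟩) ++
        trace (triangleMap x y z v) r (arc (-b) ⟨y, false, sy⟩ ⟨z, false, sz⟩)) := by
  rw [pairing_triangle hxy hxz hyz, pairing_triangle hxy hxz hyz]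
  obtain ⟨h1, h2, h3⟩ := triangleMap_snd hxy hxz hyz v
  rw [h1, h2, h3, hx, hy, hz]
  rcases Int.units_eq_one_or e with rfl | rfl <;> rcases Int.units_eq_one_or t with rfl | rfl <;>
  rcases Int.units_eq_one_or m with rfl | rfl <;> rcases Int.units_eq_one_or b with rfl | rfl <;>
  push_cast <;> ring

theorem arc_triangle_perm (x y z : ℕ) (t m b sx sy sz : ℤˣ) (R : GaussCode) :
    ((arc t ⟨x, true, sx⟩ ⟨y, true, sy⟩ ++ arc m ⟨z, true, sz⟩ ⟨x, false, sx⟩ ++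
      arc b ⟨y, false, sy⟩ ⟨z, false, sz⟩) ++ R).Perm
    (([⟨x, true, sx⟩, ⟨y, true, sy⟩, ⟨z, true, sz⟩, ⟨x, false, sx⟩, ⟨y, false, sy⟩,
      ⟨z, false, sz⟩] : GaussCode) ++ R) :=
  (((arc_perm _ _ _).append (arc_perm _ _ _)).append (arc_perm _ _ _)).append_right _

theorem IsValid.triangle {x y z : ℕ} {sx sy sz : ℤˣ} {R : GaussCode}
    (h : IsValid (([⟨x, true, sx⟩, ⟨y, true, sy⟩, ⟨z, true, sz⟩, ⟨x, false, sx⟩, ⟨y, false, sy⟩,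
      ⟨z, false, sz⟩] : GaussCode) ++ R)) :
    x ≠ y ∧ x ≠ z ∧ y ≠ z ∧ ∀ q ∈ R, q.label ≠ x ∧ q.label ≠ y ∧ q.label ≠ z := by
  have hn := h.1
  simp only [List.cons_append, List.nil_append, List.nodup_cons, List.mem_cons, not_or] at hn
  obtain ⟨⟨h1, h2, -⟩, ⟨h3, -⟩, -⟩ := hn
  refine ⟨h.label_ne_of_isOver_eq (p := ⟨x, true, sx⟩) (q := ⟨y, true, sy⟩) (by simp) (by simp) h1
    rfl, h.label_ne_of_isOver_eq (p := ⟨x, true, sx⟩) (q := ⟨z, true, sz⟩) (by simp) (by simp) h2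
    rfl, h.label_ne_of_isOver_eq (p := ⟨y, true, sy⟩) (q := ⟨z, true, sz⟩) (by simp) (by simp) h3
    rfl, fun q hq => ?_⟩
  have hl := h.label_ne (by simp [Pass.other])
  exact ⟨hl ⟨x, true, sx⟩ (by simp) q hq, hl ⟨y, true, sy⟩ (by simp) q hq,
    hl ⟨z, true, sz⟩ (by simp) q hq⟩

theorem indexShift_of_involution {c c' : GaussCode} (E : CycleSpace →ₗ[ℝ] CycleSpace)
    (hE : ∀ v, E (E v) = v) (h : ∀ v, strandForm c v = strandForm c' (E v)) :
    IndexShift (strandForm c) (strandForm c') 0 0 :=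
  .of_equiv E E (fun v => (h v).symm) fun v => by rw [h, hE]

theorem indexShift_triangle {x y z : ℕ} {e t m b sx sy sz : ℤˣ} {A B C : GaussCode}
    (hx : sx = -(e * t * m)) (hy : sy = e * t * b) (hz : sz = -(e * m * b))
    (h : IsValid (arc t ⟨x, true, sx⟩ ⟨y, true, sy⟩ ++ A ++ arc m ⟨z, true, sz⟩ ⟨x, false, sx⟩ ++ B ++
          arc b ⟨y, false, sy⟩ ⟨z, false, sz⟩ ++ C)) :
    IndexShift
      (strandForm (arc t ⟨x, true, sx⟩ ⟨y, true, sy⟩ ++ A ++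
        arc m ⟨z, true, sz⟩ ⟨x, false, sx⟩ ++ B ++ arc b ⟨y, false, sy⟩ ⟨z, false, sz⟩ ++ C))
      (strandForm (arc (-t) ⟨x, true, sx⟩ ⟨y, true, sy⟩ ++ A ++
        arc (-m) ⟨z, true, sz⟩ ⟨x, false, sx⟩ ++ B ++ arc (-b) ⟨y, false, sy⟩ ⟨z, false, sz⟩ ++ C))
      0 0 := by
  obtain ⟨hxy, hxz, hyz, hR⟩ := ((h.of_perm (interleave_perm _ _ _ _ _ _)).of_perm
    (arc_triangle_perm x y z t m b sx sy sz _)).triangle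
  have hl : ∀ t m b : ℤˣ, ∀ p ∈ arc t ⟨x, true, sx⟩ ⟨y, true, sy⟩ ++
      arc m ⟨z, true, sz⟩ ⟨x, false, sx⟩ ++ arc b ⟨y, false, sy⟩ ⟨z, false, sz⟩,
      ∀ q ∈ A ++ B ++ C, q.label ≠ p.label := by
    intro t m b p hp q hq
    obtain ⟨h1, h2, h3⟩ := hR q hq
    simp only [List.mem_append, (arc_perm _ _ _).mem_iff, List.mem_cons, List.not_mem_nil,
      or_false] at hp
    rcases hp with ((rfl | rfl) | (rfl | rfl)) | (rfl | rfl) <;> assumption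
  obtain h' := triangleMap_snd hxy hxz hyz
  refine indexShift_of_involution (triangleMap x y z) (triangleMap_triangleMap hxy hxz hyz)
    fun v => strandForm_replace ?_ ?_ ?_ ?_ ?_ (hl _ _ _) (hl _ _ _)
      (pairing_triangle_eq hxy hxz hyz hx hy hz v)
  · simp [triangleMap_apply]
  · intro p hp
    obtain ⟨h1, h2, h3⟩ := hR p hp
    exact jump_triangleMap_of_ne h1 h2 h3 v
  all_goals
    rw [totalJump_arc, totalJump_arc]
    simp only [jump_apply, (h' v).1, (h' v).2.1, (h' v).2.2, if_true, Bool.false_eq_true, if_false]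
    ring

theorem indexShift_triangle' {x y z : ℕ} {e t m b sx sy sz : ℤˣ} {A B C : GaussCode}
    (hx : sx = -(e * t * m)) (hy : sy = e * t * b) (hz : sz = -(e * m * b))
    (h : IsValid (arc t ⟨x, true, sx⟩ ⟨y, true, sy⟩ ++ A ++
        arc b ⟨y, false, sy⟩ ⟨z, false, sz⟩ ++ B ++ arc m ⟨z, true, sz⟩ ⟨x, false, sx⟩ ++ C)) :
    IndexShift
      (strandForm (arc t ⟨x, true, sx⟩ ⟨y, true, sy⟩ ++ A ++
        arc b ⟨y, false, sy⟩ ⟨z, false, sz⟩ ++ B ++ arc m ⟨z, true, sz⟩ ⟨x, false, sx⟩ ++ C))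
      (strandForm (arc (-t) ⟨x, true, sx⟩ ⟨y, true, sy⟩ ++ A ++
        arc (-b) ⟨y, false, sy⟩ ⟨z, false, sz⟩ ++ B ++ arc (-m) ⟨z, true, sz⟩ ⟨x, false, sx⟩ ++ C))
      0 0 := by
  have swap : ∀ {α : Type} (u v w : List α), (u ++ v ++ w).Perm (u ++ w ++ v) := fun u v w => by
    simpa only [List.append_assoc] using List.perm_append_comm.append_left u
  obtain ⟨hxy, hxz, hyz, hR⟩ := (((h.of_perm (interleave_perm _ _ _ _ _ _)).of_perm
    ((swap _ _ _).append_right _)).of_perm (arc_triangle_perm x y z t m b sx sy sz _)).triangle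
  have hl : ∀ t m b : ℤˣ, ∀ p ∈ arc t ⟨x, true, sx⟩ ⟨y, true, sy⟩ ++
      arc b ⟨y, false, sy⟩ ⟨z, false, sz⟩ ++ arc m ⟨z, true, sz⟩ ⟨x, false, sx⟩,
      ∀ q ∈ A ++ B ++ C, q.label ≠ p.label := by
    intro t m b p hp q hq
    obtain ⟨h1, h2, h3⟩ := hR q hq
    simp only [List.mem_append, (arc_perm _ _ _).mem_iff, List.mem_cons, List.not_mem_nil,
      or_false] at hp
    rcases hp with ((rfl | rfl) | (rfl | rfl)) | (rfl | rfl) <;> assumption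
  obtain h' := triangleMap_snd hxy hxz hyz
  refine indexShift_of_involution (triangleMap x y z) (triangleMap_triangleMap hxy hxz hyz)
    fun v => strandForm_replace ?_ ?_ ?_ ?_ ?_ (hl _ _ _) (hl _ _ _) fun p q r => ?_
  · simp [triangleMap_apply]
  · intro p hp
    obtain ⟨h1, h2, h3⟩ := hR p hp
    exact jump_triangleMap_of_ne h1 h2 h3 v
  · rw [totalJump_arc, totalJump_arc]
    simp only [jump_apply, (h' v).1, (h' v).2.1, if_true]
    ring
  · rw [totalJump_arc, totalJump_arc]
    simp only [jump_apply, (h' v).2.1, (h' v).2.2, Bool.false_eq_true, if_false]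
    ring
  · rw [totalJump_arc, totalJump_arc]
    simp only [jump_apply, (h' v).1, (h' v).2.2, if_true, Bool.false_eq_true, if_false]
    ring
  -- The pairing ignores the order in which the strands are listed, so the same local identity
  -- covers the order top, bottom, middle.
  · rw [pairing_perm (swap _ _ _) (swap _ _ _),
      pairing_perm (swap (trace (triangleMap x y z v) _ _) _ _) (swap _ _ _)]
    exact pairing_triangle_eq hxy hxz hyz hx hy hz v p r q

/-! ### The signature as a knot invariant -/

/-- The number `k` is twice the signature of the quadratic function, corrected by the writhe. -/
def HasSignature (c : GaussCode) (k : ℤ) : Prop :=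
  ∃ p q : ℕ, IsGreatest {r | PosDim (strandForm c) r} p ∧
    IsGreatest {r | PosDim (fun v => -strandForm c v) r} q ∧ 2 * ((p : ℤ) - q) - signSum c = k

theorem signSum_append (c d : GaussCode) : signSum (c ++ d) = signSum c + signSum d := by
  simp [signSum]

theorem signSum_perm {c d : GaussCode} (h : c.Perm d) : signSum c = signSum d :=
  (h.map _).sum_eq

theorem signSum_arc (t : ℤˣ) (p q : Pass) : signSum (arc t p q) = p.sign + q.sign := by
  rw [signSum_perm (arc_perm t p q)]; simp [signSum]

/-- A shift of the indices is compensated by the writhe. This matters only for kinks, where the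
difference of the indices changes by the sign of the crossing. -/
theorem hasSignature_iff {c d : GaussCode} {a b : ℕ}
    (h : IndexShift (strandForm c) (strandForm d) a b)
    (hs : signSum c = signSum d + 2 * ((a : ℤ) - b)) (k : ℤ) :
    HasSignature c k ↔ HasSignature d k := by
  unfold HasSignature
  simp only [isGreatest_posDim_iff h.1, isGreatest_posDim_iff h.2]
  constructor
  · rintro ⟨_, _, ⟨p, hp, rfl⟩, ⟨q, hq, rfl⟩, rfl⟩
    exact ⟨p, q, hp, hq, by push_cast; linarith⟩
  · rintro ⟨p, q, hp, hq, rfl⟩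
    exact ⟨_, _, ⟨p, hp, rfl⟩, ⟨q, hq, rfl⟩, by push_cast; linarith⟩

/-- Invariance is a property of the codes alone: validity suffices and planarity plays no role. -/
theorem Move.hasSignature_iff {c d : GaussCode} (h : Move c d) (hc : IsValid c) (k : ℤ) :
    HasSignature c k ↔ HasSignature d k := by
  cases h with
  | rotate A B =>
    exact GaussCode.hasSignature_iff (indexShift_rotate hc)
      (by simp [signSum_perm (List.perm_append_comm : (A ++ B).Perm _)]) k
  | relabel f hf c =>
    exact GaussCode.hasSignature_iff (indexShift_relabel f hf c)
      (by simp [signSum, Function.comp_def]) k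
  | reidemeister1 x o s A =>
    obtain ⟨a, b, h, hab⟩ := indexShift_kink hc
    refine GaussCode.hasSignature_iff h ?_ k
    rw [signSum_append, hab]
    simp [signSum]; ring
  | reidemeister2 x y o s t A B =>
    refine GaussCode.hasSignature_iff (indexShift_bigon hc) ?_ k
    simp only [signSum_append, signSum_arc]
    simp [signSum]
  | reidemeister3 x y z e t m b sx sy sz A B C hx hy hz =>
    exact GaussCode.hasSignature_iff (indexShift_triangle hx hy hz hc)
      (by simp only [signSum_append, signSum_arc]; simp) k
  | reidemeister3' x y z e t m b sx sy sz A B C hx hy hz =>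
    exact GaussCode.hasSignature_iff (indexShift_triangle' hx hy hz hc)
      (by simp only [signSum_append, signSum_arc]; simp) k

theorem Isotopic.hasSignature_iff {c d : GaussCode} (h : Isotopic c d) (k : ℤ) :
    HasSignature c k ↔ HasSignature d k := by
  induction h with
  | rel c d h => exact h.2.2.hasSignature_iff h.1.1 k
  | refl c => rfl
  | symm c d _ ih => exact ih.symm
  | trans c d e _ _ ih ih' => exact ih.trans ih'

theorem Isotopic.isValid_iff {c d : GaussCode} (h : Isotopic c d) : IsValid c ↔ IsValid d := by
  induction h with
  | rel c d h => exact iff_of_true h.1.1 h.2.1.1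
  | refl c => rfl
  | symm c d _ ih => exact ih.symm
  | trans c d e _ _ ih ih' => exact ih.trans ih'

theorem hasSignature_nil : HasSignature [] 0 := by
  have h : strandForm [] = 0 := rfl
  have h0 : IsGreatest {r | PosDim (0 : CycleSpace → ℝ) r} 0 := ⟨posDim_zero _, fun r hr =>
    PosDim.le_of_le_sum (fun i : Fin 0 => i.elim0) (fun v _ => le_rfl) hr⟩
  refine ⟨0, 0, h ▸ h0, ?_, rfl⟩
  rwa [show (fun v => -strandForm [] v) = 0 from funext fun v => by simp [h]]

/-! ### Crossing changes -/

theorem IsValid.map {c : GaussCode} (h : IsValid c) {g : Pass → Pass}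
    (hg : Function.Injective g) (hl : ∀ p, (g p).label = p.label)
    (ho : ∀ p, g p.other = (g p).other) : IsValid (c.map g) := by
  refine ⟨h.1.map hg, fun p hp => ?_⟩
  obtain ⟨p, hpc, rfl⟩ := List.mem_map.1 hp
  refine ⟨by rw [← ho]; exact List.mem_map_of_mem (h.2 p hpc).1, fun q hq hpq => ?_⟩
  obtain ⟨q, hqc, rfl⟩ := List.mem_map.1 hq
  rw [← ho, hg.eq_iff, hg.eq_iff]
  exact (h.2 p hpc).2 q hqc (by rwa [hl, hl] at hpq)

theorem Pass.flip_flip (p : Pass) : p.flip.flip = p := by simp [Pass.flip]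

theorem Pass.flip_other (p : Pass) : p.other.flip = p.flip.other := rfl

theorem IsValid.mirror {c : GaussCode} (h : IsValid c) : IsValid (mirror c) :=
  h.map (Function.LeftInverse.injective Pass.flip_flip) (fun _ => rfl) Pass.flip_other

theorem IsValid.changeCrossing {c : GaussCode} (h : IsValid c) (x : ℕ) :
    IsValid (changeCrossing c x) := by
  refine h.map (Function.LeftInverse.injective (g := fun p => if p.label = x then p.flip else p)
    fun p => ?_) (fun p => ?_) fun p => ?_
  · dsimp only
    by_cases hp : p.label = x
    · rw [if_pos hp, if_pos (by exact hp), Pass.flip_flip]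
    · rw [if_neg hp, if_neg hp]
  · split <;> rfl
  · by_cases hp : p.label = x
    · rw [if_pos hp, if_pos (by exact hp), Pass.flip_other]
    · rw [if_neg hp, if_neg (by exact hp)]

/-- The parameters of a cycle after a crossing change. -/
def negateAt (x : ℕ) : CycleSpace →ₗ[ℝ] CycleSpace :=
  LinearMap.prodMap LinearMap.id (LinearMap.pi fun n => (if n = x then -1 else 1 : ℝ) •
    LinearMap.proj n)

theorem negateAt_snd (x n : ℕ) (v : CycleSpace) :
    (negateAt x v).2 n = (if n = x then -1 else 1) * v.2 n := rfl

theorem negateAt_negateAt (x : ℕ) (v : CycleSpace) : negateAt x (negateAt x v) = v := by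
  refine Prod.ext rfl (funext fun n => ?_)
  rw [negateAt_snd, negateAt_snd]
  split <;> ring

/-- A crossing change swaps over and under and thus reverses the jumps at `x`; negating the
parameter restores them, so the same cycle is described in both diagrams. -/
theorem trace_changeCrossing (c : GaussCode) (x : ℕ) (v : CycleSpace) (b : ℝ) :
    trace (negateAt x v) b (changeCrossing c x) =
      (trace v b c).map fun u => (if u.1.label = x then u.1.flip else u.1, u.2) := by
  induction c generalizing b with
  | nil => rfl
  | cons p c ih =>
    have h : jump (if p.label = x then p.flip else p) (negateAt x v) = jump p v := by
      split
      · next hp => cases h : p.isOver <;> simp [jump_apply, Pass.flip, negateAt_snd, hp, h]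
      · next hp => simp [jump_apply, negateAt_snd, hp]
    rw [trace, List.map_cons, ← ih, ← h]
    rfl

theorem snd_eq_of_mem_trace {c₁ c₂ : GaussCode} {p : Pass} (h : (c₁ ++ p :: c₂).Nodup)
    {v : CycleSpace} {b : ℝ} {u : Pass × ℝ} (hu : u ∈ trace v b (c₁ ++ p :: c₂)) (hp : u.1 = p) :
    u.2 = 2 * (b + totalJump c₁ v) + jump p v := by
  rw [trace_append, trace, List.mem_append, List.mem_cons] at hu
  have h1 := List.nodup_middle.1 h
  rw [List.nodup_cons, List.mem_append, not_or] at h1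
  rcases hu with hu | rfl | hu
  · exact absurd (hp ▸ fst_mem_of_mem_trace hu) h1.1.1
  · rfl
  · exact absurd (hp ▸ fst_mem_of_mem_trace hu) h1.1.2

/-- Only the term of the changed crossing differs, and it has the coefficient sum along the strand
through `p` as a factor. This sum is `l`, so the two functions agree on its kernel. -/
theorem strandForm_changeCrossing {c : GaussCode} (h : IsValid c) {p : Pass} (hp : p ∈ c) :
    ∃ l : CycleSpace →ₗ[ℝ] ℝ, ∀ v, l v = 0 →
      strandForm (changeCrossing c p.label) (negateAt p.label v) = strandForm c v := by
  obtain ⟨c₁, c₂, rfl⟩ := List.append_of_mem hp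
  refine ⟨(2 : ℝ) • (LinearMap.fst ℝ ℝ (ℕ → ℝ) + totalJump c₁) + jump p, fun v hv => ?_⟩
  have h0 : ∀ u ∈ trace v v.1 (c₁ ++ p :: c₂), u.1 = p → u.2 = 0 := fun u hu hup =>
    (snd_eq_of_mem_trace h.1 hu hup).trans hv
  rw [strandForm, strandForm, show (negateAt p.label v).1 = v.1 from rfl, trace_changeCrossing]
  simp only [pairing, List.map_map, Function.comp_def]
  congr 1
  refine List.map_congr_left fun u hu => ?_
  congr 1
  refine List.map_congr_left fun w hw => ?_
  by_cases hul : u.1.label = p.label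
  · rcases (h.2 p hp).2 u.1 (fst_mem_of_mem_trace hu) hul with h1 | h1
    · rw [h0 u hu h1]; ring
    by_cases hwl : w.1.label = p.label
    · rcases (h.2 p hp).2 w.1 (fst_mem_of_mem_trace hw) hwl with h2 | h2
      · rw [h0 w hw h2]; ring
      · have h3 : p.other ≠ p.other.other := fun h => by
          simpa [Pass.other] using congrArg Pass.isOver h
        have h4 : p.other.flip ≠ p.other.flip.other := fun h => by
          simpa [Pass.other, Pass.flip] using congrArg Pass.isOver h
        rw [if_pos hul, if_pos hwl, h1, h2, weight, if_neg h4, weight, if_neg h3]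
    · rw [weight_eq_zero_of_label_ne, weight_eq_zero_of_label_ne]
      · rwa [hul]
      · rw [if_neg hwl, if_pos hul]
        exact fun h => hwl (h.trans hul)
  · rw [if_neg hul]
    by_cases hwl : w.1.label = p.label
    · rw [weight_eq_zero_of_label_ne, weight_eq_zero_of_label_ne]
      · rw [hwl]; exact Ne.symm hul
      · rw [if_pos hwl]
        exact fun h => hul (h.symm.trans hwl)
    · rw [if_neg hwl]

theorem signSum_changeCrossing {c : GaussCode} (h : IsValid c) {p : Pass} (hp : p ∈ c) :
    signSum (changeCrossing c p.label) = signSum c - 4 * (p.sign : ℤ) := by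
  have h1 : p.other ≠ p := fun h => by simpa [Pass.other] using congrArg Pass.isOver h
  have h2 : c.Perm ([p, p.other] ++ (c.erase p).erase p.other) :=
    (List.perm_cons_erase hp).trans
      ((List.perm_cons_erase ((List.mem_erase_of_ne h1).2 (h.2 p hp).1)).cons p)
  have h3 := (h.of_perm h2).label_ne (by simp [Pass.other]) p (by simp)
  have h4 : changeCrossing ((c.erase p).erase p.other) p.label = (c.erase p).erase p.other :=
    (List.map_congr_left fun q hq => if_neg (h3 q hq)).trans (List.map_id' _)
  have h5 : changeCrossing ([p, p.other] ++ (c.erase p).erase p.other) p.label =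
      [p.flip, p.other.flip] ++ changeCrossing ((c.erase p).erase p.other) p.label := by
    simp [changeCrossing, Pass.other]
  have h6 : (changeCrossing c p.label).Perm
    (changeCrossing ([p, p.other] ++ (c.erase p).erase p.other) p.label) := h2.map _
  rw [signSum_perm h2, signSum_perm h6, h5, h4, signSum_append, signSum_append]
  simp [signSum, Pass.flip, Pass.other]
  ring

theorem exists_isGreatest_posDim_near {V : Type*} [AddCommGroup V] [Module ℝ V] {Q Q' : V → ℝ}
    (h : ∀ r, PosDim Q (r + 1) → PosDim Q' r) (h' : ∀ r, PosDim Q' (r + 1) → PosDim Q r) {p' : ℕ}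
    (hp' : IsGreatest {r | PosDim Q' r} p') :
    ∃ p, IsGreatest {r | PosDim Q r} p ∧ p ≤ p' + 1 ∧ p' ≤ p + 1 := by
  have key : ∀ r, PosDim Q r → r ≤ p' + 1 := fun r hr => by
    cases r with
    | zero => omega
    | succ r => exact Nat.succ_le_succ (hp'.2 (h r hr))
  obtain ⟨p, hp⟩ := exists_isGreatest_posDim key
  refine ⟨p, hp, key p hp.1, ?_⟩
  cases p' with
  | zero => omega
  | succ p' => exact Nat.succ_le_succ (hp.2 (h' p' hp'.1))

/-- Each index changes by at most 1, which alters `2 * (p - q)` by at most 4; the sign sum changes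
by exactly 4. -/
theorem HasSignature.of_changeCrossing {c : GaussCode} (h : IsValid c) {x : ℕ}
    (hx : ∃ p ∈ c, p.label = x) {k : ℤ} (hk : HasSignature (changeCrossing c x) k) :
    ∃ k', HasSignature c k' ∧ |k' - k| ≤ 8 := by
  obtain ⟨p, hp, rfl⟩ := hx
  obtain ⟨l, hl⟩ := strandForm_changeCrossing h hp
  have hl' : ∀ v, (l ∘ₗ negateAt p.label) v = 0 → strandForm c (negateAt p.label v) =
      strandForm (changeCrossing c p.label) v := fun v hv => by
    rw [← hl _ hv, negateAt_negateAt]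
  obtain ⟨a', b', ha', hb', rfl⟩ := hk
  obtain ⟨a, ha, h1, h2⟩ := exists_isGreatest_posDim_near (fun r hr => hr.of_eq_on_ker _ l hl)
    (fun r hr => hr.of_eq_on_ker _ _ hl') ha'
  obtain ⟨b, hb, h3, h4⟩ := exists_isGreatest_posDim_near
    (fun r hr => hr.of_eq_on_ker _ l fun v hv => by rw [hl v hv])
    (fun r hr => hr.of_eq_on_ker _ _ fun v hv => by rw [hl' v hv]) hb'
  refine ⟨_, ⟨a, b, ha, hb, rfl⟩, ?_⟩
  rw [signSum_changeCrossing h hp, abs_le]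
  rcases Int.units_eq_one_or p.sign with hs | hs <;> rw [hs] <;> push_cast <;> omega

theorem UnknotsIn.exists_hasSignature {n : ℕ} {c : GaussCode} (h : UnknotsIn n c)
    (hc : IsValid c) : ∃ k, HasSignature c k ∧ |k| ≤ 8 * n := by
  induction h with
  | isotopy h => exact ⟨0, (h.hasSignature_iff 0).2 hasSignature_nil, by simp⟩
  | change h hx _ ih =>
    have hd := h.isValid_iff.1 hc
    obtain ⟨k, hk, hn⟩ := ih (hd.changeCrossing _)
    obtain ⟨k', hk', hkk⟩ := hk.of_changeCrossing hd hx
    refine ⟨k', (h.hasSignature_iff k').2 hk', ?_⟩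
    have := abs_sub_abs_le_abs_sub k' k
    push_cast
    linarith

theorem two_le_unknottingNumber {c : GaussCode} (hc : IsValid c)
    (h : ∀ k, HasSignature c k → 8 < |k|) : 2 ≤ unknottingNumber c := by
  refine le_iInf₂ fun n hn => ?_
  obtain ⟨k, hk, hkn⟩ := hn.exists_hasSignature hc
  have h8 := h k hk
  have h2 : 2 ≤ n := by omega
  exact_mod_cast h2

/-! ### Mirror images -/

theorem sum_map_neg {α R : Type*} [Ring R] (l : List α) (f : α → R) :
    (l.map fun x => -f x).sum = -(l.map f).sum := by
  induction l with
  | nil => simp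
  | cons a l ih => simp [ih, add_comm]

/-- Negated parameters give the same coefficients on the mirror image, and all crossing signs are
reversed. -/
theorem strandForm_mirror (c : GaussCode) (v : CycleSpace) :
    strandForm (mirror c) (v.1, -v.2) = -strandForm c v := by
  have h1 : ∀ b, trace (v.1, -v.2) b (mirror c) =
      (trace v b c).map fun u => (u.1.flip, u.2) := by
    intro b
    induction c generalizing b with
    | nil => rfl
    | cons p c ih =>
      have h : jump p.flip (v.1, -v.2) = jump p v := by
        cases h : p.isOver <;> simp [jump_apply, Pass.flip, h]
      rw [trace, List.map_cons, ← ih, ← h]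
      rfl
  have h2 : ∀ p q : Pass, weight p.flip q.flip = -weight p q := by
    intro p q
    by_cases h : q = p.other
    · rw [weight, weight, if_pos h, if_pos (by rw [h]; rfl)]
      simp [Pass.flip]
    · rw [weight, weight, if_neg h, if_neg, neg_zero]
      intro h'
      rw [← Pass.flip_other] at h'
      exact h ((Function.LeftInverse.injective Pass.flip_flip) h')
  rw [strandForm, strandForm, h1]
  simp only [pairing, List.map_map, Function.comp_def, h2, neg_mul, sum_map_neg]

theorem HasSignature.of_mirror {c : GaussCode} {k : ℤ} (h : HasSignature (mirror c) k) :
    HasSignature c (-k) := by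
  have hm : ∀ v, strandForm c (v.1, -v.2) = -strandForm (mirror c) v := fun v => by
    have := strandForm_mirror c (v.1, -v.2)
    rw [neg_neg] at this
    rw [this, neg_neg]
  let E : CycleSpace →ₗ[ℝ] CycleSpace := LinearMap.prodMap LinearMap.id (-LinearMap.id)
  have h1 := IndexShift.of_equiv (Q₁ := strandForm c) (Q₂ := fun v => -strandForm (mirror c) v) E E
    (fun v => by rw [show E v = (v.1, -v.2) from rfl, strandForm_mirror, neg_neg]) fun v => hm v
  obtain ⟨p, q, hp, hq, rfl⟩ := h
  have hs : signSum (mirror c) = -signSum c := by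
    simp [signSum, mirror, Pass.flip, Function.comp_def, sum_map_neg]
  have h2 := (isGreatest_posDim_iff h1.1 q).2 ⟨q, hq, rfl⟩
  have h3 := (isGreatest_posDim_iff h1.2 p).2 ⟨p, by simpa only [neg_neg] using hp, rfl⟩
  exact ⟨q, p, h2, h3, by rw [hs]; ring⟩

/-! ### The unknotting numbers of `5₁` and `8₂` -/

/-- Diagonalization by completing squares: one positive and four negative squares of independent
linear forms. -/
theorem strandForm_fiveOne (v : CycleSpace) : strandForm fiveOne v =
      2 * (10 * v.1 + v.2 1 - 2 * v.2 2 + 4 * v.2 3 - 6 * v.2 4 + 8 * v.2 5) ^ 2 -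
        6 * (-10/3 * v.1 + v.2 2 - 2 * v.2 3 + 8/3 * v.2 4 - 10/3 * v.2 5) ^ 2 -
        6 * (10/3 * v.1 + v.2 3 - 2 * v.2 4 + 8/3 * v.2 5) ^ 2 -
        10/3 * (-2 * v.1 + v.2 4 - 2 * v.2 5) ^ 2 -
        10/3 * (2 * v.1 + v.2 5) ^ 2 := by
  simp [strandForm, fiveOne, trace, pairing, weight, Pass.other, jump_apply]
  ring

theorem strandForm_eightTwo (v : CycleSpace) : strandForm eightTwo v =
      2 * (-2 * v.1 + v.2 1 - 4 * v.2 3 - 4 * v.2 4 - 4 * v.2 5 + 2 * v.2 6 + 4 * v.2 7 + 4 * v.2 8) ^ 2 +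
        2 * (38 * v.1 - 12 * v.2 3 + v.2 4 + 20 * v.2 5 + 14 * v.2 6 + 6 * v.2 7 - 10 * v.2 8) ^ 2 -
        2 * (-10 * v.1 + v.2 2 - 4 * v.2 4 - 8 * v.2 5 - 2 * v.2 6 + 2 * v.2 7 + 6 * v.2 8) ^ 2 -
        94 * (246/47 * v.1 - 86/47 * v.2 3 + 126/47 * v.2 5 + 96/47 * v.2 6 + v.2 7 - 60/47 * v.2 8) ^ 2 -
        154/47 * (-26/11 * v.1 + v.2 3 - 68/77 * v.2 5 - 10/7 * v.2 6 + 10/77 * v.2 8) ^ 2 -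
        22/7 * (42/11 * v.1 + 18/11 * v.2 5 + v.2 6 - 8/11 * v.2 8) ^ 2 -
        34/11 * (-2 * v.1 - 2 * v.2 5 + v.2 8) ^ 2 -
        34/11 * (2 * v.1 + v.2 5) ^ 2 := by
  simp [strandForm, eightTwo, trace, pairing, weight, Pass.other, jump_apply]
  ring

theorem isValid_fiveOne : IsValid fiveOne := by
  unfold IsValid
  decide

theorem isValid_eightTwo : IsValid eightTwo := by
  unfold IsValid
  decide +kernel

/-- The coefficient of a 1-cycle before the base point. -/
abbrev baseCoeff : CycleSpace →ₗ[ℝ] ℝ := LinearMap.fst ℝ ℝ (ℕ → ℝ)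

/-- The increase of the coefficient at the over passage of a crossing. -/
abbrev overJump (n : ℕ) : CycleSpace →ₗ[ℝ] ℝ := LinearMap.proj n ∘ₗ LinearMap.snd ℝ ℝ (ℕ → ℝ)

theorem lt_abs_of_hasSignature_fiveOne {k : ℤ} (h : HasSignature fiveOne k) : 8 < |k| := by
  obtain ⟨p, q, hp, hq, rfl⟩ := h
  have h1 : p ≤ 1 := by
    refine hp.1.le_of_le_sum ![(10 : ℝ) • baseCoeff + overJump 1 - (2 : ℝ) • overJump 2 +
      (4 : ℝ) • overJump 3 - (6 : ℝ) • overJump 4 + (8 : ℝ) • overJump 5] fun v hv => ?_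
    have h0 := hv 0
    simp at h0
    rw [strandForm_fiveOne, h0]
    nlinarith only [sq_nonneg (-10/3 * v.1 + v.2 2 - 2 * v.2 3 + 8/3 * v.2 4 - 10/3 * v.2 5),
      sq_nonneg (10/3 * v.1 + v.2 3 - 2 * v.2 4 + 8/3 * v.2 5),
      sq_nonneg (-2 * v.1 + v.2 4 - 2 * v.2 5), sq_nonneg (2 * v.1 + v.2 5)]
  have h2 : 1 ≤ q := by
    -- Equal parameters at 1 and 2 and nothing else describe the cycle supported on the two edges
    -- between these crossings, around a bigon; the function is `-4 * x 0 ^ 2` on it.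
    refine hq.2 ⟨LinearMap.prod 0 (LinearMap.pi fun n => if n = 1 ∨ n = 2 then LinearMap.proj 0
      else 0), fun x hx => ?_⟩
    have h0 : x 0 ≠ 0 := fun h => hx (funext fun i => by fin_cases i; exact h)
    simp [strandForm_fiveOne]
    have := sq_pos_of_ne_zero h0
    nlinarith
  have h3 : signSum fiveOne = 10 := by decide
  rw [h3, lt_abs]
  -- The bounds on `p` and `q` give `k ≤ -10`.
  omega

theorem lt_abs_of_hasSignature_eightTwo {k : ℤ} (h : HasSignature eightTwo k) : 8 < |k| := by
  obtain ⟨p, q, hp, hq, rfl⟩ := h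
  have h1 : p ≤ 2 := by
    refine hp.1.le_of_le_sum ![-(2 : ℝ) • baseCoeff + overJump 1 - (4 : ℝ) • overJump 3 -
      (4 : ℝ) • overJump 4 - (4 : ℝ) • overJump 5 + (2 : ℝ) • overJump 6 + (4 : ℝ) • overJump 7 +
      (4 : ℝ) • overJump 8, (38 : ℝ) • baseCoeff - (12 : ℝ) • overJump 3 + overJump 4 +
      (20 : ℝ) • overJump 5 + (14 : ℝ) • overJump 6 + (6 : ℝ) • overJump 7 -
      (10 : ℝ) • overJump 8] fun v hv => ?_
    have h0 := hv 0
    have h1 := hv 1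
    simp at h0 h1
    have key : ∀ a b c d e f : ℝ, 2 * (0 : ℝ) ^ 2 + 2 * 0 ^ 2 - 2 * a ^ 2 - 94 * b ^ 2 -
        154/47 * c ^ 2 - 22/7 * d ^ 2 - 34/11 * e ^ 2 - 34/11 * f ^ 2 ≤ 0 := fun a b c d e f => by
      linarith [sq_nonneg a, sq_nonneg b, sq_nonneg c, sq_nonneg d, sq_nonneg e, sq_nonneg f]
    rw [strandForm_eightTwo, neg_mul, h0, h1]
    exact key _ _ _ _ _ _
  have h2 : 3 ≤ q := by
    -- Again cycles supported on the two edges between two crossings, now for the disjoint pairs 2,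
    -- 6 and 3, 7 and 4, 8.
    refine hq.2 ⟨LinearMap.prod 0 (LinearMap.pi fun n => if n = 2 ∨ n = 6 then LinearMap.proj 0
      else if n = 3 ∨ n = 7 then LinearMap.proj 1 else if n = 4 ∨ n = 8 then LinearMap.proj 2
      else 0), fun x hx => ?_⟩
    simp [strandForm_eightTwo]
    have h0 : 0 < x 0 ^ 2 + x 1 ^ 2 + x 2 ^ 2 := by
      by_contra h
      refine hx (funext fun i => ?_)
      fin_cases i <;> dsimp <;> nlinarith [sq_nonneg (x 0), sq_nonneg (x 1), sq_nonneg (x 2)]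
    nlinarith
  have h3 : signSum eightTwo = 8 := by decide
  rw [h3, lt_abs]
  omega

theorem two_le_unknottingNumber_mirror {c : GaussCode} (hc : IsValid c)
    (h : ∀ k, HasSignature c k → 8 < |k|) : 2 ≤ unknottingNumber (mirror c) :=
  two_le_unknottingNumber hc.mirror fun k hk => by simpa using h _ hk.of_mirror

theorem unknottingNumber_fiveOne : unknottingNumber fiveOne = 2 :=
  le_antisymm unknottingNumber_fiveOne_le
    (two_le_unknottingNumber isValid_fiveOne fun _ => lt_abs_of_hasSignature_fiveOne)

theorem unknottingNumber_mirror_fiveOne : unknottingNumber (mirror fiveOne) = 2 :=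
  le_antisymm unknottingNumber_mirror_fiveOne_le
    (two_le_unknottingNumber_mirror isValid_fiveOne fun _ => lt_abs_of_hasSignature_fiveOne)

theorem unknottingNumber_eightTwo : unknottingNumber eightTwo = 2 :=
  le_antisymm unknottingNumber_eightTwo_le
    (two_le_unknottingNumber isValid_eightTwo fun _ => lt_abs_of_hasSignature_eightTwo)

theorem unknottingNumber_mirror_eightTwo : unknottingNumber (mirror eightTwo) = 2 :=
  le_antisymm unknottingNumber_mirror_eightTwo_le
    (two_le_unknottingNumber_mirror isValid_eightTwo fun _ => lt_abs_of_hasSignature_eightTwo)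

end GaussCode
end KnotTheory

namespace KnotTheory

/-- A map along which `Q` is positive is injective because `Q 0 = 0`, so its image is a positive
definite subspace of dimension `r`. -/
theorem posDim_iff_le_sigPos {V : Type*} [AddCommGroup V] [Module ℝ V] [FiniteDimensional ℝ V]
    (Q : QuadraticForm ℝ V) (r : ℕ) : PosDim (fun v => Q v) r ↔ r ≤ sigPos Q := by
  constructor
  · rintro ⟨f, hf⟩
    have hinj : Function.Injective f := by
      rw [injective_iff_map_eq_zero]
      intro x hx
      by_contra h
      exact absurd (hf x h) (by simp [hx])
    have hr : Module.finrank ℝ (LinearMap.range f) = r := by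
      rw [LinearMap.finrank_range_of_inj hinj, Module.finrank_fin_fun]
    rw [← hr]
    refine le_sigPos_of_posDef Q fun v hv => ?_
    obtain ⟨x, hx⟩ := v.2
    rw [QuadraticMap.restrict_apply, ← hx]
    refine hf x fun h => hv (Subtype.ext ?_)
    rw [← hx, h, map_zero]; rfl
  · intro h
    obtain ⟨W, hW, hpos⟩ := exists_finrank_eq_sigPos_and_posDef Q
    exact .of_finrank W.subtype (fun u hu => hpos u hu) (by rwa [hW])

namespace GaussCode

/-! ### The Seifert form in terms of the parameters of a cycle -/

/-- The passages of a part of a code, with the coefficients before and after the passages. -/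
def edgeCoeffs (v : CycleSpace) : ℝ → GaussCode → List (Pass × ℝ × ℝ)
  | _, [] => []
  | b, p :: c => (p, b, b + jump p v) :: edgeCoeffs v (b + jump p v) c

/-- The value of the Seifert form at a cycle with the given coefficients. -/
def seifertSum (L : List (Pass × ℝ × ℝ)) : ℝ :=
  (L.map fun u => (L.map fun w =>
    if u.1.label = w.1.label ∧ u.1.isOver = true ∧ w.1.isOver = false then
      if u.1.sign = 1 then (u.2.2 - w.2.1) * w.2.1 else (w.2.2 - u.2.1) * w.2.2
    else 0).sum).sum

/-- The cycle with given parameters. -/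
def cycleOf (c : GaussCode) : CycleSpace →ₗ[ℝ] Fin c.length → ℝ :=
  LinearMap.pi fun i => LinearMap.fst ℝ ℝ (ℕ → ℝ) + totalJump (c.take (i + 1))

theorem cycleOf_apply (c : GaussCode) (v : CycleSpace) (i : Fin c.length) :
    cycleOf c v i = v.1 + totalJump (c.take (i + 1)) v := rfl

theorem edgeCoeffs_eq (c : GaussCode) (v : CycleSpace) (b : ℝ) :
    edgeCoeffs v b c = List.ofFn fun i : Fin c.length =>
      (c.get i, b + totalJump (c.take i) v, b + totalJump (c.take (i + 1)) v) := by
  induction c generalizing b with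
  | nil => rfl
  | cons p c ih =>
    rw [edgeCoeffs, ih]
    simp only [List.length_cons, List.ofFn_succ]
    simp [totalJump_cons, totalJump_nil, add_assoc]

theorem totalJump_take_succ (c : GaussCode) {k : ℕ} (hk : k < c.length) (v : CycleSpace) :
    totalJump (c.take (k + 1)) v = totalJump (c.take k) v + jump (c.get ⟨k, hk⟩) v := by
  rw [List.take_succ_eq_append_getElem hk, totalJump_append, LinearMap.add_apply, totalJump_cons,
    totalJump_nil, add_zero]
  rfl

theorem prev_zero {c : GaussCode} (h : 0 < c.length) :
    prev c ⟨0, h⟩ = ⟨c.length - 1, by omega⟩ := by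
  refine Fin.ext ?_
  simp only [prev, zero_add]
  exact Nat.mod_eq_of_lt (by omega)

theorem prev_succ {c : GaussCode} {k : ℕ} (h : k + 1 < c.length) :
    prev c ⟨k + 1, h⟩ = ⟨k, by omega⟩ := by
  refine Fin.ext ?_
  simp only [prev]
  rw [show k + 1 + c.length - 1 = k + c.length by omega, Nat.add_mod_right]
  exact Nat.mod_eq_of_lt (by omega)

theorem cycleOf_prev {c : GaussCode} (hc : IsValid c) (v : CycleSpace) (i : Fin c.length) :
    cycleOf c v (prev c i) = v.1 + totalJump (c.take i) v := by
  obtain ⟨k, hk⟩ := i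
  cases k with
  | zero =>
    rw [prev_zero hk, cycleOf_apply]
    simp only
    -- The predecessor of the first position is the last one; there the total jump of the whole code
    -- has accumulated, which is zero.
    rw [show c.length - 1 + 1 = c.length by omega, List.take_length, totalJump_eq_zero hc]
    simp [totalJump_nil]
  | succ k => rw [prev_succ hk]; rfl

theorem cycleOf_eq_add_jump {c : GaussCode} (hc : IsValid c) (v : CycleSpace) (i : Fin c.length) :
    cycleOf c v i = cycleOf c v (prev c i) + jump (c.get i) v := by
  rw [cycleOf_prev hc, cycleOf_apply, totalJump_take_succ c i.2, add_assoc]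

theorem IsValid.get_eq_other {c : GaussCode} (hc : IsValid c) {i j : Fin c.length} (hij : i ≠ j)
    (h : (c.get i).label = (c.get j).label) : c.get j = (c.get i).other := by
  rcases (hc.2 _ (c.get_mem i)).2 _ (c.get_mem j) h.symm with h1 | h1
  · exact absurd (hc.1.injective_get h1).symm hij
  · exact h1

theorem cycleOf_mem {c : GaussCode} (hc : IsValid c) (v : CycleSpace) : cycleOf c v ∈ cycles c := by
  intro i j hij h
  rw [cycleOf_eq_add_jump hc v i, cycleOf_eq_add_jump hc v j, hc.get_eq_other hij h, jump_other]
  ring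

theorem seifertForm_cycleOf {c : GaussCode} (hc : IsValid c) (v : CycleSpace) :
    seifertForm c (cycleOf c v) (cycleOf c v) = seifertSum (edgeCoeffs v v.1 c) := by
  rw [seifertSum, edgeCoeffs_eq, List.map_ofFn, List.sum_ofFn]
  simp only [seifertForm, LinearMap.sum_apply]
  refine Finset.sum_congr rfl fun i _ => ?_
  simp only [Function.comp_apply, List.map_ofFn, List.sum_ofFn]
  refine Finset.sum_congr rfl fun j _ => ?_
  split
  · split
    · simp [LinearMap.BilinForm.linMulLin, edge, cycleOf_prev hc, cycleOf_apply]
      ring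
    · simp [LinearMap.BilinForm.linMulLin, edge, cycleOf_prev hc, cycleOf_apply]
      ring
  · simp

/-- The parameters of a cycle. -/
noncomputable def cycleParam (c : GaussCode) (h : 0 < c.length) :
    (Fin c.length → ℝ) →ₗ[ℝ] CycleSpace :=
  LinearMap.prod (LinearMap.proj ⟨c.length - 1, by omega⟩)
    (LinearMap.pi fun x => ∑ i : Fin c.length,
      if (c.get i).label = x ∧ (c.get i).isOver = true then edge c i - edge c (prev c i) else 0)

/-- The parameters are read off at the over passages; at an under passage the jump is then forced by
conservation of flow at the crossing. -/
theorem jump_cycleParam {c : GaussCode} (hc : IsValid c) (h : 0 < c.length)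
    {a : Fin c.length → ℝ} (ha : a ∈ cycles c) (i : Fin c.length) :
    jump (c.get i) (cycleParam c h a) = a i - a (prev c i) := by
  have key : ∀ j : Fin c.length, (c.get j).isOver = true →
      (cycleParam c h a).2 (c.get j).label = a j - a (prev c j) := by
    intro j hj
    have h1 : (cycleParam c h a).2 (c.get j).label = ∑ i : Fin c.length,
      if (c.get i).label = (c.get j).label ∧ (c.get i).isOver = true then
        a i - a (prev c i) else 0 := by
      simp only [cycleParam, LinearMap.prod_apply, Function.prod_apply, LinearMap.pi_apply,
        LinearMap.sum_apply]
      refine Finset.sum_congr rfl fun i _ => ?_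
      split <;> rfl
    rw [h1, Finset.sum_eq_single j]
    · rw [if_pos ⟨rfl, hj⟩]
    · intro i _ hij
      refine if_neg fun h2 => ?_
      have h3 := hc.get_eq_other hij h2.1
      rw [h3] at hj
      simp [Pass.other, -List.get_eq_getElem, h2.2] at hj
    · simp
  cases ho : (c.get i).isOver with
  | true => rw [jump_apply, if_pos ho, one_mul, key i ho]
  | false =>
    obtain ⟨j, hj⟩ := List.get_of_mem (hc.2 _ (c.get_mem i)).1
    have hjo : (c.get j).isOver = true := by rw [hj]; simp [Pass.other, -List.get_eq_getElem, ho]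
    have hl : (c.get j).label = (c.get i).label := by rw [hj]; rfl
    have hij : i ≠ j := by
      rintro rfl
      rw [ho] at hjo
      exact Bool.false_ne_true hjo
    have := ha i j hij hl.symm
    rw [jump_apply, ho, ← hl, key j hjo]
    simp only [Bool.false_eq_true, if_false]
    linarith

theorem cycleOf_cycleParam {c : GaussCode} (hc : IsValid c) (h : 0 < c.length)
    {a : Fin c.length → ℝ} (ha : a ∈ cycles c) : cycleOf c (cycleParam c h a) = a := by
  have key : ∀ k (hk : k < c.length), cycleOf c (cycleParam c h a) ⟨k, hk⟩ = a ⟨k, hk⟩ := by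
    intro k
    induction k with
    | zero =>
      intro hk
      rw [cycleOf_eq_add_jump hc, jump_cycleParam hc h ha, cycleOf_prev hc, prev_zero hk]
      simp [totalJump_nil, cycleParam]
    | succ k ih =>
      intro hk
      rw [cycleOf_eq_add_jump hc, jump_cycleParam hc h ha, prev_succ hk, ih]
      ring
  exact funext fun i => key i i.2

/-- `cycleOf` maps onto the cycles with `cycleParam` as a section, and both respect the form.
Parameters of absent crossings lie in the kernel and do not affect the index. The factor `t` is used
with `1` and `-1`. -/
theorem posDim_seifert_iff {c : GaussCode} (hc : IsValid c) (h : 0 < c.length) (t : ℝ) (r : ℕ) :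
    PosDim (fun a => t * seifertQuadraticForm c a) r ↔
      PosDim (fun v : CycleSpace => t * seifertSum (edgeCoeffs v v.1 c)) r := by
  constructor
  · refine fun hr => hr.comp (cycleParam c h ∘ₗ (cycles c).subtype) fun a => ?_
    rw [← seifertForm_cycleOf hc, LinearMap.comp_apply, Submodule.subtype_apply,
      cycleOf_cycleParam hc h a.2]
    rfl
  · refine fun hr => hr.comp ((cycleOf c).codRestrict _ (cycleOf_mem hc)) fun v => ?_
    rw [← seifertForm_cycleOf hc]
    rfl

theorem le_sigPos_iff {c : GaussCode} (hc : IsValid c) (h : 0 < c.length) (r : ℕ) :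
    r ≤ sigPos (seifertQuadraticForm c) ↔
      PosDim (fun v : CycleSpace => seifertSum (edgeCoeffs v v.1 c)) r := by
  rw [← posDim_iff_le_sigPos]
  simpa only [one_mul] using posDim_seifert_iff hc h 1 r

theorem le_sigNeg_iff {c : GaussCode} (hc : IsValid c) (h : 0 < c.length) (r : ℕ) :
    r ≤ sigNeg (seifertQuadraticForm c) ↔
      PosDim (fun v : CycleSpace => -seifertSum (edgeCoeffs v v.1 c)) r := by
  rw [← sigPos_neg, ← posDim_iff_le_sigPos]
  have := posDim_seifert_iff hc h (-1) r
  simp only [neg_one_mul] at this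
  exact this

/-! ### The signatures of the connected sums -/

/-- Even labels belong to `5₁` and odd labels to `8₂`, so the squares split between the summands:
four negative ones from `5₁`, five positive and one negative from the mirrored `8₂`. The coefficient
`v.1` drops out because it adds a multiple of the knot itself, the sum of all Seifert circles, which
is trivial on the surface. -/
theorem seifertSum_connSum_fiveOne_mirror_eightTwo (v : CycleSpace) :
    seifertSum (edgeCoeffs v v.1 (connSum fiveOne (mirror eightTwo))) =
      2 * (1/4 * v.2 7 + v.2 9 + 1/4 * v.2 11 - 3/4 * v.2 15 - 3/4 * v.2 17) ^ 2 +
        7/8 * (-8/7 * v.2 5 - 9/7 * v.2 7 + v.2 11 + 8/7 * v.2 13 + v.2 15 - 5/7 * v.2 17) ^ 2 +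
        (-v.2 5 - 1/2 * v.2 7 + v.2 11 + v.2 13 - 1/2 * v.2 17) ^ 2 +
        5/28 * (6/5 * v.2 5 + v.2 7 - 6/5 * v.2 13 - v.2 17) ^ 2 +
        17/20 * (v.2 5 - v.2 13) ^ 2 -
        2 * (v.2 2 - 3/4 * v.2 4 + 1/4 * v.2 6 + 1/4 * v.2 8 - 3/4 * v.2 10) ^ 2 -
        7/8 * (v.2 4 - 9/7 * v.2 6 + v.2 8 - 5/7 * v.2 10) ^ 2 -
        (-1/2 * v.2 6 + v.2 8 - 1/2 * v.2 10) ^ 2 -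
        5/28 * (v.2 6 - v.2 10) ^ 2 -
        (v.2 3 + 1/2 * v.2 5 - v.2 7 - v.2 9 - v.2 11 - 1/2 * v.2 13 + v.2 15 + v.2 17) ^ 2 := by
  simp [seifertSum, connSum, mirror, fiveOne, eightTwo, edgeCoeffs, Pass.flip, jump_apply]
  ring

theorem seifertSum_connSum_fiveOne_eightTwo (v : CycleSpace) :
    seifertSum (edgeCoeffs v v.1 (connSum fiveOne eightTwo)) =
      (v.2 3 - 1/2 * v.2 5 - v.2 7 - v.2 9 - v.2 11 + 1/2 * v.2 13 + v.2 15 + v.2 17) ^ 2 -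
        2 * (v.2 2 - 3/4 * v.2 4 + 1/4 * v.2 6 + 1/4 * v.2 8 - 3/4 * v.2 10) ^ 2 -
        7/8 * (v.2 4 - 9/7 * v.2 6 + v.2 8 - 5/7 * v.2 10) ^ 2 -
        (-1/2 * v.2 6 + v.2 8 - 1/2 * v.2 10) ^ 2 -
        5/28 * (v.2 6 - v.2 10) ^ 2 -
        2 * (1/4 * v.2 7 + v.2 9 + 1/4 * v.2 11 - 3/4 * v.2 15 - 3/4 * v.2 17) ^ 2 -
        7/8 * (-8/7 * v.2 5 - 9/7 * v.2 7 + v.2 11 + 8/7 * v.2 13 + v.2 15 - 5/7 * v.2 17) ^ 2 -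
        (-v.2 5 - 1/2 * v.2 7 + v.2 11 + v.2 13 - 1/2 * v.2 17) ^ 2 -
        5/28 * (6/5 * v.2 5 + v.2 7 - 6/5 * v.2 13 - v.2 17) ^ 2 -
        17/20 * (v.2 5 - v.2 13) ^ 2 := by
  simp [seifertSum, connSum, fiveOne, eightTwo, edgeCoeffs, jump_apply]
  ring

theorem seifertSum_connSum_mirror_fiveOne_mirror_eightTwo (v : CycleSpace) :
    seifertSum (edgeCoeffs v v.1 (connSum (mirror fiveOne) (mirror eightTwo))) =
      2 * (v.2 2 - 3/4 * v.2 4 + 1/4 * v.2 6 + 1/4 * v.2 8 - 3/4 * v.2 10) ^ 2 +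
        7/8 * (v.2 4 - 9/7 * v.2 6 + v.2 8 - 5/7 * v.2 10) ^ 2 +
        (-1/2 * v.2 6 + v.2 8 - 1/2 * v.2 10) ^ 2 +
        5/28 * (v.2 6 - v.2 10) ^ 2 +
        2 * (1/4 * v.2 7 + v.2 9 + 1/4 * v.2 11 - 3/4 * v.2 15 - 3/4 * v.2 17) ^ 2 +
        7/8 * (-8/7 * v.2 5 - 9/7 * v.2 7 + v.2 11 + 8/7 * v.2 13 + v.2 15 - 5/7 * v.2 17) ^ 2 +
        (-v.2 5 - 1/2 * v.2 7 + v.2 11 + v.2 13 - 1/2 * v.2 17) ^ 2 +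
        5/28 * (6/5 * v.2 5 + v.2 7 - 6/5 * v.2 13 - v.2 17) ^ 2 +
        17/20 * (v.2 5 - v.2 13) ^ 2 -
        (v.2 3 + 1/2 * v.2 5 - v.2 7 - v.2 9 - v.2 11 - 1/2 * v.2 13 + v.2 15 + v.2 17) ^ 2 := by
  simp [seifertSum, connSum, mirror, fiveOne, eightTwo, edgeCoeffs, Pass.flip, jump_apply]
  ring

/-- The weights are those of the diagonalizations above. Only the fifth varies: it is `17/20` for
the last square in the odd labels and `1` elsewhere. -/
theorem eq_zero_of_not_sum_sq_pos {w a b c d e : ℝ} (hw : 0 < w)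
    (h : ¬ 0 < 2 * a ^ 2 + 7/8 * b ^ 2 + c ^ 2 + 5/28 * d ^ 2 + w * e ^ 2) :
    a = 0 ∧ b = 0 ∧ c = 0 ∧ d = 0 ∧ e = 0 := by
  have he := mul_nonneg hw.le (sq_nonneg e)
  have he' : w * e ^ 2 = 0 := le_antisymm
    (by linarith [sq_nonneg a, sq_nonneg b, sq_nonneg c, sq_nonneg d]) he
  have key : ∀ x : ℝ, x ^ 2 ≤ 0 → x = 0 := fun x hx =>
    pow_eq_zero_iff two_ne_zero |>.1 (le_antisymm hx (sq_nonneg x))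
  refine ⟨key a ?_, key b ?_, key c ?_, key d ?_, key e ?_⟩
  · linarith [sq_nonneg a, sq_nonneg b, sq_nonneg c, sq_nonneg d]
  · linarith [sq_nonneg a, sq_nonneg b, sq_nonneg c, sq_nonneg d]
  · linarith [sq_nonneg a, sq_nonneg b, sq_nonneg c, sq_nonneg d]
  · linarith [sq_nonneg a, sq_nonneg b, sq_nonneg c, sq_nonneg d]
  · exact ((mul_eq_zero.1 he').resolve_left hw.ne').le

theorem isValid_connSum_fiveOne_mirror_eightTwo : IsValid (connSum fiveOne (mirror eightTwo)) := by
  unfold IsValid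
  decide +kernel

theorem isValid_connSum_fiveOne_eightTwo : IsValid (connSum fiveOne eightTwo) := by
  unfold IsValid
  decide +kernel

theorem isValid_connSum_mirror_fiveOne_mirror_eightTwo :
    IsValid (connSum (mirror fiveOne) (mirror eightTwo)) := by
  unfold IsValid
  decide +kernel

theorem sigPos_connSum_fiveOne_mirror_eightTwo_le :
    sigPos (seifertQuadraticForm (connSum fiveOne (mirror eightTwo))) ≤ 5 := by
  have h := (le_sigPos_iff isValid_connSum_fiveOne_mirror_eightTwo (by decide) _).1 le_rfl
  refine PosDim.le_of_le_sum ![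
      (1/4 : ℝ) • overJump 7 + overJump 9 + (1/4 : ℝ) • overJump 11 - (3/4 : ℝ) • overJump 15 -
        (3/4 : ℝ) • overJump 17,
      (-8/7 : ℝ) • overJump 5 - (9/7 : ℝ) • overJump 7 + overJump 11 +
        (8/7 : ℝ) • overJump 13 + overJump 15 - (5/7 : ℝ) • overJump 17,
      -overJump 5 - (1/2 : ℝ) • overJump 7 + overJump 11 + overJump 13 -
        (1/2 : ℝ) • overJump 17,
      (6/5 : ℝ) • overJump 5 + overJump 7 - (6/5 : ℝ) • overJump 13 - overJump 17,
      overJump 5 - overJump 13] (fun v hv => ?_) h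
  have h0 : 1/4 * v.2 7 + v.2 9 + 1/4 * v.2 11 - 3/4 * v.2 15 - 3/4 * v.2 17 = 0 := by
    simpa using hv 0
  have h1 : -8/7 * v.2 5 - 9/7 * v.2 7 + v.2 11 + 8/7 * v.2 13 + v.2 15 - 5/7 * v.2 17 = 0 := by
    simpa using hv 1
  have h2 : -v.2 5 - 1/2 * v.2 7 + v.2 11 + v.2 13 - 1/2 * v.2 17 = 0 := by
    simpa using hv 2
  have h3 : 6/5 * v.2 5 + v.2 7 - 6/5 * v.2 13 - v.2 17 = 0 := by
    simpa using hv 3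
  have h4 : v.2 5 - v.2 13 = 0 := by
    simpa using hv 4
  have key : ∀ a b c d e : ℝ, 2 * (0 : ℝ) ^ 2 + 7/8 * 0 ^ 2 + 0 ^ 2 + 5/28 * 0 ^ 2 +
    17/20 * 0 ^ 2 - 2 * a ^ 2 - 7/8 * b ^ 2 - c ^ 2 - 5/28 * d ^ 2 - e ^ 2 ≤ 0 := fun a b c d e => by
    linarith [sq_nonneg a, sq_nonneg b, sq_nonneg c, sq_nonneg d, sq_nonneg e]
  rw [seifertSum_connSum_fiveOne_mirror_eightTwo, h0, h1, h2, h3, h4]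
  exact key _ _ _ _ _

theorem sigNeg_connSum_fiveOne_mirror_eightTwo_le :
    sigNeg (seifertQuadraticForm (connSum fiveOne (mirror eightTwo))) ≤ 5 := by
  have h := (le_sigNeg_iff isValid_connSum_fiveOne_mirror_eightTwo (by decide) _).1 le_rfl
  refine PosDim.le_of_le_sum ![
      overJump 2 - (3/4 : ℝ) • overJump 4 + (1/4 : ℝ) • overJump 6 + (1/4 : ℝ) • overJump 8 -
        (3/4 : ℝ) • overJump 10,
      overJump 4 - (9/7 : ℝ) • overJump 6 + overJump 8 - (5/7 : ℝ) • overJump 10,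
      (-1/2 : ℝ) • overJump 6 + overJump 8 - (1/2 : ℝ) • overJump 10,
      overJump 6 - overJump 10,
      overJump 3 + (1/2 : ℝ) • overJump 5 - overJump 7 - overJump 9 - overJump 11 -
        (1/2 : ℝ) • overJump 13 + overJump 15 + overJump 17] (fun v hv => ?_) h
  have h0 : v.2 2 - 3/4 * v.2 4 + 1/4 * v.2 6 + 1/4 * v.2 8 - 3/4 * v.2 10 = 0 := by
    simpa using hv 0
  have h1 : v.2 4 - 9/7 * v.2 6 + v.2 8 - 5/7 * v.2 10 = 0 := by
    simpa using hv 1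
  have h2 : -1/2 * v.2 6 + v.2 8 - 1/2 * v.2 10 = 0 := by
    simpa using hv 2
  have h3 : v.2 6 - v.2 10 = 0 := by
    simpa using hv 3
  have h4 : v.2 3 + 1/2 * v.2 5 - v.2 7 - v.2 9 - v.2 11 - 1/2 * v.2 13 + v.2 15 + v.2 17 =
      0 := by
    simpa using hv 4
  have key : ∀ a b c d e : ℝ, -(2 * a ^ 2 + 7/8 * b ^ 2 + c ^ 2 + 5/28 * d ^ 2 +
    17/20 * e ^ 2 - 2 * 0 ^ 2 - 7/8 * 0 ^ 2 - 0 ^ 2 - 5/28 * 0 ^ 2 - 0 ^ 2) ≤ 0 := fun a b c d e => by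
    linarith [sq_nonneg a, sq_nonneg b, sq_nonneg c, sq_nonneg d, sq_nonneg e]
  rw [seifertSum_connSum_fiveOne_mirror_eightTwo, h0, h1, h2, h3, h4]
  exact key _ _ _ _ _

theorem sigPos_connSum_fiveOne_eightTwo_le :
    sigPos (seifertQuadraticForm (connSum fiveOne eightTwo)) ≤ 1 := by
  have h := (le_sigPos_iff isValid_connSum_fiveOne_eightTwo (by decide) _).1 le_rfl
  refine PosDim.le_of_le_sum ![
      overJump 3 - (1/2 : ℝ) • overJump 5 - overJump 7 - overJump 9 - overJump 11 +
        (1/2 : ℝ) • overJump 13 + overJump 15 + overJump 17] (fun v hv => ?_) h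
  have h0 : v.2 3 - 1/2 * v.2 5 - v.2 7 - v.2 9 - v.2 11 + 1/2 * v.2 13 + v.2 15 + v.2 17 =
      0 := by
    simpa using hv 0
  have key : ∀ a b c d e f g h i : ℝ, (0 : ℝ) ^ 2 - 2 * a ^ 2 - 7/8 * b ^ 2 - c ^ 2 -
    5/28 * d ^ 2 - 2 * e ^ 2 - 7/8 * f ^ 2 - g ^ 2 - 5/28 * h ^ 2 - 17/20 * i ^ 2 ≤ 0 :=
    fun a b c d e f g h i => by
    linarith [sq_nonneg a, sq_nonneg b, sq_nonneg c, sq_nonneg d, sq_nonneg e, sq_nonneg f,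
      sq_nonneg g, sq_nonneg h, sq_nonneg i]
  rw [seifertSum_connSum_fiveOne_eightTwo, h0]
  exact key _ _ _ _ _ _ _ _ _

theorem sigNeg_connSum_mirror_fiveOne_mirror_eightTwo_le :
    sigNeg (seifertQuadraticForm (connSum (mirror fiveOne) (mirror eightTwo))) ≤ 1 := by
  have h := (le_sigNeg_iff isValid_connSum_mirror_fiveOne_mirror_eightTwo (by decide) _).1 le_rfl
  refine PosDim.le_of_le_sum ![
      overJump 3 + (1/2 : ℝ) • overJump 5 - overJump 7 - overJump 9 - overJump 11 -
        (1/2 : ℝ) • overJump 13 + overJump 15 + overJump 17] (fun v hv => ?_) h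
  have h0 : v.2 3 + 1/2 * v.2 5 - v.2 7 - v.2 9 - v.2 11 - 1/2 * v.2 13 + v.2 15 + v.2 17 =
      0 := by
    simpa using hv 0
  have key : ∀ a b c d e f g h i : ℝ, -(2 * a ^ 2 + 7/8 * b ^ 2 + c ^ 2 + 5/28 * d ^ 2 +
    2 * e ^ 2 + 7/8 * f ^ 2 + g ^ 2 + 5/28 * h ^ 2 + 17/20 * i ^ 2 - 0 ^ 2) ≤ 0 := fun a b c d e
    f g h i => by
    linarith [sq_nonneg a, sq_nonneg b, sq_nonneg c, sq_nonneg d, sq_nonneg e, sq_nonneg f,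
      sq_nonneg g, sq_nonneg h, sq_nonneg i]
  rw [seifertSum_connSum_mirror_fiveOne_mirror_eightTwo, h0]
  exact key _ _ _ _ _ _ _ _ _

theorem five_le_sigPos_connSum_fiveOne_mirror_eightTwo :
    5 ≤ sigPos (seifertQuadraticForm (connSum fiveOne (mirror eightTwo))) := by
  rw [le_sigPos_iff isValid_connSum_fiveOne_mirror_eightTwo (by decide)]
  -- The parameters at 13, 17 and the even labels are zero, and the one at 3 is solved for so that
  -- the negative square in the odd labels vanishes. The five positive squares then determine `x`.
  refine ⟨LinearMap.prod 0 (LinearMap.pi fun n => if n = 5 then LinearMap.proj 0 else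
    if n = 7 then LinearMap.proj 1 else if n = 11 then LinearMap.proj 2 else
    if n = 15 then LinearMap.proj 3 else if n = 9 then LinearMap.proj 4 else
    if n = 3 then (-1/2 : ℝ) • (LinearMap.proj 0 : (Fin 5 → ℝ) →ₗ[ℝ] ℝ) +
      LinearMap.proj 1 + LinearMap.proj 2 - LinearMap.proj 3 + LinearMap.proj 4 else 0), fun x hx => ?_⟩
  by_contra h
  simp only [seifertSum_connSum_fiveOne_mirror_eightTwo] at h
  obtain ⟨h0, h1, h2, h3, h4⟩ := eq_zero_of_not_sum_sq_pos (w := 17/20)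
    (a := 1/4 * x 1 + x 4 + 1/4 * x 2 - 3/4 * x 3)
    (b := -8/7 * x 0 - 9/7 * x 1 + x 2 + x 3) (c := -x 0 - 1/2 * x 1 + x 2)
    (d := 6/5 * x 0 + x 1) (e := x 0) (by norm_num) (by convert h using 2; simp; ring)
  exact hx (funext fun i => by fin_cases i <;> simp <;> linarith)

theorem five_le_sigNeg_connSum_fiveOne_mirror_eightTwo :
    5 ≤ sigNeg (seifertQuadraticForm (connSum fiveOne (mirror eightTwo))) := by
  rw [le_sigNeg_iff isValid_connSum_fiveOne_mirror_eightTwo (by decide)]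
  -- Label 10 is set to zero, and label 3 occurs only in the negative square of the odd labels; so
  -- the positive squares vanish and the five negative ones determine `x`.
  refine ⟨LinearMap.prod 0 (LinearMap.pi fun n => if n = 2 then LinearMap.proj 0 else
    if n = 4 then LinearMap.proj 1 else if n = 6 then LinearMap.proj 2 else
    if n = 8 then LinearMap.proj 3 else if n = 3 then LinearMap.proj 4 else 0), fun x hx => ?_⟩
  by_contra h
  simp only [seifertSum_connSum_fiveOne_mirror_eightTwo] at h
  obtain ⟨h0, h1, h2, h3, h4⟩ := eq_zero_of_not_sum_sq_pos (w := 1)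
    (a := x 0 - 3/4 * x 1 + 1/4 * x 2 + 1/4 * x 3) (b := x 1 - 9/7 * x 2 + x 3)
    (c := -1/2 * x 2 + x 3) (d := x 2) (e := x 4) (by norm_num) (by convert h using 2; simp; ring)
  exact hx (funext fun i => by fin_cases i <;> simp <;> linarith)

/-- Two dimensions are enough, since the positive index is at most 1. -/
theorem two_le_sigNeg_connSum_fiveOne_eightTwo :
    2 ≤ sigNeg (seifertQuadraticForm (connSum fiveOne eightTwo)) := by
  rw [le_sigNeg_iff isValid_connSum_fiveOne_eightTwo (by decide)]
  refine ⟨LinearMap.prod 0 (LinearMap.pi fun n => if n = 2 then LinearMap.proj 0 else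
    if n = 4 then LinearMap.proj 1 else 0), fun x hx => ?_⟩
  by_contra h
  simp only [seifertSum_connSum_fiveOne_eightTwo] at h
  obtain ⟨h0, h1, -⟩ := eq_zero_of_not_sum_sq_pos (w := 1)
    (a := x 0 - 3/4 * x 1) (b := x 1) (c := 0) (d := 0) (e := 0) (by norm_num)
    (by convert h using 2; simp; ring)
  exact hx (funext fun i => by fin_cases i <;> simp <;> linarith)

theorem two_le_sigPos_connSum_mirror_fiveOne_mirror_eightTwo :
    2 ≤ sigPos (seifertQuadraticForm (connSum (mirror fiveOne) (mirror eightTwo))) := by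
  rw [le_sigPos_iff isValid_connSum_mirror_fiveOne_mirror_eightTwo (by decide)]
  refine ⟨LinearMap.prod 0 (LinearMap.pi fun n => if n = 2 then LinearMap.proj 0 else
    if n = 4 then LinearMap.proj 1 else 0), fun x hx => ?_⟩
  by_contra h
  simp only [seifertSum_connSum_mirror_fiveOne_mirror_eightTwo] at h
  obtain ⟨h0, h1, -⟩ := eq_zero_of_not_sum_sq_pos (w := 1)
    (a := x 0 - 3/4 * x 1) (b := x 1) (c := 0) (d := 0) (e := 0) (by norm_num)
    (by convert h using 2; simp)
  exact hx (funext fun i => by fin_cases i <;> simp <;> linarith)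

theorem signature_connSum_fiveOne_mirror_eightTwo :
    signature (connSum fiveOne (mirror eightTwo)) = 0 := by
  have h1 := sigPos_connSum_fiveOne_mirror_eightTwo_le
  have h2 := sigNeg_connSum_fiveOne_mirror_eightTwo_le
  have h3 := five_le_sigPos_connSum_fiveOne_mirror_eightTwo
  have h4 := five_le_sigNeg_connSum_fiveOne_mirror_eightTwo
  unfold signature
  omega

theorem signature_connSum_fiveOne_eightTwo_ne : signature (connSum fiveOne eightTwo) ≠ 0 := by
  have h1 := sigPos_connSum_fiveOne_eightTwo_le
  have h2 := two_le_sigNeg_connSum_fiveOne_eightTwo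
  unfold signature
  omega

theorem signature_connSum_mirror_fiveOne_mirror_eightTwo_ne :
    signature (connSum (mirror fiveOne) (mirror eightTwo)) ≠ 0 := by
  have h1 := sigNeg_connSum_mirror_fiveOne_mirror_eightTwo_le
  have h2 := two_le_sigPos_connSum_mirror_fiveOne_mirror_eightTwo
  unfold signature
  omega

end GaussCode
end KnotTheory

/-! ### The theorem -/

open KnotTheory.GaussCode in
theorem theorem1p2 :
    (∃ A B : KnotTheory.GaussCode,
      (A = fiveOne ∨ A = mirror fiveOne) ∧ (B = eightTwo ∨ B = mirror eightTwo) ∧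
        signature (connSum A B) = 0) ∧
    ∀ A B : KnotTheory.GaussCode,
      (A = fiveOne ∨ A = mirror fiveOne) → (B = eightTwo ∨ B = mirror eightTwo) →
      signature (connSum A B) = 0 →
        unknottingNumber A = 2 ∧ unknottingNumber B = 2 ∧
        unknottingNumber (connSum A B) ≤ 3 ∧
        unknottingNumber (connSum A B) < unknottingNumber A + unknottingNumber B := by
  have lt : ∀ {a b c : ℕ∞}, a = 2 → b = 2 → c ≤ 3 → a = 2 ∧ b = 2 ∧ c ≤ 3 ∧ c < a + b := by
    rintro a b c rfl rfl hc
    exact ⟨rfl, rfl, hc, hc.trans_lt (by norm_num)⟩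
  refine ⟨⟨fiveOne, mirror eightTwo, .inl rfl, .inr rfl,
    signature_connSum_fiveOne_mirror_eightTwo⟩, ?_⟩
  -- The signature condition rules out the sums with neither or both of the knots mirrored. For the
  -- two others the bound 3 lies below `2 + 2`.
  rintro A B (rfl | rfl) (rfl | rfl) h
  · exact absurd h signature_connSum_fiveOne_eightTwo_ne
  · exact lt unknottingNumber_fiveOne unknottingNumber_mirror_eightTwo
      unknottingNumber_connSum_fiveOne_mirror_eightTwo_le
  · exact lt unknottingNumber_mirror_fiveOne unknottingNumber_eightTwo
      unknottingNumber_connSum_mirror_fiveOne_eightTwo_le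
  · exact absurd h signature_connSum_mirror_fiveOne_mirror_eightTwo_ne
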